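/- Let $k$ be a field, $H$ a Hopf algebra over $k$ (with comultiplication $\Delta$ and counit $\varepsilon$), and let $A/B$ be an $H$-Galois extension of $k$-algebras: $A$ is a right $H$-comodule via an algebra map $\rho:A\to A\otimes H$, $\rho(a)=\sum a_{\langle0\rangle}\otimes a_{\langle1\rangle}$, $B=\{a\in A\mid \rho(a)=a\otimes 1\}$, and the canonical map $\beta:A\otimes_BA\to A\otimes H$, $x\otimes_B y\mapsto\sum xy_{\langle0\rangle}\otimes y_{\langle1\rangle}$, is bijective. Let $A_B=A/[A,B]$, where $[A,B]$ is the subspace spanned by all $ab-ba$ with $a\in A$, $b\in B$, and write $\bar a$ for the class of $a$. Then $A_B$ is a right $H$-comodule via $\bar a\mapsto\sum\overline{a_{\langle0\rangle}}\otimes a_{\langle1\rangle}$ and a left $H$-module via $h\bar a=\sum\overline{\kappa^2(h)\,a\,\kappa^1(h)}$, where $\sum\kappa^1(h)\otimes_B\kappa^2(h)=\beta^{-1}(1\otimes h)$. Let $Z_*(A/B)$ be the cyclic $k$-module with $Z_n(A/B)=A\widehat\otimes_B\cdots\widehat\otimes_BA=(A^{\otimes_B(n+1)})_B$ ($n+1$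 factors; the quotient of $A^{\otimes_B(n+1)}$ by the commutators with $B$), whose face maps multiply adjacent factors ($d_i$ multiplies $a^i$ and $a^{i+1}$ for $i<n$, and $d_n(a^0\widehat\otimes\cdots\widehat\otimes a^n)=a^na^0\widehat\otimes a^1\widehat\otimes\cdots\widehat\otimes a^{n-1}$), whose degeneracy $s_i$ inserts $1$ after $a^i$, and whose cyclic operator is $t_n(a^0\widehat\otimes\cdots\widehat\otimes a^n)=a^n\widehat\otimes a^0\widehat\otimes\cdots\widehat\otimes a^{n-1}$. Let $Z_*(H,A_B)$ be the simplicial $k$-module with $Z_n(H,A_B)=H^{\otimes(n+1)}\otimes_HA_B$, where $H$ acts on the right of $H^{\otimes(n+1)}$ diagonally, with faces $\delta_i((h^0,\dots,h^n)\otimes_H\bar a)=\varepsilon(h^i)(h^0,\dots,\widehat{h^i},\dots,h^n)\otimes_H\bar a$ and degeneracies $\sigma_i((h^0,\dots,h^n)\otimes_H\bar a)=(h^0,\dots,\Delta(h^i),\dots,h^n)\otimes_H\bar a$. Theorem. There are well-defined $k$-linear maps $\tau_n:Z_n(H,A_B)\to Z_n(H,A_B)$, $n\ge0$, with $$\tau_n((h^0,\dots,h^n)\otimes_H\bar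 a)=\sum(h^na_{\langle1\rangle},h^0,\dots,h^{n-1})\otimes_H\overline{a_{\langle0\rangle}},$$ and $(Z_*(H,A_B),\delta_*,\sigma_*,\tau_*)$ is a cyclic $k$-module, isomorphic to $Z_*(A/B)$ as a cyclic $k$-module. In particular there is an isomorphism of cyclic modules $Z_*(A/B)\to Z_*(H,A_B)$ which induces isomorphisms $HC_n(A/B)\cong HC_n(Z_*(H,A_B))$ for all $n\ge0$, where the cyclic homology $HC_*$ of a cyclic module is the homology of the total complex of its Tsygan double complex, and $HC_*(A/B)$ is that of $Z_*(A/B)$. -/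

import Mathlib

open TensorProduct CategoryTheory

universe u

namespace HopfCyclic

section TensorPowers

variable {k : Type u} [Field k] {V : Type u} [AddCommGroup V] [Module k V]
  {P : Type u} [AddCommGroup P] [Module k P]

/-- The map `(x, x₁ ⊗ ⋯ ⊗ xₙ) ↦ x ⊗ x₁ ⊗ ⋯ ⊗ xₙ`. -/
noncomputable def tcons {n : ℕ} : V →ₗ[k] (⨂[k]^n V) →ₗ[k] (⨂[k]^(n + 1) V) :=
  (PiTensorProduct.lift (R := k)).toLinearMap ∘ₗ
    (PiTensorProduct.tprod k (s := fun _ : Fin (n + 1) => V)).curryLeft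

/-- The universal property of `V^{⊗(n+1)} = V ⊗ V^{⊗n}`: a bilinear map `f` on `V × V^{⊗n}` gives
the linear map `x ⊗ x₁ ⊗ ⋯ ⊗ xₙ ↦ f x (x₁ ⊗ ⋯ ⊗ xₙ)`. -/
noncomputable def tuncons {n : ℕ} (f : V →ₗ[k] (⨂[k]^n V) →ₗ[k] P) : (⨂[k]^(n + 1) V) →ₗ[k] P :=
  PiTensorProduct.lift (LinearMap.uncurryLeft
    ((PiTensorProduct.lift (R := k) (s := fun _ : Fin n => V) (E := P)).symm.toLinearMap ∘ₗ f))

theorem tcons_tprod {n : ℕ} (x : V) (a : Fin n → V) :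
    tcons (k := k) x (PiTensorProduct.tprod k a) =
      PiTensorProduct.tprod k (Fin.cons x a : Fin (n + 1) → V) := by
  simp [tcons]

theorem tprod_eq_tcons {n : ℕ} (a : Fin (n + 1) → V) :
    PiTensorProduct.tprod k a = tcons (k := k) (a 0) (PiTensorProduct.tprod k (Fin.tail a)) := by
  rw [tcons_tprod, Fin.cons_self_tail]

theorem tuncons_tprod {n : ℕ} (f : V →ₗ[k] (⨂[k]^n V) →ₗ[k] P) (a : Fin (n + 1) → V) :
    tuncons f (PiTensorProduct.tprod k a) = f (a 0) (PiTensorProduct.tprod k (Fin.tail a)) := by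
  simp [tuncons]

@[simp]
theorem tuncons_tcons {n : ℕ} (f : V →ₗ[k] (⨂[k]^n V) →ₗ[k] P) (x : V) (y : ⨂[k]^n V) :
    tuncons f (tcons x y) = f x y := by
  have : tuncons f ∘ₗ tcons x = f x := by
    apply PiTensorProduct.ext
    ext a
    simp [tcons_tprod, tuncons_tprod]
  exact LinearMap.congr_fun this y

theorem tpow_ext {n : ℕ} {f g : (⨂[k]^(n + 1) V) →ₗ[k] P}
    (h : ∀ x y, f (tcons x y) = g (tcons x y)) : f = g := by
  apply PiTensorProduct.ext
  ext a
  simp only [LinearMap.compMultilinearMap_apply]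
  rw [tprod_eq_tcons]
  exact h _ _

/-- `tuncons` as a linear map. -/
noncomputable def tunconsL {n : ℕ} :
    (V →ₗ[k] (⨂[k]^n V) →ₗ[k] P) →ₗ[k] ((⨂[k]^(n + 1) V) →ₗ[k] P) where
  toFun := tuncons
  map_add' f g := tpow_ext fun x y => by simp
  map_smul' c f := tpow_ext fun x y => by simp

@[simp]
theorem tunconsL_apply {n : ℕ} (f : V →ₗ[k] (⨂[k]^n V) →ₗ[k] P) : tunconsL f = tuncons f := rfl

/-- The map `V ⊗ φ : V^{⊗(m+1)} → V^{⊗(n+1)}` for `φ : V^{⊗m} → V^{⊗n}`. -/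
noncomputable def tlift {m n : ℕ} (φ : (⨂[k]^m V) →ₗ[k] (⨂[k]^n V)) :
    (⨂[k]^(m + 1) V) →ₗ[k] (⨂[k]^(n + 1) V) :=
  tuncons (LinearMap.lcomp k _ φ ∘ₗ tcons)

@[simp]
theorem tlift_tcons {m n : ℕ} (φ : (⨂[k]^m V) →ₗ[k] (⨂[k]^n V)) (x : V) (y : ⨂[k]^m V) :
    tlift φ (tcons x y) = tcons x (φ y) := by
  simp [tlift]

end TensorPowers

section CyclicModules

/-- A simplicial `k`-module, presented by its face maps `d` and its degeneracy maps `s`. -/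
structure SimplicialModule (k : Type u) [Field k] where
  obj : ℕ → Type u
  [addCommGroup : ∀ n, AddCommGroup (obj n)]
  [module : ∀ n, Module k (obj n)]
  d : ∀ n, Fin (n + 2) → (obj (n + 1) →ₗ[k] obj n)
  s : ∀ n, Fin (n + 1) → (obj n →ₗ[k] obj (n + 1))
  d_d : ∀ n (i j : Fin (n + 2)), i ≤ j →
    d n i ∘ₗ d (n + 1) j.succ = d n j ∘ₗ d (n + 1) i.castSucc
  s_s : ∀ n (i j : Fin (n + 1)), i ≤ j →
    s (n + 1) j.succ ∘ₗ s n i = s (n + 1) i.castSucc ∘ₗ s n j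
  d_s_of_le : ∀ n (i : Fin (n + 2)) (j : Fin (n + 1)), i ≤ j.castSucc →
    d (n + 1) i.castSucc ∘ₗ s (n + 1) j.succ = s n j ∘ₗ d n i
  d_s_castSucc : ∀ n (i : Fin (n + 1)), d n i.castSucc ∘ₗ s n i = LinearMap.id
  d_s_succ : ∀ n (i : Fin (n + 1)), d n i.succ ∘ₗ s n i = LinearMap.id
  d_s_of_gt : ∀ n (i : Fin (n + 2)) (j : Fin (n + 1)), j.castSucc < i →
    d (n + 1) i.succ ∘ₗ s (n + 1) j.castSucc = s n j ∘ₗ d n i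

attribute [instance] SimplicialModule.addCommGroup SimplicialModule.module

/-- The operators `t n` make the simplicial module `X` into a cyclic module: `t n` is an
automorphism with `(t n)^(n+1) = 1`, with the usual compatibilities with faces and degeneracies. -/
structure IsCyclicOperator {k : Type u} [Field k] (X : SimplicialModule k)
    (t : ∀ n, X.obj n →ₗ[k] X.obj n) : Prop where
  pow_eq_id : ∀ n, (t n : Module.End k (X.obj n)) ^ (n + 1) = 1
  d_succ_t : ∀ n (i : Fin (n + 1)), X.d n i.succ ∘ₗ t (n + 1) = t n ∘ₗ X.d n i.castSucc
  d_zero_t : ∀ n, X.d n 0 ∘ₗ t (n + 1) = X.d n (Fin.last (n + 1))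
  s_succ_t : ∀ n (i : Fin n), X.s n i.succ ∘ₗ t n = t (n + 1) ∘ₗ X.s n i.castSucc
  s_zero_t : ∀ n, X.s n 0 ∘ₗ t n = t (n + 1) ∘ₗ t (n + 1) ∘ₗ X.s n (Fin.last n)

/-- A cyclic `k`-module. -/
structure CyclicModule (k : Type u) [Field k] extends SimplicialModule k where
  t : ∀ n, obj n →ₗ[k] obj n
  isCyclicOperator : IsCyclicOperator toSimplicialModule t

/-- A morphism of cyclic modules. -/
structure CyclicModule.Hom {k : Type u} [Field k] (X Y : CyclicModule k) where
  f : ∀ n, X.obj n →ₗ[k] Y.obj n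
  comm_d : ∀ n (i : Fin (n + 2)), f n ∘ₗ X.d n i = Y.d n i ∘ₗ f (n + 1)
  comm_s : ∀ n (i : Fin (n + 1)), f (n + 1) ∘ₗ X.s n i = Y.s n i ∘ₗ f n
  comm_t : ∀ n, f n ∘ₗ X.t n = Y.t n ∘ₗ f n

/-- A morphism of cyclic modules is an isomorphism iff it is bijective in every degree. -/
def CyclicModule.Hom.IsIso {k : Type u} [Field k] {X Y : CyclicModule k} (φ : X.Hom Y) : Prop :=
  ∀ n, Function.Bijective (φ.f n)

theorem comp_fsum {k M₀ M₁ M₂ ι : Type*} [Field k] [AddCommGroup M₀]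
    [AddCommGroup M₁] [AddCommGroup M₂] [Module k M₀] [Module k M₁] [Module k M₂]
    (f : M₁ →ₗ[k] M₀) (s : Finset ι) (g : ι → (M₂ →ₗ[k] M₁)) :
    f ∘ₗ (∑ i ∈ s, g i) = ∑ i ∈ s, f ∘ₗ g i := by
  ext x; simp

theorem fsum_comp {k M₀ M₁ M₂ ι : Type*} [Field k] [AddCommGroup M₀]
    [AddCommGroup M₁] [AddCommGroup M₂] [Module k M₀] [Module k M₁] [Module k M₂]
    (s : Finset ι) (g : ι → (M₁ →ₗ[k] M₀)) (f : M₂ →ₗ[k] M₁) :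
    (∑ i ∈ s, g i) ∘ₗ f = ∑ i ∈ s, g i ∘ₗ f := by
  ext x; simp

theorem alternating_comp_eq_zero {k M₀ M₁ M₂ : Type u} [Field k] [AddCommGroup M₀]
    [AddCommGroup M₁] [AddCommGroup M₂] [Module k M₀] [Module k M₁] [Module k M₂]
    (d : ℕ → (M₁ →ₗ[k] M₀)) (d' : ℕ → (M₂ →ₗ[k] M₁)) (m : ℕ)
    (h : ∀ i j, i ≤ j → j < m → d i ∘ₗ d' (j + 1) = d j ∘ₗ d' i) :
    (∑ i ∈ Finset.range m, (-1 : k) ^ i • d i) ∘ₗ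
      (∑ i ∈ Finset.range (m + 1), (-1 : k) ^ i • d' i) = 0 := by
  induction m with
  | zero => simp
  | succ m ih =>
    have ih := ih fun i j hij hj => h i j hij (by omega)
    have h1 : (∑ i ∈ Finset.range m, (-1 : k) ^ i • d i) ∘ₗ d' (m + 1) =
        d m ∘ₗ (∑ i ∈ Finset.range m, (-1 : k) ^ i • d' i) := by
      rw [fsum_comp, comp_fsum]
      refine Finset.sum_congr rfl fun i hi => ?_
      rw [LinearMap.smul_comp, LinearMap.comp_smul,
        h i m (Finset.mem_range.1 hi).le (Nat.lt_succ_self m)]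
    have h2 := h m m le_rfl (Nat.lt_succ_self m)
    rw [Finset.sum_range_succ _ (m + 1), LinearMap.comp_add, LinearMap.comp_smul,
      Finset.sum_range_succ, LinearMap.add_comp, LinearMap.add_comp, ih, h1, zero_add,
      LinearMap.smul_comp, LinearMap.smul_comp, h2, Finset.sum_range_succ, LinearMap.comp_add,
      LinearMap.comp_smul, smul_add, smul_add, pow_succ]
    module

namespace CyclicModule

variable {k : Type u} [Field k] (X : CyclicModule k)

/-- The signed face map `(-1)^i d_i`, extended by zero to all `i : ℕ`. -/
def signedFace (n i : ℕ) : X.obj (n + 1) →ₗ[k] X.obj n :=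
  if h : i < n + 2 then (-1 : k) ^ i • X.d n ⟨i, h⟩ else 0

/-- The Hochschild boundary `b = ∑_{i=0}^{n+1} (-1)^i d_i`. -/
def b (n : ℕ) : X.obj (n + 1) →ₗ[k] X.obj n :=
  ∑ i : Fin (n + 2), (-1 : k) ^ (i : ℕ) • X.d n i

/-- The boundary `b' = ∑_{i=0}^{n} (-1)^i d_i` of the acyclic complex (the last face is omitted). -/
def b' (n : ℕ) : X.obj (n + 1) →ₗ[k] X.obj n :=
  ∑ i : Fin (n + 1), (-1 : k) ^ (i : ℕ) • X.d n i.castSucc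

/-- The signed cyclic operator `(-1)^n t_n`. -/
def signedT (n : ℕ) : Module.End k (X.obj n) := (-1 : k) ^ n • X.t n

/-- The norm operator of the cyclic group of order `n + 1`, acting through `(-1)^n t_n`. -/
def norm (n : ℕ) : Module.End k (X.obj n) := ∑ i ∈ Finset.range (n + 1), X.signedT n ^ i

theorem b_eq (n : ℕ) : X.b n = ∑ i ∈ Finset.range (n + 2), X.signedFace n i := by
  rw [b, ← Fin.sum_univ_eq_sum_range]
  refine Finset.sum_congr rfl fun i _ => ?_
  simp [signedFace]

theorem b'_eq (n : ℕ) : X.b' n = ∑ i ∈ Finset.range (n + 1), X.signedFace n i := by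
  rw [b', ← Fin.sum_univ_eq_sum_range]
  refine Finset.sum_congr rfl fun i _ => ?_
  have : (i : ℕ) < n + 2 := by omega
  simp only [signedFace, this, dif_pos]
  rfl

theorem alternating_sq (n m : ℕ) (hm : m ≤ n + 2) :
    (∑ i ∈ Finset.range m, X.signedFace n i) ∘ₗ
      (∑ i ∈ Finset.range (m + 1), X.signedFace (n + 1) i) = 0 := by
  have := alternating_comp_eq_zero (k := k)
    (fun i => if h : i < n + 2 then X.d n ⟨i, h⟩ else 0)
    (fun i => if h : i < n + 3 then X.d (n + 1) ⟨i, h⟩ else 0) m (by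
      intro i j hij hj
      have h1 : i < n + 2 := by omega
      have h2 : j < n + 2 := by omega
      have h3 : j + 1 < n + 3 := by omega
      have h4 : i < n + 3 := by omega
      simp only [h1, h2, h3, h4, dif_pos]
      exact X.d_d n ⟨i, h1⟩ ⟨j, h2⟩ hij)
  convert this using 2
  · refine Finset.sum_congr rfl fun i _ => ?_
    unfold signedFace; split_ifs <;> simp
  · refine Finset.sum_congr rfl fun i _ => ?_
    unfold signedFace; split_ifs <;> simp

theorem b_b (n : ℕ) : X.b n ∘ₗ X.b (n + 1) = 0 := by
  rw [b_eq, b_eq]; exact X.alternating_sq n (n + 2) le_rfl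

theorem b'_b' (n : ℕ) : X.b' n ∘ₗ X.b' (n + 1) = 0 := by
  rw [b'_eq, b'_eq]; exact X.alternating_sq n (n + 1) (by omega)

theorem signedT_pow (n : ℕ) : X.signedT n ^ (n + 1) = 1 := by
  rw [signedT, smul_pow, X.isCyclicOperator.pow_eq_id, ← pow_mul,
    Even.neg_one_pow (Nat.even_mul_succ_self n), one_smul]

theorem signedFace_succ_T (n i : ℕ) (hi : i ≤ n) :
    X.signedFace n (i + 1) ∘ₗ X.signedT (n + 1) = X.signedT n ∘ₗ X.signedFace n i := by
  have h1 : i + 1 < n + 2 := by omega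
  have h2 : i < n + 2 := by omega
  have := X.isCyclicOperator.d_succ_t n ⟨i, by omega⟩
  simp only [signedFace, h1, h2, dif_pos, signedT, LinearMap.smul_comp, LinearMap.comp_smul]
  simp only [Fin.succ_mk, Fin.castSucc_mk] at this
  rw [this, smul_smul, smul_smul]
  congr 1
  ring

theorem signedFace_zero_T (n : ℕ) :
    X.signedFace n 0 ∘ₗ X.signedT (n + 1) = X.signedFace n (n + 1) := by
  have := X.isCyclicOperator.d_zero_t n
  simp only [signedFace, signedT, LinearMap.comp_smul]
  simp only [Nat.zero_lt_succ, dif_pos, pow_zero, one_smul, Nat.lt_succ_self]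
  exact congrArg _ this

theorem b_T (n : ℕ) :
    X.b n ∘ₗ X.signedT (n + 1) = X.signedT n ∘ₗ X.b' n + (X.b n - X.b' n) := by
  rw [b_eq, b'_eq, Finset.sum_range_succ _ (n + 1), add_sub_cancel_left, ← Finset.sum_range_succ,
    Finset.sum_range_succ', LinearMap.add_comp, signedFace_zero_T, fsum_comp,
    comp_fsum]
  congr 1
  exact Finset.sum_congr rfl fun i hi =>
    X.signedFace_succ_T n i (by have := Finset.mem_range.1 hi; omega)

theorem b_one_sub_T (n : ℕ) :
    X.b n ∘ₗ (LinearMap.id - X.signedT (n + 1)) = (LinearMap.id - X.signedT n) ∘ₗ X.b' n := by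
  rw [LinearMap.comp_sub, LinearMap.sub_comp, b_T, LinearMap.comp_id, LinearMap.id_comp]
  abel

theorem norm_eq' (n : ℕ) : X.norm n = ∑ i ∈ Finset.range (n + 1), X.signedT n ^ (i + 1) := by
  have h1 := Finset.sum_range_succ (fun i => X.signedT n ^ i) (n + 1)
  have h2 := Finset.sum_range_succ' (fun i => X.signedT n ^ i) (n + 1)
  rw [h2, signedT_pow, pow_zero] at h1
  exact (add_right_cancel h1).symm

theorem T_mul_norm (n : ℕ) : X.signedT n * X.norm n = X.norm n := by
  conv_rhs => rw [norm_eq']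
  rw [norm, Finset.mul_sum]
  exact Finset.sum_congr rfl fun i _ => (pow_succ' _ _).symm

theorem norm_mul_T (n : ℕ) : X.norm n * X.signedT n = X.norm n := by
  conv_rhs => rw [norm_eq']
  rw [norm, Finset.sum_mul]
  exact Finset.sum_congr rfl fun i _ => (pow_succ _ _).symm

theorem pow_mul_norm (n i : ℕ) : X.signedT n ^ i * X.norm n = X.norm n := by
  induction i with
  | zero => simp
  | succ i ih => rw [pow_succ, mul_assoc, T_mul_norm, ih]

theorem norm_comp_one_sub_T (n : ℕ) : X.norm n ∘ₗ (LinearMap.id - X.signedT n) = 0 := by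
  rw [LinearMap.comp_sub, LinearMap.comp_id, sub_eq_zero]
  exact (X.norm_mul_T n).symm

theorem one_sub_T_comp_norm (n : ℕ) : (LinearMap.id - X.signedT n) ∘ₗ X.norm n = 0 := by
  rw [LinearMap.sub_comp, LinearMap.id_comp, sub_eq_zero]
  exact (X.T_mul_norm n).symm

theorem signedFace_pow (n i : ℕ) (hi : i ≤ n + 1) :
    X.signedFace n i ∘ₗ (X.signedT (n + 1) ^ i) = (X.signedT n ^ i) ∘ₗ X.signedFace n 0 := by
  induction i with
  | zero => rfl
  | succ i ih =>
    rw [pow_succ', Module.End.mul_eq_comp, ← LinearMap.comp_assoc,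
      signedFace_succ_T _ _ _ (by omega), LinearMap.comp_assoc, ih (by omega), pow_succ']
    rfl

theorem b'_norm (n : ℕ) :
    X.b' n ∘ₗ X.norm (n + 1) = X.norm n ∘ₗ X.signedFace n 0 ∘ₗ X.norm (n + 1) := by
  rw [b'_eq, fsum_comp]
  conv_rhs => rw [norm, fsum_comp]
  refine Finset.sum_congr rfl fun i hi => ?_
  have hi := Finset.mem_range.1 hi
  conv_lhs => rw [← pow_mul_norm X (n + 1) i, Module.End.mul_eq_comp, ← LinearMap.comp_assoc,
    signedFace_pow X n i (by omega)]
  rfl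

theorem norm_signedFace (n j : ℕ) (hj : j ≤ n + 1) :
    X.norm n ∘ₗ X.signedFace n (n + 1 - j) =
      X.norm n ∘ₗ X.signedFace n 0 ∘ₗ (X.signedT (n + 1) ^ (j + 1)) := by
  induction j with
  | zero => rw [zero_add, pow_one, signedFace_zero_T, Nat.sub_zero]
  | succ j ih =>
    have h := X.signedFace_succ_T n (n + 1 - (j + 1)) (by omega)
    rw [show n + 1 - (j + 1) + 1 = n + 1 - j by omega] at h
    calc X.norm n ∘ₗ X.signedFace n (n + 1 - (j + 1))
        = (X.norm n * X.signedT n) ∘ₗ X.signedFace n (n + 1 - (j + 1)) := by rw [norm_mul_T]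
      _ = X.norm n ∘ₗ (X.signedT n ∘ₗ X.signedFace n (n + 1 - (j + 1))) := rfl
      _ = (X.norm n ∘ₗ X.signedFace n (n + 1 - j)) ∘ₗ X.signedT (n + 1) := by rw [← h]; rfl
      _ = _ := by rw [ih (by omega), pow_succ _ (j + 1)]; rfl

theorem norm_b (n : ℕ) :
    X.norm n ∘ₗ X.b n = X.norm n ∘ₗ X.signedFace n 0 ∘ₗ X.norm (n + 1) := by
  rw [b_eq, comp_fsum, norm_eq' X (n + 1), comp_fsum, comp_fsum,
    ← Finset.sum_range_reflect]
  refine Finset.sum_congr rfl fun i hi => ?_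
  have hi := Finset.mem_range.1 hi
  rw [← norm_signedFace X n i (by omega)]
  rfl

theorem b'_norm_eq (n : ℕ) : X.b' n ∘ₗ X.norm (n + 1) = X.norm n ∘ₗ X.b n := by
  rw [b'_norm, norm_b]

/-- The vertical differential `X_{q+1} → X_q` in the column `p` of the Tsygan double complex, up to
the sign `(-1)^p`: it is `b` if `p` is even and `b'` if `p` is odd. -/
def vert (p q : ℕ) : X.obj (q + 1) →ₗ[k] X.obj q := if Even p then X.b q else X.b' q

/-- The horizontal differential from column `p + 1` to column `p`, in row `q`:
it is `1 - (-1)^q t_q` if `p` is even and the norm if `p` is odd. -/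
def horiz (p q : ℕ) : X.obj q →ₗ[k] X.obj q :=
  if Even p then LinearMap.id - X.signedT q else X.norm q

theorem vert_vert (p q : ℕ) : X.vert p q ∘ₗ X.vert p (q + 1) = 0 := by
  unfold vert; split_ifs
  · exact X.b_b q
  · exact X.b'_b' q

theorem horiz_horiz (p q : ℕ) : X.horiz p q ∘ₗ X.horiz (p + 1) q = 0 := by
  unfold horiz
  by_cases h : Even p
  · rw [if_pos h, if_neg (by simpa [Nat.even_add_one] using h)]
    exact X.one_sub_T_comp_norm q
  · rw [if_neg h, if_pos (by simpa [Nat.even_add_one] using h)]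
    exact X.norm_comp_one_sub_T q

theorem horiz_vert (p q : ℕ) :
    X.horiz p q ∘ₗ X.vert (p + 1) q = X.vert p q ∘ₗ X.horiz p (q + 1) := by
  unfold horiz vert
  by_cases h : Even p
  · rw [if_pos h, if_pos h, if_pos h, if_neg (by simpa [Nat.even_add_one] using h)]
    exact (X.b_one_sub_T q).symm
  · rw [if_neg h, if_neg h, if_neg h, if_pos (by simpa [Nat.even_add_one] using h)]
    exact (X.b'_norm_eq q).symm

/-- The column `p` of the Tsygan double complex. -/
noncomputable def column (p : ℕ) : ChainComplex (ModuleCat.{u} k) ℕ :=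
  ChainComplex.of (fun q => ModuleCat.of k (X.obj q)) (fun q => ModuleCat.ofHom (X.vert p q))
    (fun q => by rw [← ModuleCat.ofHom_comp, vert_vert]; rfl)

/-- The Tsygan double complex of a cyclic module; `(tsygan X).X p` is the column `p`, and the rows
are the periodic complexes with differentials `1 - (-1)^q t_q` and the norm. All
squares commute; passing to the total complex multiplies the differentials of the column `p` by
`(-1)^p`, which makes them anticommute. -/
noncomputable def tsygan :
    HomologicalComplex₂ (ModuleCat.{u} k) (ComplexShape.down ℕ) (ComplexShape.down ℕ) :=
  ChainComplex.of (fun p => X.column p)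
    (fun p => ChainComplex.ofHom (X := X.column (p + 1)) (Y := X.column p)
      (fun q => ModuleCat.ofHom (X.horiz p q))
      (fun q => by
        simp only [column, ChainComplex.of_d]
        rw [← ModuleCat.ofHom_comp, ← ModuleCat.ofHom_comp, horiz_vert]))
    (fun p => by
      ext q : 1
      change ModuleCat.ofHom (X.horiz (p + 1) q) ≫ ModuleCat.ofHom (X.horiz p q) = 0
      rw [← ModuleCat.ofHom_comp, horiz_horiz]; rfl)

/-- The cyclic homology `HC_n(X)`: the homology of the total complex of the Tsygan double complex. -/
noncomputable def HC (n : ℕ) : ModuleCat.{u} k :=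
  (X.tsygan.total (ComplexShape.down ℕ)).homology n

variable {X} {Y : CyclicModule k}

namespace Hom

variable (φ : X.Hom Y)

theorem comm_T (n : ℕ) : φ.f n ∘ₗ X.signedT n = Y.signedT n ∘ₗ φ.f n := by
  simp only [signedT, LinearMap.comp_smul, LinearMap.smul_comp, φ.comm_t]

theorem comm_vert (p q : ℕ) : φ.f q ∘ₗ X.vert p q = Y.vert p q ∘ₗ φ.f (q + 1) := by
  unfold vert; split_ifs
  · simp only [b, comp_fsum, fsum_comp, LinearMap.comp_smul, LinearMap.smul_comp,
      φ.comm_d]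
  · simp only [b', comp_fsum, fsum_comp, LinearMap.comp_smul, LinearMap.smul_comp,
      φ.comm_d]

theorem comm_horiz (p q : ℕ) : φ.f q ∘ₗ X.horiz p q = Y.horiz p q ∘ₗ φ.f q := by
  unfold horiz; split_ifs
  · rw [LinearMap.comp_sub, LinearMap.sub_comp, comm_T]; rfl
  · simp only [norm, comp_fsum, fsum_comp]
    refine Finset.sum_congr rfl fun i hi => ?_
    clear hi
    induction i with
    | zero => rfl
    | succ i ih =>
      rw [pow_succ, Module.End.mul_eq_comp, ← LinearMap.comp_assoc, ih, LinearMap.comp_assoc,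
        comm_T, pow_succ]
      rfl

/-- The map of Tsygan double complexes induced by a morphism of cyclic modules. -/
noncomputable def tsyganMap : X.tsygan ⟶ Y.tsygan :=
  ChainComplex.ofHom (X := X.tsygan) (Y := Y.tsygan)
    (fun p => ChainComplex.ofHom (X := X.column p) (Y := Y.column p)
      (fun q => ModuleCat.ofHom (φ.f q))
      (fun q => by
        simp only [column, ChainComplex.of_d]
        rw [← ModuleCat.ofHom_comp, ← ModuleCat.ofHom_comp, comm_vert]))
    (fun p => by
      simp only [tsygan, ChainComplex.of_d]
      ext q : 1
      change ModuleCat.ofHom (φ.f q) ≫ ModuleCat.ofHom (Y.horiz p q) =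
        ModuleCat.ofHom (X.horiz p q) ≫ ModuleCat.ofHom (φ.f q)
      rw [← ModuleCat.ofHom_comp, ← ModuleCat.ofHom_comp, comm_horiz])

/-- The map on cyclic homology induced by a morphism of cyclic modules. -/
noncomputable def HCMap (n : ℕ) : X.HC n ⟶ Y.HC n :=
  HomologicalComplex.homologyMap
    (HomologicalComplex₂.total.map φ.tsyganMap (ComplexShape.down ℕ)) n

end Hom

end CyclicModule

end CyclicModules

section RelativeCyclicModule

variable {k : Type u} [Field k] {A : Type u} [Ring A] [Algebra k A]

variable (k A) in
/-- `mulAt n i` multiplies the factors `i` and `i + 1`, for `i = 0, …, n`: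
`a₀ ⊗ ⋯ ⊗ aₙ₊₁ ↦ a₀ ⊗ ⋯ ⊗ aᵢaᵢ₊₁ ⊗ ⋯ ⊗ aₙ₊₁`. -/
noncomputable def mulAt : (n : ℕ) → Fin (n + 1) → ((⨂[k]^(n + 2) A) →ₗ[k] (⨂[k]^(n + 1) A))
  | 0, _ => tuncons (tunconsL ∘ₗ (LinearMap.mul k A).compr₂ tcons)
  | n + 1, i => Fin.cases (motive := fun _ => _)
      (tuncons (tunconsL ∘ₗ (LinearMap.mul k A).compr₂ tcons)) (fun j => tlift (mulAt n j)) i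

@[simp]
theorem mulAt_zero (n : ℕ) (x y : A) (z : ⨂[k]^n A) :
    mulAt k A n 0 (tcons x (tcons y z)) = tcons (x * y) z := by
  cases n <;> simp [mulAt]

@[simp]
theorem mulAt_succ (n : ℕ) (i : Fin (n + 1)) (x : A) (z : ⨂[k]^(n + 2) A) :
    mulAt k A (n + 1) i.succ (tcons x z) = tcons x (mulAt k A n i z) := by
  simp [mulAt]

@[simp]
theorem mulAt_one (n : ℕ) (x : A) (z : ⨂[k]^(n + 2) A) :
    mulAt k A (n + 1) 1 (tcons x z) = tcons x (mulAt k A n 0 z) :=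
  mulAt_succ n 0 x z

variable (k A) in
/-- `insertOne n i` inserts `1` after the factor `i`, for `i = 0, …, n`:
`a₀ ⊗ ⋯ ⊗ aₙ ↦ a₀ ⊗ ⋯ ⊗ aᵢ ⊗ 1 ⊗ aᵢ₊₁ ⊗ ⋯ ⊗ aₙ`. -/
noncomputable def insertOne : (n : ℕ) → Fin (n + 1) → ((⨂[k]^(n + 1) A) →ₗ[k] (⨂[k]^(n + 2) A))
  | 0, _ => tlift (tcons 1)
  | n + 1, i => Fin.cases (motive := fun _ => _) (tlift (tcons 1)) (fun j => tlift (insertOne n j)) i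

@[simp]
theorem insertOne_zero (n : ℕ) (x : A) (z : ⨂[k]^n A) :
    insertOne k A n 0 (tcons x z) = tcons x (tcons 1 z) := by
  cases n <;> simp [insertOne]

@[simp]
theorem insertOne_succ (n : ℕ) (i : Fin (n + 1)) (x : A) (z : ⨂[k]^(n + 1) A) :
    insertOne k A (n + 1) i.succ (tcons x z) = tcons x (insertOne k A n i z) := by
  simp [insertOne]

@[simp]
theorem insertOne_one (n : ℕ) (x : A) (z : ⨂[k]^(n + 1) A) :
    insertOne k A (n + 1) 1 (tcons x z) = tcons x (insertOne k A n 0 z) :=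
  insertOne_succ n 0 x z

variable (k A) in
/-- The cyclic rotation `a₀ ⊗ ⋯ ⊗ aₙ ↦ aₙ ⊗ a₀ ⊗ ⋯ ⊗ aₙ₋₁`. -/
noncomputable def rotate (n : ℕ) : (⨂[k]^(n + 1) A) ≃ₗ[k] (⨂[k]^(n + 1) A) :=
  PiTensorProduct.reindex k (fun _ => A) (finRotate (n + 1))

theorem rotate_tprod (n : ℕ) (a : Fin (n + 1) → A) :
    rotate k A n (PiTensorProduct.tprod k a) =
      PiTensorProduct.tprod k fun i => a ((finRotate (n + 1)).symm i) := by
  simp [rotate]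

theorem rotate_snoc (n : ℕ) (a : Fin n → A) (x : A) :
    rotate k A n (PiTensorProduct.tprod k (Fin.snoc a x : Fin (n + 1) → A)) =
      tcons x (PiTensorProduct.tprod k a) := by
  rw [rotate_tprod, tcons_tprod, Fin.snoc_eq_cons_rotate]
  simp

/-- The map `(x, x₁ ⊗ ⋯ ⊗ xₙ) ↦ x₁ ⊗ ⋯ ⊗ xₙ ⊗ x`. -/
noncomputable def tsnoc {n : ℕ} (x : A) : (⨂[k]^n A) →ₗ[k] (⨂[k]^(n + 1) A) :=
  (rotate k A n).symm.toLinearMap ∘ₗ tcons x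

@[simp]
theorem rotate_tsnoc {n : ℕ} (x : A) (y : ⨂[k]^n A) :
    rotate k A n (tsnoc x y) = tcons x y := by
  simp [tsnoc]

theorem tsnoc_tprod {n : ℕ} (x : A) (a : Fin n → A) :
    tsnoc x (PiTensorProduct.tprod k a) =
      PiTensorProduct.tprod k (Fin.snoc a x : Fin (n + 1) → A) := by
  apply (rotate k A n).injective
  rw [rotate_tsnoc, rotate_snoc]

theorem tpow_ext_snoc {n : ℕ} {P : Type u} [AddCommGroup P] [Module k P]
    {f g : (⨂[k]^(n + 1) A) →ₗ[k] P}
    (h : ∀ x y, f (tsnoc x y) = g (tsnoc x y)) : f = g := by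
  apply PiTensorProduct.ext
  ext a
  have := h (a (Fin.last n)) (PiTensorProduct.tprod k (Fin.init a))
  simpa [tsnoc_tprod] using this

@[simp]
theorem tsnoc_tcons {n : ℕ} (x y : A) (z : ⨂[k]^n A) :
    tsnoc y (tcons x z) = tcons x (tsnoc y z) := by
  have : (tsnoc y ∘ₗ tcons x : (⨂[k]^n A) →ₗ[k] _) = tcons x ∘ₗ tsnoc y := by
    apply PiTensorProduct.ext
    ext a
    simp [tcons_tprod, tsnoc_tprod, Fin.cons_snoc_eq_snoc_cons]
  exact LinearMap.congr_fun this z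

@[simp]
theorem mulAt_castSucc_tsnoc (n : ℕ) (i : Fin (n + 1)) (x : A) (z : ⨂[k]^(n + 2) A) :
    mulAt k A (n + 1) i.castSucc (tsnoc x z) = tsnoc x (mulAt k A n i z) := by
  suffices h : mulAt k A (n + 1) i.castSucc ∘ₗ tsnoc x = tsnoc x ∘ₗ mulAt k A n i from
    LinearMap.congr_fun h z
  clear z
  induction n with
  | zero =>
    obtain rfl : i = 0 := by omega
    refine tpow_ext fun x₀ y => ?_
    suffices h : mulAt k A (0 + 1) (Fin.castSucc 0) ∘ₗ tsnoc x ∘ₗ tcons x₀ =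
      tsnoc x ∘ₗ mulAt k A 0 0 ∘ₗ tcons x₀ from LinearMap.congr_fun h y
    refine tpow_ext fun x₁ y => ?_
    simp
  | succ n ih =>
    refine tpow_ext fun x₀ y => ?_
    induction i using Fin.cases with
    | zero =>
      suffices h : mulAt k A (n + 1 + 1) (Fin.castSucc 0) ∘ₗ tsnoc x ∘ₗ tcons x₀ =
        tsnoc x ∘ₗ mulAt k A (n + 1) 0 ∘ₗ tcons x₀ from LinearMap.congr_fun h y
      refine tpow_ext fun x₁ y => ?_
      simp
    | succ i =>
      simp only [LinearMap.comp_apply, tsnoc_tcons, Fin.castSucc_succ, mulAt_succ]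
      exact congrArg (tcons x₀) (LinearMap.congr_fun (ih i) y)

@[simp]
theorem insertOne_castSucc_tsnoc (n : ℕ) (i : Fin (n + 1)) (x : A) (z : ⨂[k]^(n + 1) A) :
    insertOne k A (n + 1) i.castSucc (tsnoc x z) = tsnoc x (insertOne k A n i z) := by
  suffices h : insertOne k A (n + 1) i.castSucc ∘ₗ tsnoc x = tsnoc x ∘ₗ insertOne k A n i from
    LinearMap.congr_fun h z
  clear z
  induction n with
  | zero =>
    obtain rfl : i = 0 := by omega
    refine tpow_ext fun x₀ y => ?_
    simp
  | succ n ih =>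
    refine tpow_ext fun x₀ y => ?_
    induction i using Fin.cases with
    | zero => simp
    | succ i =>
      simp only [LinearMap.comp_apply, tsnoc_tcons, Fin.castSucc_succ, insertOne_succ]
      exact congrArg (tcons x₀) (LinearMap.congr_fun (ih i) y)

theorem mulAt_last_tsnoc (n : ℕ) (x y : A) (z : ⨂[k]^n A) :
    mulAt k A n (Fin.last n) (tsnoc y (tsnoc x z)) = tsnoc (x * y) z := by
  induction n with
  | zero =>
    suffices h : mulAt k A 0 (Fin.last 0) ∘ₗ tsnoc y ∘ₗ tsnoc x = tsnoc (x * y) from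
      LinearMap.congr_fun h z
    apply PiTensorProduct.ext
    ext a
    have h1 : ∀ c : A, tsnoc c (PiTensorProduct.tprod k a) =
        tcons c (PiTensorProduct.tprod k a) := by
      intro c
      rw [tsnoc_tprod, tcons_tprod]
      congr 1
      ext i
      obtain rfl : i = 0 := by omega
      rfl
    simp only [LinearMap.compMultilinearMap_apply, LinearMap.comp_apply, h1, tsnoc_tcons]
    exact mulAt_zero 0 _ _ _
  | succ n ih =>
    suffices h : mulAt k A (n + 1) (Fin.last (n + 1)) ∘ₗ tsnoc y ∘ₗ tsnoc x = tsnoc (x * y) from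
      LinearMap.congr_fun h z
    refine tpow_ext fun x₀ z => ?_
    rw [← Fin.succ_last]
    simp only [LinearMap.comp_apply, tsnoc_tcons, mulAt_succ, ih]

theorem insertOne_last (n : ℕ) (z : ⨂[k]^(n + 1) A) :
    insertOne k A n (Fin.last n) z = tsnoc 1 z := by
  suffices h : insertOne k A n (Fin.last n) = tsnoc 1 from LinearMap.congr_fun h z
  induction n with
  | zero =>
    refine tpow_ext fun x z => ?_
    rw [tsnoc_tcons]
    have h1 : (tsnoc 1 : (⨂[k]^0 A) →ₗ[k] _) = tcons 1 := by
      apply PiTensorProduct.ext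
      ext a
      simp only [LinearMap.compMultilinearMap_apply]
      rw [tsnoc_tprod, tcons_tprod]
      congr 1
      ext i
      obtain rfl : i = 0 := by omega
      rfl
    rw [h1]
    exact insertOne_zero 0 _ _
  | succ n ih =>
    refine tpow_ext fun x z => ?_
    rw [← Fin.succ_last, insertOne_succ, tsnoc_tcons, ih z]

theorem mulAt_mulAt (n : ℕ) (i j : Fin (n + 1)) (h : i ≤ j) :
    mulAt k A n i ∘ₗ mulAt k A (n + 1) j.succ = mulAt k A n j ∘ₗ mulAt k A (n + 1) i.castSucc := by
  induction n with
  | zero =>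
    obtain rfl : i = 0 := by omega
    obtain rfl : j = 0 := by omega
    refine tpow_ext fun x y => ?_
    suffices h : mulAt k A 0 0 ∘ₗ mulAt k A (0 + 1) (Fin.succ 0) ∘ₗ tcons x =
      mulAt k A 0 0 ∘ₗ mulAt k A (0 + 1) (Fin.castSucc 0) ∘ₗ tcons x from LinearMap.congr_fun h y
    refine tpow_ext fun y z => ?_
    suffices h : mulAt k A 0 0 ∘ₗ mulAt k A (0 + 1) (Fin.succ 0) ∘ₗ tcons x ∘ₗ tcons y =
      mulAt k A 0 0 ∘ₗ mulAt k A (0 + 1) (Fin.castSucc 0) ∘ₗ tcons x ∘ₗ tcons y from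
        LinearMap.congr_fun h z
    refine tpow_ext fun z w => ?_
    simp [mul_assoc]
  | succ n ih =>
    refine tpow_ext fun x y => ?_
    induction i using Fin.cases with
    | zero =>
      suffices h : mulAt k A (n + 1) 0 ∘ₗ mulAt k A (n + 1 + 1) j.succ ∘ₗ tcons x =
        mulAt k A (n + 1) j ∘ₗ mulAt k A (n + 1 + 1) (Fin.castSucc 0) ∘ₗ tcons x from
          LinearMap.congr_fun h y
      refine tpow_ext fun y z => ?_
      induction j using Fin.cases with
      | zero =>
        suffices h : mulAt k A (n + 1) 0 ∘ₗ mulAt k A (n + 1 + 1) (Fin.succ 0) ∘ₗ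
            tcons x ∘ₗ tcons y =
          mulAt k A (n + 1) 0 ∘ₗ mulAt k A (n + 1 + 1) (Fin.castSucc 0) ∘ₗ tcons x ∘ₗ tcons y from
            LinearMap.congr_fun h z
        refine tpow_ext fun z w => ?_
        simp [mul_assoc]
      | succ j => simp
    | succ i =>
      induction j using Fin.cases with
      | zero => simp at h
      | succ j =>
        have := ih i j (by simpa using h)
        simp only [LinearMap.comp_apply, mulAt_succ, Fin.castSucc_succ]
        exact congrArg (tcons x) (LinearMap.congr_fun this y)

theorem insertOne_insertOne (n : ℕ) (i j : Fin (n + 1)) (h : i ≤ j) :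
    insertOne k A (n + 1) j.succ ∘ₗ insertOne k A n i =
      insertOne k A (n + 1) i.castSucc ∘ₗ insertOne k A n j := by
  induction n with
  | zero =>
    obtain rfl : i = 0 := by omega
    obtain rfl : j = 0 := by omega
    refine tpow_ext fun x y => ?_
    simp
  | succ n ih =>
    refine tpow_ext fun x y => ?_
    induction i using Fin.cases with
    | zero =>
      induction j using Fin.cases with
      | zero => simp
      | succ j => simp
    | succ i =>
      induction j using Fin.cases with
      | zero => simp at h
      | succ j =>
        have := ih i j (by simpa using h)
        simp only [LinearMap.comp_apply, insertOne_succ, Fin.castSucc_succ]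
        exact congrArg (tcons x) (LinearMap.congr_fun this y)

theorem mulAt_insertOne_self (n : ℕ) (i : Fin (n + 1)) :
    mulAt k A n i ∘ₗ insertOne k A n i = LinearMap.id := by
  induction n with
  | zero =>
    obtain rfl : i = 0 := by omega
    refine tpow_ext fun x y => ?_
    simp
  | succ n ih =>
    refine tpow_ext fun x y => ?_
    induction i using Fin.cases with
    | zero => simp
    | succ i =>
      simp only [LinearMap.comp_apply, insertOne_succ, mulAt_succ]
      exact congrArg (tcons x) (LinearMap.congr_fun (ih i) y)

theorem mulAt_succ_insertOne (n : ℕ) (i : Fin (n + 1)) :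
    mulAt k A (n + 1) i.succ ∘ₗ insertOne k A (n + 1) i.castSucc = LinearMap.id := by
  induction n with
  | zero =>
    obtain rfl : i = 0 := by omega
    refine tpow_ext fun x y => ?_
    suffices h : mulAt k A (0 + 1) (Fin.succ 0) ∘ₗ insertOne k A (0 + 1) (Fin.castSucc 0) ∘ₗ
      tcons x = LinearMap.id ∘ₗ tcons x from LinearMap.congr_fun h y
    refine tpow_ext fun y z => ?_
    simp
  | succ n ih =>
    refine tpow_ext fun x y => ?_
    induction i using Fin.cases with
    | zero =>
      suffices h : mulAt k A (n + 1 + 1) (Fin.succ 0) ∘ₗ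
        insertOne k A (n + 1 + 1) (Fin.castSucc 0) ∘ₗ
        tcons x = LinearMap.id ∘ₗ tcons x from LinearMap.congr_fun h y
      refine tpow_ext fun y z => ?_
      simp
    | succ i =>
      simp only [LinearMap.comp_apply, insertOne_succ, mulAt_succ, Fin.castSucc_succ]
      exact congrArg (tcons x) (LinearMap.congr_fun (ih i) y)

theorem mulAt_insertOne_of_le (n : ℕ) (i : Fin (n + 1)) (j : Fin (n + 1)) (h : i ≤ j) :
    mulAt k A (n + 1) i.castSucc ∘ₗ insertOne k A (n + 1) j.succ =
      insertOne k A n j ∘ₗ mulAt k A n i := by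
  induction n with
  | zero =>
    obtain rfl : i = 0 := by omega
    obtain rfl : j = 0 := by omega
    refine tpow_ext fun x y => ?_
    suffices h : mulAt k A (0 + 1) (Fin.castSucc 0) ∘ₗ insertOne k A (0 + 1) (Fin.succ 0) ∘ₗ
      tcons x = insertOne k A 0 0 ∘ₗ mulAt k A 0 0 ∘ₗ tcons x from LinearMap.congr_fun h y
    refine tpow_ext fun y z => ?_
    simp
  | succ n ih =>
    refine tpow_ext fun x y => ?_
    induction i using Fin.cases with
    | zero =>
      suffices h : mulAt k A (n + 1 + 1) (Fin.castSucc 0) ∘ₗ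
        insertOne k A (n + 1 + 1) j.succ ∘ₗ tcons x =
        insertOne k A (n + 1) j ∘ₗ mulAt k A (n + 1) 0 ∘ₗ tcons x from LinearMap.congr_fun h y
      refine tpow_ext fun y z => ?_
      induction j using Fin.cases with
      | zero => simp
      | succ j => simp
    | succ i =>
      induction j using Fin.cases with
      | zero => simp at h
      | succ j =>
        have := ih i j (by simpa using h)
        simp only [LinearMap.comp_apply, insertOne_succ, mulAt_succ, Fin.castSucc_succ]
        exact congrArg (tcons x) (LinearMap.congr_fun this y)

theorem mulAt_insertOne_of_gt (n : ℕ) (i : Fin (n + 1)) (j : Fin (n + 1)) (h : j < i) :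
    mulAt k A (n + 1) i.succ ∘ₗ insertOne k A (n + 1) j.castSucc =
      insertOne k A n j ∘ₗ mulAt k A n i := by
  induction n with
  | zero => omega
  | succ n ih =>
    refine tpow_ext fun x y => ?_
    induction i using Fin.cases with
    | zero => simp at h
    | succ i =>
      induction j using Fin.cases with
      | zero => simp
      | succ j =>
        have := ih i j (by simpa using h)
        simp only [LinearMap.comp_apply, insertOne_succ, mulAt_succ, Fin.castSucc_succ]
        exact congrArg (tcons x) (LinearMap.congr_fun this y)

theorem mulAt_succ_rotate (n : ℕ) (i : Fin (n + 1)) :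
    mulAt k A (n + 1) i.succ ∘ₗ (rotate k A (n + 2)).toLinearMap =
      (rotate k A (n + 1)).toLinearMap ∘ₗ mulAt k A (n + 1) i.castSucc := by
  refine tpow_ext_snoc fun x y => ?_
  simp

theorem insertOne_succ_rotate (n : ℕ) (i : Fin (n + 1)) :
    insertOne k A (n + 1) i.succ ∘ₗ (rotate k A (n + 1)).toLinearMap =
      (rotate k A (n + 2)).toLinearMap ∘ₗ insertOne k A (n + 1) i.castSucc := by
  refine tpow_ext_snoc fun x y => ?_
  simp

theorem mulAt_zero_rotate_rotate (n : ℕ) :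
    mulAt k A n 0 ∘ₗ (rotate k A (n + 1)).toLinearMap ∘ₗ (rotate k A (n + 1)).toLinearMap =
      (rotate k A n).toLinearMap ∘ₗ mulAt k A n (Fin.last n) := by
  refine tpow_ext_snoc fun x y => ?_
  suffices h : mulAt k A n 0 ∘ₗ (rotate k A (n + 1)).toLinearMap ∘ₗ
      (rotate k A (n + 1)).toLinearMap ∘ₗ tsnoc x =
      (rotate k A n).toLinearMap ∘ₗ mulAt k A n (Fin.last n) ∘ₗ tsnoc x from
    LinearMap.congr_fun h y
  refine tpow_ext_snoc fun y z => ?_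
  simp [mulAt_last_tsnoc, ← tsnoc_tcons]

theorem insertOne_zero_rotate (n : ℕ) :
    insertOne k A n 0 ∘ₗ (rotate k A n).toLinearMap =
      (rotate k A (n + 1)).toLinearMap ∘ₗ (rotate k A (n + 1)).toLinearMap ∘ₗ
        insertOne k A n (Fin.last n) := by
  refine tpow_ext_snoc fun x y => ?_
  simp [insertOne_last, ← tsnoc_tcons]

theorem mulAt_zero_rotate_insertOne_last (n : ℕ) :
    mulAt k A n 0 ∘ₗ (rotate k A (n + 1)).toLinearMap ∘ₗ insertOne k A n (Fin.last n) =
      LinearMap.id := by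
  refine tpow_ext fun x y => ?_
  simp [insertOne_last, -tsnoc_tcons]

theorem rotate_pow (n : ℕ) :
    ((rotate k A n).toLinearMap : Module.End k (⨂[k]^(n + 1) A)) ^ (n + 1) = 1 := by
  have h : ∀ m : ℕ, ∀ a : Fin (n + 1) → A,
      (((rotate k A n).toLinearMap : Module.End k (⨂[k]^(n + 1) A)) ^ m)
        (PiTensorProduct.tprod k a) = PiTensorProduct.tprod k
          fun i => a ((((finRotate (n + 1))⁻¹) ^ m : Equiv.Perm (Fin (n + 1))) i) := by
    intro m
    induction m with
    | zero => intro a; rfl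
    | succ m ih =>
      intro a
      rw [pow_succ, Module.End.mul_apply, LinearEquiv.coe_coe, rotate_tprod, ih, pow_succ']
      rfl
  have h2 : (finRotate (n + 1) : Equiv.Perm (Fin (n + 1))) ^ (n + 1) = 1 := by
    rcases n with _ | n
    · ext i; simp
    · have := (isCycle_finRotate (n := n)).orderOf
      rw [support_finRotate, Finset.card_univ, Fintype.card_fin] at this
      exact (congrArg (finRotate (n + 2) ^ ·) this.symm).trans (pow_orderOf_eq_one _)
  apply PiTensorProduct.ext
  ext a
  rw [LinearMap.compMultilinearMap_apply, h, inv_pow, h2]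
  rfl


/-- The face maps on tensor powers: `faceT n i` multiplies the factors `i` and `i + 1` if `i ≤ n`,
and `faceT n (n + 1)` maps `a₀ ⊗ ⋯ ⊗ aₙ₊₁` to `aₙ₊₁a₀ ⊗ a₁ ⊗ ⋯ ⊗ aₙ`. -/
noncomputable def faceT (n : ℕ) (i : Fin (n + 2)) : (⨂[k]^(n + 2) A) →ₗ[k] (⨂[k]^(n + 1) A) :=
  Fin.lastCases (motive := fun _ => _) (mulAt k A n 0 ∘ₗ (rotate k A (n + 1)).toLinearMap)
    (fun j => mulAt k A n j) i

@[simp]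
theorem faceT_last (n : ℕ) : faceT n (Fin.last (n + 1)) =
    mulAt k A n 0 ∘ₗ (rotate k A (n + 1)).toLinearMap := by
  simp [faceT]

@[simp]
theorem faceT_castSucc (n : ℕ) (j : Fin (n + 1)) : faceT n j.castSucc = mulAt k A n j := by
  simp [faceT]

theorem faceT_zero (n : ℕ) : faceT n 0 = mulAt k A n 0 := faceT_castSucc n 0

theorem faceT_zero_rotate (n : ℕ) :
    faceT n 0 ∘ₗ (rotate k A (n + 1)).toLinearMap = faceT n (Fin.last (n + 1)) := by
  rw [faceT_last, faceT_zero]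

theorem faceT_succ_rotate (n : ℕ) (i : Fin (n + 1)) :
    faceT n i.succ ∘ₗ (rotate k A (n + 1)).toLinearMap =
      (rotate k A n).toLinearMap ∘ₗ faceT n i.castSucc := by
  induction i using Fin.lastCases with
  | last => rw [Fin.succ_last, faceT_last, faceT_castSucc, ← mulAt_zero_rotate_rotate]; rfl
  | cast i =>
    rw [← Fin.castSucc_succ, faceT_castSucc, faceT_castSucc]
    cases n with
    | zero => exact i.elim0
    | succ n => exact mulAt_succ_rotate n i

theorem faceT_faceT (n : ℕ) (i j : Fin (n + 2)) (h : i ≤ j) :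
    faceT n i ∘ₗ faceT (k := k) (A := A) (n + 1) j.succ = faceT n j ∘ₗ faceT (n + 1) i.castSucc := by
  induction j using Fin.lastCases with
  | last =>
    rw [Fin.succ_last, ← faceT_zero_rotate n, LinearMap.comp_assoc, ← faceT_succ_rotate,
      ← faceT_zero_rotate (n + 1), ← LinearMap.comp_assoc, ← LinearMap.comp_assoc]
    congr 1
    induction i using Fin.lastCases with
    | last =>
      rw [Fin.succ_last, ← faceT_zero_rotate n, ← faceT_zero_rotate (n + 1), LinearMap.comp_assoc,
        ← LinearMap.comp_assoc]
      have := faceT_succ_rotate (k := k) (A := A) (n + 1) 0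
      rw [Fin.castSucc_zero] at this
      rw [LinearMap.comp_assoc, ← this, ← LinearMap.comp_assoc, ← LinearMap.comp_assoc]
      congr 1
      rw [faceT_zero, faceT_zero, show (Fin.succ (0 : Fin (n + 1 + 1))) = Fin.castSucc (Fin.succ 0) from rfl, faceT_castSucc]
      exact mulAt_mulAt n 0 0 le_rfl
    | cast i =>
      rw [← Fin.castSucc_succ, faceT_castSucc, faceT_castSucc, faceT_zero, faceT_zero]
      exact (mulAt_mulAt n 0 i (Fin.zero_le i)).symm
  | cast j =>
    induction i using Fin.lastCases with
    | last =>
      exact absurd (lt_of_le_of_lt h (Fin.castSucc_lt_last j)) (lt_irrefl _)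
    | cast i =>
      rw [← Fin.castSucc_succ, faceT_castSucc, faceT_castSucc, faceT_castSucc, faceT_castSucc]
      exact mulAt_mulAt n i j (by simpa using h)

theorem faceT_insertOne_of_le (n : ℕ) (i : Fin (n + 2)) (j : Fin (n + 1)) (h : i ≤ j.castSucc) :
    faceT (n + 1) i.castSucc ∘ₗ insertOne k A (n + 1) j.succ = insertOne k A n j ∘ₗ faceT n i := by
  induction i using Fin.lastCases with
  | last => exact absurd (lt_of_le_of_lt h (Fin.castSucc_lt_last j)) (lt_irrefl _)
  | cast i =>
    rw [faceT_castSucc, faceT_castSucc]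
    exact mulAt_insertOne_of_le n i j (by simpa using h)

theorem faceT_insertOne_self (n : ℕ) (i : Fin (n + 1)) :
    faceT n i.castSucc ∘ₗ insertOne k A n i = LinearMap.id := by
  rw [faceT_castSucc]; exact mulAt_insertOne_self n i

theorem faceT_succ_insertOne (n : ℕ) (i : Fin (n + 1)) :
    faceT n i.succ ∘ₗ insertOne k A n i = LinearMap.id := by
  induction i using Fin.lastCases with
  | last => rw [Fin.succ_last, faceT_last]; exact mulAt_zero_rotate_insertOne_last n
  | cast i =>
    rw [← Fin.castSucc_succ, faceT_castSucc]
    cases n with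
    | zero => exact i.elim0
    | succ n => exact mulAt_succ_insertOne n i

theorem faceT_insertOne_of_gt (n : ℕ) (i : Fin (n + 2)) (j : Fin (n + 1)) (h : j.castSucc < i) :
    faceT (n + 1) i.succ ∘ₗ insertOne k A (n + 1) j.castSucc = insertOne k A n j ∘ₗ faceT n i := by
  induction i using Fin.lastCases with
  | last =>
    rw [Fin.succ_last, ← faceT_zero_rotate, LinearMap.comp_assoc, ← insertOne_succ_rotate,
      ← faceT_zero_rotate, ← LinearMap.comp_assoc, ← LinearMap.comp_assoc]
    congr 1
    exact faceT_insertOne_of_le n 0 j (Fin.zero_le _)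
  | cast i =>
    rw [← Fin.castSucc_succ, faceT_castSucc, faceT_castSucc]
    exact mulAt_insertOne_of_gt n i j (by simpa using h)

variable (B : Subalgebra k A)

/-- The relations of the cyclic tensor product over `B`:
`⋯ ⊗ aᵢb ⊗ aᵢ₊₁ ⊗ ⋯ = ⋯ ⊗ aᵢ ⊗ baᵢ₊₁ ⊗ ⋯` for `b ∈ B`, where the indices `0, …, n` are taken
cyclically, so that the last relation is `a₀ ⊗ ⋯ ⊗ aₙb = ba₀ ⊗ ⋯ ⊗ aₙ`. -/
def cyclicRel (n : ℕ) : Submodule k (⨂[k]^(n + 1) A) :=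
  Submodule.span k {z | ∃ (a : Fin (n + 1) → A) (i : Fin (n + 1)), ∃ b ∈ B,
    z = PiTensorProduct.tprod k (Function.update a i (a i * b)) -
      PiTensorProduct.tprod k (Function.update a (i + 1) (b * a (i + 1)))}

/-- The cyclic tensor product `A ⊗̂_B ⋯ ⊗̂_B A = (A ⊗_B ⋯ ⊗_B A) / [A ⊗_B ⋯ ⊗_B A, B]`
of `n + 1` copies of `A`. -/
abbrev CyclicTensor (n : ℕ) : Type u := (⨂[k]^(n + 1) A) ⧸ cyclicRel B n

theorem cyclicRel_le_comap {n m : ℕ} (f : (⨂[k]^(n + 1) A) →ₗ[k] (⨂[k]^(m + 1) A))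
    (h : ∀ (a : Fin (n + 1) → A) (i : Fin (n + 1)), ∀ b ∈ B,
      f (PiTensorProduct.tprod k (Function.update a i (a i * b))) -
        f (PiTensorProduct.tprod k (Function.update a (i + 1) (b * a (i + 1)))) ∈ cyclicRel B m) :
    cyclicRel B n ≤ (cyclicRel B m).comap f := by
  rw [cyclicRel, Submodule.span_le]
  rintro _ ⟨a, i, b, hb, rfl⟩
  simpa using h a i b hb

variable {B} in
theorem mem_cyclicRel {n : ℕ} (a : Fin (n + 1) → A) (i : Fin (n + 1)) {b : A} (hb : b ∈ B) :
    PiTensorProduct.tprod k (Function.update a i (a i * b)) -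
      PiTensorProduct.tprod k (Function.update a (i + 1) (b * a (i + 1))) ∈ cyclicRel B n :=
  Submodule.subset_span ⟨a, i, b, hb, rfl⟩

theorem cyclicRel_le_rotate (n : ℕ) :
    cyclicRel B n ≤ (cyclicRel B n).comap (rotate k A n).toLinearMap := by
  refine cyclicRel_le_comap B _ fun a i b hb => ?_
  have h : ∀ j x, rotate k A n (PiTensorProduct.tprod k (Function.update a j x)) =
      PiTensorProduct.tprod k
        (Function.update (a ∘ (finRotate (n + 1)).symm) (finRotate (n + 1) j) x) := by
    intro j x
    rw [rotate_tprod]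
    congr 1
    exact Function.update_comp_equiv a (finRotate (n + 1)).symm j x
  rw [LinearEquiv.coe_coe, h, h]
  have := mem_cyclicRel (a ∘ (finRotate (n + 1)).symm) (finRotate (n + 1) i) hb
  rw [finRotate_apply, finRotate_apply] at *
  simpa [← finRotate_apply] using this

theorem cyclicRel_le_rotate_symm (n : ℕ) :
    cyclicRel B n ≤ (cyclicRel B n).comap (rotate k A n).symm.toLinearMap := by
  have h : ∀ m, cyclicRel B n ≤ (cyclicRel B n).comap
      (((rotate k A n).toLinearMap : Module.End k (⨂[k]^(n + 1) A)) ^ m) := by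
    intro m
    induction m with
    | zero => exact le_of_eq (Submodule.comap_id _).symm
    | succ m ih =>
      intro x hx
      rw [pow_succ]
      exact ih (cyclicRel_le_rotate B n hx)
  have h2 : (rotate k A n).symm.toLinearMap =
      ((rotate k A n).toLinearMap : Module.End k (⨂[k]^(n + 1) A)) ^ n := by
    ext1
    ext a
    have := LinearMap.congr_fun (rotate_pow (k := k) (A := A) n)
      ((rotate k A n).symm (PiTensorProduct.tprod k a))
    rw [pow_succ, Module.End.mul_apply, LinearEquiv.coe_coe, LinearEquiv.apply_symm_apply] at this
    exact this.symm
  rw [h2]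
  exact h n

theorem mulAt_zero_tprod (n : ℕ) (a : Fin (n + 2) → A) :
    mulAt k A n 0 (PiTensorProduct.tprod k a) = PiTensorProduct.tprod k
      (Fin.cons (a 0 * a 1) (fun i => a i.succ.succ) : Fin (n + 1) → A) := by
  rw [tprod_eq_tcons, tprod_eq_tcons, mulAt_zero, tcons_tprod]
  rfl

theorem contract_update_zero (n : ℕ) (a : Fin (n + 2) → A) (y : A) :
    (Fin.cons (Function.update a 0 y 0 * Function.update a 0 y 1)
      (fun i => Function.update a 0 y i.succ.succ) : Fin (n + 1) → A) =
    Function.update (Fin.cons (a 0 * a 1) (fun i => a i.succ.succ) : Fin (n + 1) → A) 0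
      (y * a 1) := by
  ext j
  induction j using Fin.cases with
  | zero => simp
  | succ j => simp [Fin.succ_ne_zero]

theorem contract_update_one (n : ℕ) (a : Fin (n + 2) → A) (y : A) :
    (Fin.cons (Function.update a 1 y 0 * Function.update a 1 y 1)
      (fun i => Function.update a 1 y i.succ.succ) : Fin (n + 1) → A) =
    Function.update (Fin.cons (a 0 * a 1) (fun i => a i.succ.succ) : Fin (n + 1) → A) 0
      (a 0 * y) := by
  ext j
  induction j using Fin.cases with
  | zero => simp
  | succ j =>
    have h2 : (j.succ.succ : Fin (n + 2)) ≠ 1 := by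
      rw [← Fin.succ_zero_eq_one]; exact fun h => Fin.succ_ne_zero _ (Fin.succ_injective _ h)
    simp [h2]

theorem contract_update_succ_succ (n : ℕ) (a : Fin (n + 2) → A) (i : Fin n) (y : A) :
    (Fin.cons (Function.update a i.succ.succ y 0 * Function.update a i.succ.succ y 1)
      (fun j => Function.update a i.succ.succ y j.succ.succ) : Fin (n + 1) → A) =
    Function.update (Fin.cons (a 0 * a 1) (fun i => a i.succ.succ) : Fin (n + 1) → A) i.succ
      y := by
  ext j
  induction j using Fin.cases with
  | zero =>
    have h2 : (i.succ.succ : Fin (n + 2)) ≠ 1 := by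
      rw [← Fin.succ_zero_eq_one]; exact fun h => Fin.succ_ne_zero _ (Fin.succ_injective _ h)
    simp [Function.update_of_ne h2.symm, (Fin.succ_ne_zero _).symm]
  | succ j => simp [Function.update_apply]

theorem cyclicRel_le_mulAt_zero (n : ℕ) :
    cyclicRel B (n + 1) ≤ (cyclicRel B n).comap (mulAt k A n 0) := by
  refine cyclicRel_le_comap B _ fun a i b hb => ?_
  rw [mulAt_zero_tprod, mulAt_zero_tprod]
  induction i using Fin.cases with
  | zero =>
    rw [zero_add, contract_update_zero, contract_update_one, mul_assoc, sub_self]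
    exact Submodule.zero_mem _
  | succ i =>
    have := mem_cyclicRel (Fin.cons (a 0 * a 1) (fun i => a i.succ.succ) : Fin (n + 1) → A) i hb
    have h1 : (Fin.cons (Function.update a i.succ (a i.succ * b) 0 *
          Function.update a i.succ (a i.succ * b) 1)
        (fun j => Function.update a i.succ (a i.succ * b) j.succ.succ) : Fin (n + 1) → A) =
        Function.update (Fin.cons (a 0 * a 1) (fun i => a i.succ.succ) : Fin (n + 1) → A) i
          ((Fin.cons (a 0 * a 1) (fun i => a i.succ.succ) : Fin (n + 1) → A) i * b) := by
      induction i using Fin.cases with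
      | zero => rw [Fin.succ_zero_eq_one, contract_update_one, Fin.cons_zero, mul_assoc]
      | succ i => rw [contract_update_succ_succ, Fin.cons_succ]
    rw [h1]
    convert this using 3
    induction i using Fin.lastCases with
    | last =>
      rw [Fin.succ_last, Fin.last_add_one, Fin.last_add_one, contract_update_zero, Fin.cons_zero,
        mul_assoc]
    | cast i =>
      rw [Fin.coeSucc_eq_succ, Fin.succ_castSucc, Fin.coeSucc_eq_succ, contract_update_succ_succ,
        Fin.cons_succ]

theorem insertOne_zero_tprod (n : ℕ) (a : Fin (n + 1) → A) :
    insertOne k A n 0 (PiTensorProduct.tprod k a) = PiTensorProduct.tprod k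
      (Fin.cons (a 0) (Fin.cons 1 (fun i => a i.succ)) : Fin (n + 2) → A) := by
  rw [tprod_eq_tcons, insertOne_zero, tcons_tprod, tcons_tprod]
  rfl

theorem insert_update_zero (n : ℕ) (a : Fin (n + 1) → A) (y : A) :
    (Fin.cons (Function.update a 0 y 0) (Fin.cons 1 (fun i => Function.update a 0 y i.succ)) :
      Fin (n + 2) → A) =
    Function.update (Fin.cons (a 0) (Fin.cons 1 (fun i => a i.succ)) : Fin (n + 2) → A) 0 y := by
  ext j
  induction j using Fin.cases with
  | zero => simp
  | succ j => simp [Fin.succ_ne_zero]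

theorem insert_update_succ (n : ℕ) (a : Fin (n + 1) → A) (i : Fin n) (y : A) :
    (Fin.cons (Function.update a i.succ y 0)
      (Fin.cons 1 (fun j => Function.update a i.succ y j.succ)) : Fin (n + 2) → A) =
    Function.update (Fin.cons (a 0) (Fin.cons 1 (fun i => a i.succ)) : Fin (n + 2) → A)
      i.succ.succ y := by
  ext j
  induction j using Fin.cases with
  | zero => simp [(Fin.succ_ne_zero _).symm]
  | succ j =>
    induction j using Fin.cases with
    | zero =>
      have h2 : (i.succ.succ : Fin (n + 2)) ≠ 1 := by
        rw [← Fin.succ_zero_eq_one]; exact fun h => Fin.succ_ne_zero _ (Fin.succ_injective _ h)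
      simp [Function.update_of_ne h2.symm]
    | succ j => simp [Function.update_apply]

theorem cyclicRel_le_insertOne_zero (n : ℕ) :
    cyclicRel B n ≤ (cyclicRel B (n + 1)).comap (insertOne k A n 0) := by
  refine cyclicRel_le_comap B _ fun a i b hb => ?_
  rw [insertOne_zero_tprod, insertOne_zero_tprod]
  set c : Fin (n + 2) → A := Fin.cons (a 0) (Fin.cons 1 (fun i => a i.succ)) with hc
  have hc0 : c 0 = a 0 := rfl
  have hc1 : c 1 = 1 := rfl
  have hcs : ∀ i : Fin n, c i.succ.succ = a i.succ := fun i => rfl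
  have key : ∀ i : Fin (n + 1), (Fin.cons (Function.update a (i + 1) (b * a (i + 1)) 0)
      (Fin.cons 1 (fun j => Function.update a (i + 1) (b * a (i + 1)) j.succ)) : Fin (n + 2) → A) =
      Function.update c (i.succ + 1) (b * c (i.succ + 1)) := by
    intro i
    induction i using Fin.lastCases with
    | last => rw [Fin.succ_last, Fin.last_add_one, Fin.last_add_one, insert_update_zero, hc0]
    | cast i =>
      rw [Fin.coeSucc_eq_succ, Fin.succ_castSucc, Fin.coeSucc_eq_succ, insert_update_succ, hcs]
  rw [key]
  induction i using Fin.cases with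
  | zero =>
    rw [insert_update_zero]
    have h1 := mem_cyclicRel c 0 hb
    have h2 := mem_cyclicRel c 1 hb
    rw [zero_add, hc0, hc1, mul_one] at h1
    rw [hc1, one_mul] at h2
    have := (cyclicRel B (n + 1)).add_mem h1 h2
    rwa [sub_add_sub_cancel] at this
  | succ i =>
    rw [insert_update_succ, ← hcs]
    exact mem_cyclicRel c i.succ.succ hb

theorem cyclicRel_le_faceT (n : ℕ) (i : Fin (n + 2)) :
    cyclicRel B (n + 1) ≤ (cyclicRel B n).comap (faceT n i) := by
  induction i using Fin.induction with
  | zero => rw [faceT_zero]; exact cyclicRel_le_mulAt_zero B n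
  | succ i ih =>
    intro x hx
    have h := LinearMap.congr_fun (faceT_succ_rotate n i) ((rotate k A (n + 1)).symm x)
    simp only [LinearMap.comp_apply, LinearEquiv.coe_coe, LinearEquiv.apply_symm_apply] at h
    rw [Submodule.mem_comap, h]
    exact cyclicRel_le_rotate B n (ih (cyclicRel_le_rotate_symm B (n + 1) hx))

theorem cyclicRel_le_insertOne (n : ℕ) (i : Fin (n + 1)) :
    cyclicRel B n ≤ (cyclicRel B (n + 1)).comap (insertOne k A n i) := by
  cases n with
  | zero =>
    obtain rfl : i = 0 := by omega
    exact cyclicRel_le_insertOne_zero B 0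
  | succ n =>
    induction i using Fin.induction with
    | zero => exact cyclicRel_le_insertOne_zero B (n + 1)
    | succ i ih =>
      intro x hx
      have h := LinearMap.congr_fun (insertOne_succ_rotate n i) ((rotate k A (n + 1)).symm x)
      simp only [LinearMap.comp_apply, LinearEquiv.coe_coe, LinearEquiv.apply_symm_apply] at h
      rw [Submodule.mem_comap, h]
      exact cyclicRel_le_rotate B _ (ih (cyclicRel_le_rotate_symm B (n + 1) hx))

theorem mapQ_comp_eq {M₁ M₂ M₂' M₃ : Type u} [AddCommGroup M₁] [AddCommGroup M₂]
    [AddCommGroup M₂'] [AddCommGroup M₃] [Module k M₁] [Module k M₂] [Module k M₂'] [Module k M₃]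
    {R₁ : Submodule k M₁} {R₂ : Submodule k M₂} {R₂' : Submodule k M₂'} {R₃ : Submodule k M₃}
    {f : M₁ →ₗ[k] M₂} {g : M₂ →ₗ[k] M₃} {f' : M₁ →ₗ[k] M₂'} {g' : M₂' →ₗ[k] M₃}
    (hf : R₁ ≤ R₂.comap f) (hg : R₂ ≤ R₃.comap g) (hf' : R₁ ≤ R₂'.comap f')
    (hg' : R₂' ≤ R₃.comap g') (h : g ∘ₗ f = g' ∘ₗ f') :
    R₂.mapQ R₃ g hg ∘ₗ R₁.mapQ R₂ f hf = R₂'.mapQ R₃ g' hg' ∘ₗ R₁.mapQ R₂' f' hf' := by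
  apply Submodule.linearMap_qext
  ext x
  exact congrArg (Submodule.Quotient.mk) (LinearMap.congr_fun h x)

theorem mapQ_comp_eq_id {M₁ M₂ : Type u} [AddCommGroup M₁] [AddCommGroup M₂]
    [Module k M₁] [Module k M₂] {R₁ : Submodule k M₁} {R₂ : Submodule k M₂}
    {f : M₁ →ₗ[k] M₂} {g : M₂ →ₗ[k] M₁} (hf : R₁ ≤ R₂.comap f) (hg : R₂ ≤ R₁.comap g)
    (h : g ∘ₗ f = LinearMap.id) :
    R₂.mapQ R₁ g hg ∘ₗ R₁.mapQ R₂ f hf = LinearMap.id := by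
  apply Submodule.linearMap_qext
  ext x
  exact congrArg (Submodule.Quotient.mk) (LinearMap.congr_fun h x)

/-- The simplicial module `Z_*(A/B)` of an extension of algebras `A/B`. -/
noncomputable def relSimplicialModule : SimplicialModule k where
  obj n := CyclicTensor B n
  d n i := (cyclicRel B (n + 1)).mapQ (cyclicRel B n) (faceT n i) (cyclicRel_le_faceT B n i)
  s n i := (cyclicRel B n).mapQ (cyclicRel B (n + 1)) (insertOne k A n i)
    (cyclicRel_le_insertOne B n i)
  d_d n i j h := mapQ_comp_eq _ _ _ _ (faceT_faceT n i j h)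
  s_s n i j h := mapQ_comp_eq _ _ _ _ (insertOne_insertOne n i j h)
  d_s_of_le n i j h := mapQ_comp_eq _ _ _ _ (faceT_insertOne_of_le n i j h)
  d_s_castSucc n i := mapQ_comp_eq_id _ _ (faceT_insertOne_self n i)
  d_s_succ n i := mapQ_comp_eq_id _ _ (faceT_succ_insertOne n i)
  d_s_of_gt n i j h := mapQ_comp_eq _ _ _ _ (faceT_insertOne_of_gt n i j h)

/-- The cyclic module `Z_*(A/B)` of an extension of algebras `A/B`, with the cyclic operator
`a₀ ⊗ ⋯ ⊗ aₙ ↦ aₙ ⊗ a₀ ⊗ ⋯ ⊗ aₙ₋₁`. -/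
noncomputable def relCyclicModule : CyclicModule k where
  toSimplicialModule := relSimplicialModule B
  t n := (cyclicRel B n).mapQ (cyclicRel B n) (rotate k A n).toLinearMap (cyclicRel_le_rotate B n)
  isCyclicOperator :=
    { pow_eq_id := fun n => by
        have h : ∀ (m : ℕ) (x : ⨂[k]^(n + 1) A),
            (((cyclicRel B n).mapQ (cyclicRel B n) (rotate k A n).toLinearMap
              (cyclicRel_le_rotate B n) : Module.End k (CyclicTensor B n)) ^ m)
              (Submodule.Quotient.mk x) = Submodule.Quotient.mk
              ((((rotate k A n).toLinearMap : Module.End k (⨂[k]^(n + 1) A)) ^ m) x) := by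
          intro m
          induction m with
          | zero => intro x; rfl
          | succ m ih =>
            intro x
            rw [pow_succ, pow_succ, Module.End.mul_apply, Module.End.mul_apply, ← ih]
            rfl
        apply Submodule.linearMap_qext
        refine LinearMap.ext fun x => ?_
        refine (h (n + 1) x).trans ?_
        rw [rotate_pow]
        rfl
      d_succ_t := fun n i => mapQ_comp_eq (cyclicRel_le_rotate B _)
        (cyclicRel_le_faceT B _ _) (cyclicRel_le_faceT B _ _) (cyclicRel_le_rotate B _)
        (faceT_succ_rotate n i)
      d_zero_t := fun n => by
        apply Submodule.linearMap_qext
        refine LinearMap.ext fun x => ?_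
        exact congrArg Submodule.Quotient.mk (LinearMap.congr_fun (faceT_zero_rotate n) x)
      s_succ_t := fun n i => by
        cases n with
        | zero => exact i.elim0
        | succ n =>
          exact mapQ_comp_eq (cyclicRel_le_rotate B _) (cyclicRel_le_insertOne B _ _)
            (cyclicRel_le_insertOne B _ _) (cyclicRel_le_rotate B _) (insertOne_succ_rotate n i)
      s_zero_t := fun n => by
        apply Submodule.linearMap_qext
        refine LinearMap.ext fun x => ?_
        exact congrArg Submodule.Quotient.mk (LinearMap.congr_fun (insertOne_zero_rotate n) x) }

end RelativeCyclicModule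

section HopfGalois

variable {k : Type u} [Field k]

/-- The relations `x·c ⊗ m = x ⊗ c·m` defining `X ⊗_R M`, where `r` is the right action of `R` on
`X`, that is `r c x = x·c`, and `l` is the left action of `R` on `M`. -/
def balancedRel {R X M : Type u} [AddCommGroup R] [Module k R] [AddCommGroup X] [Module k X]
    [AddCommGroup M] [Module k M] (r : R →ₗ[k] Module.End k X) (l : R →ₗ[k] Module.End k M) :
    Submodule k (X ⊗[k] M) :=
  Submodule.span k {z | ∃ (c : R) (x : X) (m : M), z = r c x ⊗ₜ[k] m - x ⊗ₜ[k] l c m}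

/-- The tensor product `X ⊗_R M` of a right `R`-module `X` and a left `R`-module `M` over a (possibly
noncommutative) `k`-algebra `R`. -/
abbrev BalancedTensor {R X M : Type u} [AddCommGroup R] [Module k R] [AddCommGroup X] [Module k X]
    [AddCommGroup M] [Module k M] (r : R →ₗ[k] Module.End k X) (l : R →ₗ[k] Module.End k M) :
    Type u :=
  (X ⊗[k] M) ⧸ balancedRel r l

theorem balancedRel_le {R X M P : Type u} [AddCommGroup R] [Module k R] [AddCommGroup X]
    [Module k X] [AddCommGroup M] [Module k M] [AddCommGroup P] [Module k P]
    (r : R →ₗ[k] Module.End k X) (l : R →ₗ[k] Module.End k M) (Q : Submodule k P)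
    (f : X ⊗[k] M →ₗ[k] P) (h : ∀ c x m, f (r c x ⊗ₜ m) - f (x ⊗ₜ l c m) ∈ Q) :
    balancedRel r l ≤ Q.comap f := by
  rw [balancedRel, Submodule.span_le]
  rintro _ ⟨c, x, m, rfl⟩
  simpa using h c x m

variable {H : Type u} [Ring H] [HopfAlgebra k H] {A : Type u} [Ring A] [Algebra k A]

/-- The right multiplication of `B` on `A`. -/
def rightMul (B : Subalgebra k A) : B →ₗ[k] Module.End k A :=
  (LinearMap.mul k A).flip ∘ₗ B.val.toLinearMap

/-- The left multiplication of `B` on `A`. -/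
def leftMul (B : Subalgebra k A) : B →ₗ[k] Module.End k A :=
  LinearMap.mul k A ∘ₗ B.val.toLinearMap

/-- The tensor product `A ⊗_B A`. -/
abbrev TensorOver (B : Subalgebra k A) : Type u := BalancedTensor (rightMul B) (leftMul B)

/-- The canonical map `β : A ⊗_B A → A ⊗ H`, `β(a ⊗_B y) = a ρ(y)`. -/
noncomputable def canonicalMap (B : Subalgebra k A) (ρ : A →ₐ[k] A ⊗[k] H)
    (hB : ∀ b ∈ B, ρ b = b ⊗ₜ 1) : TensorOver B →ₗ[k] A ⊗[k] H :=
  (balancedRel (rightMul B) (leftMul B)).liftQ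
    (TensorProduct.lift ((LinearMap.mul k (A ⊗[k] H)).compl₁₂
      (Algebra.TensorProduct.includeLeft : A →ₐ[k] A ⊗[k] H).toLinearMap ρ.toLinearMap))
    (balancedRel_le _ _ ⊥ _ fun c x m => by
      simp [rightMul, leftMul, ← mul_assoc, hB c.1 c.2])

/-- `A/B` is an `H`-Galois extension: `A` is a right `H`-comodule via an algebra map
`coact : A → A ⊗ H`, the subalgebra of coinvariants is `B`, and the canonical map
`A ⊗_B A → A ⊗ H` is bijective. -/
structure HopfGaloisExtension (H : Type u) [Ring H] [HopfAlgebra k H] (B : Subalgebra k A) where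
  coact : A →ₐ[k] A ⊗[k] H
  coassoc : (TensorProduct.assoc k A H H).toLinearMap ∘ₗ
    coact.toLinearMap.rTensor H ∘ₗ coact.toLinearMap =
      (Coalgebra.comul (R := k) (A := H)).lTensor A ∘ₗ coact.toLinearMap
  counit_comp : (TensorProduct.rid k A).toLinearMap ∘ₗ
    (Coalgebra.counit (R := k) (A := H)).lTensor A ∘ₗ coact.toLinearMap = LinearMap.id
  mem_iff : ∀ a, a ∈ B ↔ coact a = a ⊗ₜ 1
  bijective : Function.Bijective (canonicalMap B coact fun b hb => (mem_iff b).1 hb)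

/-- The subspace `[A, B]` of `A` spanned by the commutators `ab - ba` with `b ∈ B`. -/
def commutators (B : Subalgebra k A) : Submodule k A :=
  Submodule.span k {z | ∃ a : A, ∃ b ∈ B, z = a * b - b * a}

/-- `A_B = A / [A, B]`. -/
abbrev CommQuot (B : Subalgebra k A) : Type u := A ⧸ commutators B

/-- The map `A ⊗_B A → Hom(A, A_B)` that maps `x ⊗ y` to `m ↦ [ymx]`. -/
noncomputable def sandwich (B : Subalgebra k A) : TensorOver B →ₗ[k] (A →ₗ[k] CommQuot B) :=
  (balancedRel (rightMul B) (leftMul B)).liftQ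
    (TensorProduct.lift (LinearMap.mk₂ k
      (fun x y => (commutators B).mkQ ∘ₗ LinearMap.mulLeft k y ∘ₗ LinearMap.mulRight k x)
      (fun x x' y => by ext; simp [mul_add]) (fun c x y => by ext; simp)
      (fun x y y' => by ext; simp [add_mul]) (fun c x y => by ext; simp)))
    (balancedRel_le _ _ ⊥ _ fun c x y => by
      rw [Submodule.mem_bot, sub_eq_zero]
      ext m
      simp only [rightMul, leftMul, TensorProduct.lift.tmul, LinearMap.mk₂_apply,
        LinearMap.comp_apply, Submodule.mkQ_apply, LinearMap.mulLeft_apply,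
        LinearMap.mulRight_apply, LinearMap.flip_apply, LinearMap.mul_apply',
        AlgHom.toLinearMap_apply, Subalgebra.val_apply]
      rw [Submodule.Quotient.eq]
      exact Submodule.subset_span ⟨y * (m * x), c, c.2, by simp [mul_assoc]⟩)

@[simp]
theorem sandwich_mk (B : Subalgebra k A) (x y m : A) :
    sandwich B (Submodule.Quotient.mk (x ⊗ₜ y)) m = Submodule.Quotient.mk (y * (m * x)) := rfl

namespace HopfGaloisExtension

variable {B : Subalgebra k A} (E : HopfGaloisExtension H B)

/-- The canonical isomorphism `β : A ⊗_B A ≃ A ⊗ H`. -/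
noncomputable def canonicalEquiv : TensorOver B ≃ₗ[k] A ⊗[k] H :=
  LinearEquiv.ofBijective (canonicalMap B E.coact fun b hb => (E.mem_iff b).1 hb) E.bijective

theorem canonicalEquiv_mk (x y : A) :
    E.canonicalEquiv (Submodule.Quotient.mk (x ⊗ₜ y)) = (x ⊗ₜ 1) * E.coact y := rfl

/-- The translation map `κ : H → A ⊗_B A`, `κ(h) = β⁻¹(1 ⊗ h)`. -/
noncomputable def translation : H →ₗ[k] TensorOver B :=
  E.canonicalEquiv.symm.toLinearMap ∘ₗ TensorProduct.mk k A H 1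

/-- Left multiplication by `b ∈ B` on `A ⊗_B A`. -/
noncomputable def lmulT (B : Subalgebra k A) (b : A) : TensorOver B →ₗ[k] TensorOver B :=
  (balancedRel _ _).mapQ (balancedRel _ _) ((LinearMap.mulLeft k b).rTensor A)
    (balancedRel_le _ _ _ _ fun c x y => Submodule.subset_span
      ⟨c, b * x, y, by simp [rightMul, mul_assoc]⟩)

/-- Right multiplication by `b ∈ B` on `A ⊗_B A`. -/
noncomputable def rmulT (B : Subalgebra k A) (b : A) : TensorOver B →ₗ[k] TensorOver B :=
  (balancedRel _ _).mapQ (balancedRel _ _) ((LinearMap.mulRight k b).lTensor A)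
    (balancedRel_le _ _ _ _ fun c x y => Submodule.subset_span
      ⟨c, x, y * b, by simp [leftMul, mul_assoc]⟩)

theorem tensorOver_induction {p : TensorOver B → Prop} (z : TensorOver B)
    (h0 : p 0) (h1 : ∀ x y, p (Submodule.Quotient.mk (x ⊗ₜ y)))
    (h2 : ∀ z w, p z → p w → p (z + w)) : p z := by
  induction z using Submodule.Quotient.induction_on with
  | _ z =>
    induction z using TensorProduct.induction_on with
    | zero => exact h0
    | tmul x y => exact h1 x y
    | add z w hz hw => exact h2 _ _ hz hw

theorem lmulT_translation (b : A) (hb : b ∈ B) (h : H) :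
    lmulT B b (E.translation h) = rmulT B b (E.translation h) := by
  have h1 : ∀ z, E.canonicalEquiv (lmulT B b z) = (b ⊗ₜ 1) * E.canonicalEquiv z := by
    intro z
    induction z using tensorOver_induction with
    | h0 => simp
    | h1 x y =>
      change (b * x) ⊗ₜ[k] (1 : H) * E.coact y = (b ⊗ₜ 1) * ((x ⊗ₜ 1) * E.coact y)
      rw [← mul_assoc, Algebra.TensorProduct.tmul_mul_tmul, one_mul]
    | h2 z w hz hw => simp only [map_add, mul_add, hz, hw]
  have h2 : ∀ z, E.canonicalEquiv (rmulT B b z) = E.canonicalEquiv z * (b ⊗ₜ 1) := by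
    intro z
    induction z using tensorOver_induction with
    | h0 => simp
    | h1 x y =>
      change x ⊗ₜ[k] (1 : H) * E.coact (y * b) = ((x ⊗ₜ 1) * E.coact y) * (b ⊗ₜ 1)
      rw [map_mul, (E.mem_iff b).1 hb, mul_assoc]
    | h2 z w hz hw => simp only [map_add, add_mul, hz, hw]
  apply E.canonicalEquiv.injective
  rw [h1, h2]
  simp [translation]

/-- The left action of `H` on `A_B`: `h·[m] = ∑ [κ²(h) m κ¹(h)]`, where `κ(h) = ∑ κ¹(h) ⊗ κ²(h)`. -/
noncomputable def act : H →ₗ[k] Module.End k (CommQuot B) where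
  toFun h := (commutators B).liftQ (sandwich B (E.translation h)) (by
    refine Submodule.span_le.2 ?_
    rintro _ ⟨a, b, hb, rfl⟩
    have h1 : ∀ z, sandwich B (lmulT B b z) a = sandwich B z (a * b) := by
      intro z
      induction z using tensorOver_induction with
      | h0 => simp
      | h1 x y =>
        change sandwich B (Submodule.Quotient.mk ((b * x) ⊗ₜ y)) a = _
        simp [mul_assoc]
      | h2 z w hz hw => simp only [map_add, LinearMap.add_apply, hz, hw]
    have h2 : ∀ z, sandwich B (rmulT B b z) a = sandwich B z (b * a) := by
      intro z
      induction z using tensorOver_induction with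
      | h0 => simp
      | h1 x y =>
        change sandwich B (Submodule.Quotient.mk (x ⊗ₜ (y * b))) a = _
        simp [mul_assoc]
      | h2 z w hz hw => simp only [map_add, LinearMap.add_apply, hz, hw]
    rw [SetLike.mem_coe, LinearMap.mem_ker, map_sub, ← h1, ← h2, E.lmulT_translation b hb, sub_self])
  map_add' h h' := by
    apply Submodule.linearMap_qext
    ext m
    simp
    rfl
  map_smul' c h := by
    apply Submodule.linearMap_qext
    ext m
    simp
    rfl

theorem act_mk (h : H) (m : A) :
    E.act h (Submodule.Quotient.mk m) = sandwich B (E.translation h) m := rfl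

/-- The right coaction of `H` on `A_B`: `[a] ↦ ∑ [a₍₀₎] ⊗ a₍₁₎`. -/
noncomputable def coactQuot : CommQuot B →ₗ[k] CommQuot B ⊗[k] H :=
  (commutators B).liftQ ((commutators B).mkQ.rTensor H ∘ₗ E.coact.toLinearMap) (by
    refine Submodule.span_le.2 ?_
    rintro _ ⟨a, b, hb, rfl⟩
    have h1 : ∀ z : A ⊗[k] H, (commutators B).mkQ.rTensor H (z * (b ⊗ₜ 1)) =
        (commutators B).mkQ.rTensor H ((b ⊗ₜ 1) * z) := by
      intro z
      induction z using TensorProduct.induction_on with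
      | zero => simp
      | tmul x y =>
        have : (commutators B).mkQ (x * b) = (commutators B).mkQ (b * x) :=
          (Submodule.Quotient.eq _).2 (Submodule.subset_span ⟨x, b, hb, rfl⟩)
        rw [Algebra.TensorProduct.tmul_mul_tmul, Algebra.TensorProduct.tmul_mul_tmul,
          LinearMap.rTensor_tmul, LinearMap.rTensor_tmul, this, one_mul, mul_one]
      | add z w hz hw => simp only [map_add, mul_add, add_mul, hz, hw]
    rw [SetLike.mem_coe, LinearMap.mem_ker, map_sub, sub_eq_zero, LinearMap.comp_apply,
      LinearMap.comp_apply, AlgHom.toLinearMap_apply, AlgHom.toLinearMap_apply, map_mul E.coact,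
      map_mul E.coact,
      (E.mem_iff b).1 hb, h1])

end HopfGaloisExtension

end HopfGalois

section HopfSimplicial

variable {k : Type u} [Field k] {H : Type u} [Ring H] [HopfAlgebra k H]

/-- The map `((x ⊗ y), z) ↦ x ⊗ y ⊗ z` for `x, y ∈ H` and `z ∈ H^{⊗n}`. -/
noncomputable def tcons₂ {n : ℕ} : H ⊗[k] H →ₗ[k] (⨂[k]^n H) →ₗ[k] (⨂[k]^(n + 2) H) :=
  TensorProduct.lift ((LinearMap.llcomp k (⨂[k]^n H) (⨂[k]^(n + 1) H) (⨂[k]^(n + 2) H) ∘ₗ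
    tcons).compl₂ tcons)

@[simp]
theorem tcons₂_tmul {n : ℕ} (x y : H) (z : ⨂[k]^n H) :
    tcons₂ (x ⊗ₜ[k] y) z = tcons x (tcons y z) := rfl

/-- The map `((x ⊗ (y ⊗ w)), z) ↦ x ⊗ y ⊗ w ⊗ z`. -/
noncomputable def tcons₃ {n : ℕ} : H ⊗[k] (H ⊗[k] H) →ₗ[k] (⨂[k]^n H) →ₗ[k] (⨂[k]^(n + 3) H) :=
  TensorProduct.lift ((LinearMap.llcomp k (⨂[k]^n H) (⨂[k]^(n + 2) H) (⨂[k]^(n + 3) H) ∘ₗ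
    tcons).compl₂ tcons₂)

@[simp]
theorem tcons₃_tmul {n : ℕ} (x : H) (w : H ⊗[k] H) (z : ⨂[k]^n H) :
    tcons₃ (x ⊗ₜ[k] w) z = tcons x (tcons₂ w z) := rfl

variable (k H) in
/-- `counitAt n i` applies the counit to the factor `i`:
`h₀ ⊗ ⋯ ⊗ hₙ ↦ ε(hᵢ) h₀ ⊗ ⋯ ⊗ ĥᵢ ⊗ ⋯ ⊗ hₙ`. -/
noncomputable def counitAt : (n : ℕ) → Fin (n + 1) → ((⨂[k]^(n + 1) H) →ₗ[k] (⨂[k]^n H))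
  | 0, _ => tuncons ((Coalgebra.counit (R := k) (A := H)).smulRight LinearMap.id)
  | n + 1, i => Fin.cases (motive := fun _ => _)
      (tuncons ((Coalgebra.counit (R := k) (A := H)).smulRight LinearMap.id))
      (fun j => tlift (counitAt n j)) i

@[simp]
theorem counitAt_zero (n : ℕ) (x : H) (z : ⨂[k]^n H) :
    counitAt k H n 0 (tcons x z) = Coalgebra.counit (R := k) x • z := by
  cases n <;> simp [counitAt]

@[simp]
theorem counitAt_succ (n : ℕ) (i : Fin (n + 1)) (x : H) (z : ⨂[k]^(n + 1) H) :
    counitAt k H (n + 1) i.succ (tcons x z) = tcons x (counitAt k H n i z) := by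
  simp [counitAt]

@[simp]
theorem counitAt_one (n : ℕ) (x : H) (z : ⨂[k]^(n + 1) H) :
    counitAt k H (n + 1) 1 (tcons x z) = tcons x (counitAt k H n 0 z) :=
  counitAt_succ n 0 x z

variable (k H) in
/-- `comulAt n i` applies the comultiplication to the factor `i`:
`h₀ ⊗ ⋯ ⊗ hₙ ↦ h₀ ⊗ ⋯ ⊗ Δ(hᵢ) ⊗ ⋯ ⊗ hₙ`. -/
noncomputable def comulAt : (n : ℕ) → Fin (n + 1) → ((⨂[k]^(n + 1) H) →ₗ[k] (⨂[k]^(n + 2) H))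
  | 0, _ => tuncons (tcons₂ ∘ₗ Coalgebra.comul)
  | n + 1, i => Fin.cases (motive := fun _ => _)
      (tuncons (tcons₂ ∘ₗ Coalgebra.comul)) (fun j => tlift (comulAt n j)) i

@[simp]
theorem comulAt_zero (n : ℕ) (x : H) (z : ⨂[k]^n H) :
    comulAt k H n 0 (tcons x z) = tcons₂ (Coalgebra.comul x) z := by
  cases n <;> simp [comulAt]

@[simp]
theorem comulAt_succ (n : ℕ) (i : Fin (n + 1)) (x : H) (z : ⨂[k]^(n + 1) H) :
    comulAt k H (n + 1) i.succ (tcons x z) = tcons x (comulAt k H n i z) := by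
  simp [comulAt]

@[simp]
theorem comulAt_one (n : ℕ) (x : H) (z : ⨂[k]^(n + 1) H) :
    comulAt k H (n + 1) 1 (tcons x z) = tcons x (comulAt k H n 0 z) :=
  comulAt_succ n 0 x z

theorem counitAt_counitAt (n : ℕ) (i j : Fin (n + 1)) (h : i ≤ j) :
    counitAt k H n i ∘ₗ counitAt k H (n + 1) j.succ =
      counitAt k H n j ∘ₗ counitAt k H (n + 1) i.castSucc := by
  induction n with
  | zero =>
    obtain rfl : i = 0 := by omega
    obtain rfl : j = 0 := by omega
    refine tpow_ext fun x y => ?_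
    simp
  | succ n ih =>
    refine tpow_ext fun x y => ?_
    induction i using Fin.cases with
    | zero => simp
    | succ i =>
      induction j using Fin.cases with
      | zero => simp at h
      | succ j =>
        have := ih i j (by simpa using h)
        simp only [LinearMap.comp_apply, counitAt_succ, Fin.castSucc_succ]
        exact congrArg (tcons x) (LinearMap.congr_fun this y)

theorem comulAt_zero_tcons₂ (n : ℕ) (w : H ⊗[k] H) (z : ⨂[k]^n H) :
    comulAt k H (n + 1) 0 (tcons₂ w z) =
      tcons₃ (TensorProduct.assoc k H H H (Coalgebra.comul.rTensor H w)) z := by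
  have key : ∀ (v : H ⊗[k] H) (y : H),
      tcons₂ v (tcons y z) = tcons₃ (TensorProduct.assoc k H H H (v ⊗ₜ[k] y)) z := by
    intro v y
    induction v using TensorProduct.induction_on with
    | zero => simp
    | tmul a b => simp
    | add a b ha hb => simp only [map_add, LinearMap.add_apply, TensorProduct.add_tmul, ha, hb]
  induction w using TensorProduct.induction_on with
  | zero => simp
  | tmul x y => simp [key]
  | add x y hx hy => simp only [map_add, LinearMap.add_apply, hx, hy]

theorem comulAt_one_tcons₂ (n : ℕ) (w : H ⊗[k] H) (z : ⨂[k]^n H) :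
    comulAt k H (n + 1) 1 (tcons₂ w z) = tcons₃ (Coalgebra.comul.lTensor H w) z := by
  induction w using TensorProduct.induction_on with
  | zero => simp
  | tmul x y => simp
  | add x y hx hy => simp only [map_add, LinearMap.add_apply, hx, hy]

theorem comulAt_one_zero (n : ℕ) (x : H) (z : ⨂[k]^n H) :
    comulAt k H (n + 1) 1 (tcons₂ (Coalgebra.comul x) z) =
      comulAt k H (n + 1) 0 (tcons₂ (Coalgebra.comul x) z) := by
  rw [comulAt_zero_tcons₂, comulAt_one_tcons₂, Coalgebra.coassoc_apply]

@[simp]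
theorem comulAt_succ_succ_tcons₂ (n : ℕ) (j : Fin (n + 1)) (w : H ⊗[k] H) (z : ⨂[k]^(n + 1) H) :
    comulAt k H (n + 2) j.succ.succ (tcons₂ w z) = tcons₂ w (comulAt k H n j z) := by
  induction w using TensorProduct.induction_on with
  | zero => simp
  | tmul x y => simp
  | add x y hx hy => simp only [map_add, LinearMap.add_apply, hx, hy]

@[simp]
theorem counitAt_succ_succ_tcons₂ (n : ℕ) (j : Fin (n + 1)) (w : H ⊗[k] H)
    (z : ⨂[k]^(n + 1) H) :
    counitAt k H (n + 2) j.succ.succ (tcons₂ w z) = tcons₂ w (counitAt k H n j z) := by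
  induction w using TensorProduct.induction_on with
  | zero => simp
  | tmul x y => simp
  | add x y hx hy => simp only [map_add, LinearMap.add_apply, hx, hy]

@[simp]
theorem counitAt_zero_tcons₂ (n : ℕ) (x : H) (z : ⨂[k]^n H) :
    counitAt k H (n + 1) 0 (tcons₂ (Coalgebra.comul x) z) = tcons x z := by
  have h : ∀ w : H ⊗[k] H, counitAt k H (n + 1) 0 (tcons₂ w z) =
      tcons (TensorProduct.lid k H (Coalgebra.counit.rTensor H w)) z := by
    intro w
    induction w using TensorProduct.induction_on with
    | zero => simp
    | tmul x y => simp
    | add x y hx hy => simp only [map_add, LinearMap.add_apply, hx, hy]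
  rw [h, Coalgebra.rTensor_counit_comul]
  simp

@[simp]
theorem counitAt_one_tcons₂ (n : ℕ) (x : H) (z : ⨂[k]^n H) :
    counitAt k H (n + 1) 1 (tcons₂ (Coalgebra.comul x) z) = tcons x z := by
  have h : ∀ w : H ⊗[k] H, counitAt k H (n + 1) 1 (tcons₂ w z) =
      tcons (TensorProduct.rid k H (Coalgebra.counit.lTensor H w)) z := by
    intro w
    induction w using TensorProduct.induction_on with
    | zero => simp
    | tmul x y => simp
    | add x y hx hy => simp only [map_add, LinearMap.add_apply, hx, hy]
  rw [h, Coalgebra.lTensor_counit_comul]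
  simp

theorem comulAt_comulAt (n : ℕ) (i j : Fin (n + 1)) (h : i ≤ j) :
    comulAt k H (n + 1) j.succ ∘ₗ comulAt k H n i =
      comulAt k H (n + 1) i.castSucc ∘ₗ comulAt k H n j := by
  induction n with
  | zero =>
    obtain rfl : i = 0 := by omega
    obtain rfl : j = 0 := by omega
    refine tpow_ext fun x y => ?_
    simpa using comulAt_one_zero 0 x y
  | succ n ih =>
    refine tpow_ext fun x y => ?_
    induction i using Fin.cases with
    | zero =>
      induction j using Fin.cases with
      | zero => simpa using comulAt_one_zero (n + 1) x y
      | succ j => simp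
    | succ i =>
      induction j using Fin.cases with
      | zero => simp at h
      | succ j =>
        have := ih i j (by simpa using h)
        simp only [LinearMap.comp_apply, comulAt_succ, Fin.castSucc_succ]
        exact congrArg (tcons x) (LinearMap.congr_fun this y)

theorem counitAt_castSucc_comulAt (n : ℕ) (i : Fin (n + 1)) :
    counitAt k H (n + 1) i.castSucc ∘ₗ comulAt k H n i = LinearMap.id := by
  induction n with
  | zero =>
    obtain rfl : i = 0 := by omega
    refine tpow_ext fun x y => ?_
    simp
  | succ n ih =>
    refine tpow_ext fun x y => ?_
    induction i using Fin.cases with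
    | zero => simp
    | succ i =>
      simp only [LinearMap.comp_apply, comulAt_succ, counitAt_succ, Fin.castSucc_succ]
      exact congrArg (tcons x) (LinearMap.congr_fun (ih i) y)

theorem counitAt_succ_comulAt (n : ℕ) (i : Fin (n + 1)) :
    counitAt k H (n + 1) i.succ ∘ₗ comulAt k H n i = LinearMap.id := by
  induction n with
  | zero =>
    obtain rfl : i = 0 := by omega
    refine tpow_ext fun x y => ?_
    simp
  | succ n ih =>
    refine tpow_ext fun x y => ?_
    induction i using Fin.cases with
    | zero => simp
    | succ i =>
      simp only [LinearMap.comp_apply, comulAt_succ, counitAt_succ]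
      exact congrArg (tcons x) (LinearMap.congr_fun (ih i) y)

theorem counitAt_comulAt_of_le (n : ℕ) (i : Fin (n + 2)) (j : Fin (n + 1)) (h : i ≤ j.castSucc) :
    counitAt k H (n + 2) i.castSucc ∘ₗ comulAt k H (n + 1) j.succ =
      comulAt k H n j ∘ₗ counitAt k H (n + 1) i := by
  induction n with
  | zero =>
    obtain rfl : i = 0 := by
      obtain rfl : j = 0 := by omega
      simpa using h
    refine tpow_ext fun x y => ?_
    simp
  | succ n ih =>
    refine tpow_ext fun x y => ?_
    induction i using Fin.cases with
    | zero => simp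
    | succ i =>
      induction j using Fin.cases with
      | zero => simp at h
      | succ j =>
        have := ih i j (by simpa [← Fin.succ_castSucc] using h)
        simp only [LinearMap.comp_apply, comulAt_succ, counitAt_succ, Fin.castSucc_succ]
        exact congrArg (tcons x) (LinearMap.congr_fun this y)

theorem counitAt_comulAt_of_gt (n : ℕ) (i : Fin (n + 2)) (j : Fin (n + 1)) (h : j.castSucc < i) :
    counitAt k H (n + 2) i.succ ∘ₗ comulAt k H (n + 1) j.castSucc =
      comulAt k H n j ∘ₗ counitAt k H (n + 1) i := by
  induction n with
  | zero =>
    obtain rfl : j = 0 := by omega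
    induction i using Fin.cases with
    | zero => simp at h
    | succ i =>
      refine tpow_ext fun x y => ?_
      simp
  | succ n ih =>
    refine tpow_ext fun x y => ?_
    induction i using Fin.cases with
    | zero => simp at h
    | succ i =>
      induction j using Fin.cases with
      | zero => simp
      | succ j =>
        have := ih i j (by simpa [← Fin.succ_castSucc] using h)
        simp only [LinearMap.comp_apply, comulAt_succ, counitAt_succ, Fin.castSucc_succ]
        exact congrArg (tcons x) (LinearMap.congr_fun this y)

variable (k H) in
/-- The iterated comultiplication `H → H^{⊗n}`, `h ↦ ∑ h₍₁₎ ⊗ ⋯ ⊗ h₍ₙ₎`. -/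
noncomputable def iterComul : (n : ℕ) → (H →ₗ[k] (⨂[k]^n H))
  | 0 => (Coalgebra.counit (R := k) (A := H)).smulRight (1 : ⨂[k]^0 H)
  | n + 1 => TensorProduct.lift (tcons.compl₂ (iterComul n)) ∘ₗ Coalgebra.comul

variable (k H) in
/-- The diagonal right action of `H` on `H^{⊗n}`:
`(h₁ ⊗ ⋯ ⊗ hₙ)·h = ∑ h₁h₍₁₎ ⊗ ⋯ ⊗ hₙh₍ₙ₎`, that is, `iterComul h` acts by the factorwise
multiplication of `H^{⊗n}`. -/
noncomputable def diagonalAct (n : ℕ) : H →ₗ[k] Module.End k (⨂[k]^n H) :=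
  (LinearMap.mul k (⨂[k]^n H)).flip ∘ₗ iterComul k H n

theorem diagonalAct_apply (n : ℕ) (h : H) (x : ⨂[k]^n H) :
    diagonalAct k H n h x = x * iterComul k H n h := rfl

theorem tcons_mul_tcons {n : ℕ} (x x' : H) (z z' : ⨂[k]^n H) :
    tcons x z * tcons x' z' = tcons (x * x') (z * z') := by
  have h : ∀ a b : Fin n → H, tcons x (PiTensorProduct.tprod k a) *
      tcons x' (PiTensorProduct.tprod k b) =
      tcons (x * x') (PiTensorProduct.tprod k a * PiTensorProduct.tprod k b) := by
    intro a b
    simp only [tcons_tprod, PiTensorProduct.tprod_mul_tprod]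
    congr 1
    ext i
    induction i using Fin.cases with
    | zero => simp
    | succ i => simp
  induction z using PiTensorProduct.induction_on with
  | smul_tprod r a =>
    induction z' using PiTensorProduct.induction_on with
    | smul_tprod r' b => simp only [map_smul, smul_mul_assoc, mul_smul_comm, h]
    | add y y' hy hy' => simp only [map_add, mul_add, hy, hy']
  | add y y' hy hy' => simp only [map_add, add_mul, hy, hy']

theorem tcons₂_mul_tcons₂ {n : ℕ} (w w' : H ⊗[k] H) (z z' : ⨂[k]^n H) :
    tcons₂ w z * tcons₂ w' z' = tcons₂ (w * w') (z * z') := by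
  induction w using TensorProduct.induction_on with
  | zero => simp
  | tmul x y =>
    induction w' using TensorProduct.induction_on with
    | zero => simp
    | tmul x' y' => simp [tcons_mul_tcons]
    | add a b ha hb => simp only [map_add, LinearMap.add_apply, mul_add, ha, hb]
  | add a b ha hb => simp only [map_add, LinearMap.add_apply, add_mul, ha, hb]

theorem tpow_induction {n : ℕ} {p : (⨂[k]^(n + 1) H) → Prop} (z : ⨂[k]^(n + 1) H)
    (h1 : ∀ x y, p (tcons x y)) (h2 : ∀ z w, p z → p w → p (z + w)) : p z := by
  induction z using PiTensorProduct.induction_on with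
  | smul_tprod r a =>
    rw [tprod_eq_tcons, ← map_smul]
    exact h1 _ _
  | add y y' hy hy' => exact h2 _ _ hy hy'

theorem counitAt_mul (n : ℕ) (i : Fin (n + 1)) (z w : ⨂[k]^(n + 1) H) :
    counitAt k H n i (z * w) = counitAt k H n i z * counitAt k H n i w := by
  have h0 : ∀ (n : ℕ) (z w : ⨂[k]^(n + 1) H),
      counitAt k H n 0 (z * w) = counitAt k H n 0 z * counitAt k H n 0 w := by
    intro n z w
    induction z using tpow_induction with
    | h1 x z =>
      induction w using tpow_induction with
      | h1 y w =>
        simp only [tcons_mul_tcons, counitAt_zero, Bialgebra.counit_mul, smul_mul_smul_comm]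
      | h2 a b ha hb => simp only [mul_add, map_add, ha, hb]
    | h2 a b ha hb => simp only [add_mul, map_add, ha, hb]
  induction n with
  | zero =>
    obtain rfl : i = 0 := by omega
    exact h0 _ _ _
  | succ n ih =>
    induction i using Fin.cases with
    | zero => exact h0 _ _ _
    | succ i =>
      induction z using tpow_induction with
      | h1 x z =>
        induction w using tpow_induction with
        | h1 y w => simp [tcons_mul_tcons, ih]
        | h2 a b ha hb => simp only [mul_add, map_add, ha, hb]
      | h2 a b ha hb => simp only [add_mul, map_add, ha, hb]

theorem comulAt_mul (n : ℕ) (i : Fin (n + 1)) (z w : ⨂[k]^(n + 1) H) :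
    comulAt k H n i (z * w) = comulAt k H n i z * comulAt k H n i w := by
  have h0 : ∀ (n : ℕ) (z w : ⨂[k]^(n + 1) H),
      comulAt k H n 0 (z * w) = comulAt k H n 0 z * comulAt k H n 0 w := by
    intro n z w
    induction z using tpow_induction with
    | h1 x z =>
      induction w using tpow_induction with
      | h1 y w => simp [tcons_mul_tcons, tcons₂_mul_tcons₂]
      | h2 a b ha hb => simp only [mul_add, map_add, ha, hb]
    | h2 a b ha hb => simp only [add_mul, map_add, ha, hb]
  induction n with
  | zero =>
    obtain rfl : i = 0 := by omega
    exact h0 _ _ _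
  | succ n ih =>
    induction i using Fin.cases with
    | zero => exact h0 _ _ _
    | succ i =>
      induction z using tpow_induction with
      | h1 x z =>
        induction w using tpow_induction with
        | h1 y w => simp [tcons_mul_tcons, ih]
        | h2 a b ha hb => simp only [mul_add, map_add, ha, hb]
      | h2 a b ha hb => simp only [add_mul, map_add, ha, hb]

theorem iterComul_succ (n : ℕ) (h : H) : iterComul k H (n + 1) h =
    TensorProduct.lift (tcons.compl₂ (iterComul k H n)) (Coalgebra.comul h) := rfl

theorem counitAt_iterComul (n : ℕ) (i : Fin (n + 1)) (h : H) :
    counitAt k H n i (iterComul k H (n + 1) h) = iterComul k H n h := by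
  have h0 : ∀ (n : ℕ) (h : H),
      counitAt k H n 0 (iterComul k H (n + 1) h) = iterComul k H n h := by
    intro n h
    have key : ∀ w : H ⊗[k] H, counitAt k H n 0
        (TensorProduct.lift (tcons.compl₂ (iterComul k H n)) w) =
        iterComul k H n (TensorProduct.lid k H (Coalgebra.counit.rTensor H w)) := by
      intro w
      induction w using TensorProduct.induction_on with
      | zero => simp
      | tmul x y => simp
      | add a b ha hb => simp only [map_add, ha, hb]
    rw [iterComul_succ, key, Coalgebra.rTensor_counit_comul]
    simp
  induction n generalizing h with
  | zero =>
    obtain rfl : i = 0 := by omega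
    exact h0 _ _
  | succ n ih =>
    induction i using Fin.cases with
    | zero => exact h0 _ _
    | succ i =>
      rw [iterComul_succ, iterComul_succ n]
      generalize (Coalgebra.comul h : H ⊗[k] H) = w
      induction w using TensorProduct.induction_on with
      | zero => simp
      | tmul x y => simp [ih]
      | add a b ha hb => simp only [map_add, ha, hb]

theorem comulAt_iterComul (n : ℕ) (i : Fin (n + 1)) (h : H) :
    comulAt k H n i (iterComul k H (n + 1) h) = iterComul k H (n + 2) h := by
  have h0 : ∀ (n : ℕ) (h : H),
      comulAt k H n 0 (iterComul k H (n + 1) h) = iterComul k H (n + 2) h := by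
    intro n h
    set F : H ⊗[k] (H ⊗[k] H) →ₗ[k] (⨂[k]^(n + 2) H) :=
      TensorProduct.lift (tcons.compl₂ (TensorProduct.lift (tcons.compl₂ (iterComul k H n))))
      with hF
    have key1 : ∀ (v : H ⊗[k] H) (y : H), tcons₂ v (iterComul k H n y) =
        F (TensorProduct.assoc k H H H (v ⊗ₜ[k] y)) := by
      intro v y
      induction v using TensorProduct.induction_on with
      | zero => simp
      | tmul a b => simp [hF]
      | add a b ha hb => simp only [map_add, LinearMap.add_apply, TensorProduct.add_tmul, ha, hb]
    have key2 : ∀ w : H ⊗[k] H, comulAt k H n 0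
        (TensorProduct.lift (tcons.compl₂ (iterComul k H n)) w) =
        F (TensorProduct.assoc k H H H (Coalgebra.comul.rTensor H w)) := by
      intro w
      induction w using TensorProduct.induction_on with
      | zero => simp
      | tmul x y => simp [key1]
      | add a b ha hb => simp only [map_add, ha, hb]
    have key3 : ∀ w : H ⊗[k] H,
        TensorProduct.lift (tcons.compl₂ (iterComul k H (n + 1))) w =
        F (Coalgebra.comul.lTensor H w) := by
      intro w
      induction w using TensorProduct.induction_on with
      | zero => simp
      | tmul x y => simp [hF, iterComul_succ]
      | add a b ha hb => simp only [map_add, ha, hb]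
    rw [iterComul_succ, key2, iterComul_succ, key3, Coalgebra.coassoc_apply]
  induction n generalizing h with
  | zero =>
    obtain rfl : i = 0 := by omega
    exact h0 _ _
  | succ n ih =>
    induction i using Fin.cases with
    | zero => exact h0 _ _
    | succ i =>
      rw [iterComul_succ, iterComul_succ (n + 2)]
      generalize (Coalgebra.comul h : H ⊗[k] H) = w
      induction w using TensorProduct.induction_on with
      | zero => simp
      | tmul x y => simp [ih]
      | add a b ha hb => simp only [map_add, ha, hb]

variable {M : Type u} [AddCommGroup M] [Module k M] (l : H →ₗ[k] Module.End k M)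

/-- The space `Z_n(H, M) = H^{⊗(n+1)} ⊗_H M`, where `l` is the left action of `H` on `M`. -/
abbrev HopfTensor (n : ℕ) : Type u := BalancedTensor (diagonalAct k H (n + 1)) l

theorem balancedRel_le_rTensor {n m : ℕ} (f : (⨂[k]^n H) →ₗ[k] (⨂[k]^m H))
    (hmul : ∀ z w, f (z * w) = f z * f w)
    (hf : ∀ h, f (iterComul k H n h) = iterComul k H m h) :
    balancedRel (diagonalAct k H n) l ≤ (balancedRel (diagonalAct k H m) l).comap
      (f.rTensor M) :=
  balancedRel_le _ _ _ _ fun c x y => Submodule.subset_span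
    ⟨c, f x, y, by simp [diagonalAct_apply, hmul, hf]⟩

theorem rTensor_comp_eq {V₁ V₂ V₂' V₃ : Type u} [AddCommGroup V₁] [AddCommGroup V₂]
    [AddCommGroup V₂'] [AddCommGroup V₃] [Module k V₁] [Module k V₂] [Module k V₂'] [Module k V₃]
    {f : V₁ →ₗ[k] V₂} {g : V₂ →ₗ[k] V₃} {f' : V₁ →ₗ[k] V₂'} {g' : V₂' →ₗ[k] V₃}
    (h : g ∘ₗ f = g' ∘ₗ f') : g.rTensor M ∘ₗ f.rTensor M = g'.rTensor M ∘ₗ f'.rTensor M := by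
  rw [← LinearMap.rTensor_comp, ← LinearMap.rTensor_comp, h]

theorem rTensor_comp_eq_id {V₁ V₂ : Type u} [AddCommGroup V₁] [AddCommGroup V₂]
    [Module k V₁] [Module k V₂] {f : V₁ →ₗ[k] V₂} {g : V₂ →ₗ[k] V₁}
    (h : g ∘ₗ f = LinearMap.id) : g.rTensor M ∘ₗ f.rTensor M = LinearMap.id := by
  rw [← LinearMap.rTensor_comp, h, LinearMap.rTensor_id]

/-- The simplicial module `Z_*(H, M) = H^{⊗(*+1)} ⊗_H M`, with faces
`(h₀, …, hₙ) ⊗ m ↦ ε(hᵢ)(h₀, …, ĥᵢ, …, hₙ) ⊗ m` and degeneracies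
`(h₀, …, hₙ) ⊗ m ↦ (h₀, …, Δ(hᵢ), …, hₙ) ⊗ m`. -/
noncomputable def hopfSimplicialModule : SimplicialModule k where
  obj n := HopfTensor l n
  d n i := (balancedRel _ l).mapQ (balancedRel _ l) ((counitAt k H (n + 1) i).rTensor M)
    (balancedRel_le_rTensor l _ (counitAt_mul _ i) (counitAt_iterComul _ i))
  s n i := (balancedRel _ l).mapQ (balancedRel _ l) ((comulAt k H n i).rTensor M)
    (balancedRel_le_rTensor l _ (comulAt_mul _ i) (comulAt_iterComul _ i))
  d_d n i j h := mapQ_comp_eq _ _ _ _ (rTensor_comp_eq (counitAt_counitAt (n + 1) i j h))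
  s_s n i j h := mapQ_comp_eq _ _ _ _ (rTensor_comp_eq (comulAt_comulAt n i j h))
  d_s_of_le n i j h := mapQ_comp_eq _ _ _ _ (rTensor_comp_eq (counitAt_comulAt_of_le n i j h))
  d_s_castSucc n i := mapQ_comp_eq_id _ _ (rTensor_comp_eq_id (counitAt_castSucc_comulAt n i))
  d_s_succ n i := mapQ_comp_eq_id _ _ (rTensor_comp_eq_id (counitAt_succ_comulAt n i))
  d_s_of_gt n i j h := mapQ_comp_eq _ _ _ _ (rTensor_comp_eq (counitAt_comulAt_of_gt n i j h))

/-- The element `(h₀, …, hₙ) ⊗_H m` of `Z_n(H, M)`. -/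
noncomputable def hopfTensorMk {n : ℕ} (h : Fin (n + 1) → H) (m : M) :
    (hopfSimplicialModule l).obj n :=
  (Submodule.Quotient.mk (PiTensorProduct.tprod k h ⊗ₜ[k] m) : HopfTensor l n)

end HopfSimplicial

end HopfCyclic

namespace HopfCyclic

/-! ### Isomorphisms of cyclic modules: induced maps on cyclic homology, and transport of the cyclic
axioms. -/

section Transport

variable {k : Type u} [Field k]

/-! The comparison map sends a₀ ⊗ ⋯ ⊗ aₙ to ∑ (a₁₍₁₎⋯aₙ₍₁₎, a₂₍₂₎⋯aₙ₍₂₎, …, aₙ₍ₙ₎, 1) ⊗_H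
[a₀a₁₍₀₎⋯aₙ₍₀₎]. It is built by iterating one algebra map, `spread`, which sends a ⊗ v to ∑ a₍₀₎ ⊗
(a₍₁₎, v): each factor multiplies what comes after it, and the product is then coacted on.
Compatibility with faces and degeneracies thereby reduces to the counit and coassociativity axioms
of the comodule A.

The interaction of product, action and coaction rests on one identity, ∑ y₍₁₎·[m y₍₀₎] = [y m]
(`act_coact`), which says that β⁻¹(ρ(y)) = 1 ⊗_B y. In H^{⊗(n+1)} ⊗_H A_B it becomes
`toHopf_mul_coactDiag`: multiplying on the right by the diagonal coaction of c is the same as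
multiplying the A-part by c on the left. Since A ⊗ H is spanned by the elements xρ(y)
(`ext_canonical`), a linear identity in a ⊗ h has only to be checked there. This gives the module
axioms on A_B and the well-definedness of the cyclic operator (`cyclicOpAux_balanced`) without any
formula for κ(hh') or for the coaction on h·m.

The cyclic operator and the rotation correspond under the comparison map already before passing to
the quotient by the relations over B (`toHopfAux_rotate`). Hence only one of those relations has to
be verified, and the last face, being the face 0 after the cyclic operator on both sides, needs no
separate computation with products.

Bijectivity goes by induction on n. Degree 0 is A_B ≅ H ⊗_H A_B. For the step there are maps
Z_n(A/B) ⊗ H → Z_{n+1}(A/B), inserting κ(h) after the factor 0, and Z_n(H, A_B) ⊗ H → Z_{n+1}(H,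
A_B), which intertwine the comparison maps (`relToHopf_comp_relStep`). The second is bijective, with
an inverse written through the antipode (`hopfStep_bijective`); the first is surjective because a
⊗_B b = ∑ ab₍₀₎κ(b₍₁₎). If degree n is bijective, the commutative square forces the first map to be
injective as well, and then degree n + 1 is bijective.

The axioms of a cyclic operator on Z_*(H, A_B) are finally transported from Z_*(A/B) along the
surjective comparison map. -/

theorem CyclicModule.Hom.IsIso.isIso_tsyganMap {X Y : CyclicModule k} {φ : X.Hom Y}
    (h : φ.IsIso) : CategoryTheory.IsIso φ.tsyganMap := by
  have h2 : ∀ p q, CategoryTheory.IsIso ((φ.tsyganMap.f p).f q) := fun p q =>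
    (ConcreteCategory.isIso_iff_bijective (ModuleCat.ofHom (φ.f q))).2 (h q)
  have h1 : ∀ p, CategoryTheory.IsIso (φ.tsyganMap.f p) := fun p =>
    HomologicalComplex.Hom.isIso_of_components _
  exact HomologicalComplex.Hom.isIso_of_components _

theorem CyclicModule.Hom.IsIso.isIso_HCMap {X Y : CyclicModule k} {φ : X.Hom Y}
    (h : φ.IsIso) (n : ℕ) : CategoryTheory.IsIso (φ.HCMap n) := by
  have := h.isIso_tsyganMap
  have : CategoryTheory.IsIso
      (HomologicalComplex₂.total.map φ.tsyganMap (ComplexShape.down ℕ)) :=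
    (HomologicalComplex₂.total.mapIso (asIso φ.tsyganMap) (ComplexShape.down ℕ)).isIso_hom
  exact (HomologicalComplex.homologyFunctor _ _ n).map_isIso _

/-- A cyclic operator is transported along degreewise surjective maps that commute with it, the
faces and the degeneracies. -/
theorem IsCyclicOperator.of_surjective (X : CyclicModule k) (Y : SimplicialModule k)
    (τ : ∀ n, Y.obj n →ₗ[k] Y.obj n) (f : ∀ n, X.obj n →ₗ[k] Y.obj n)
    (hf : ∀ n, Function.Surjective (f n))
    (hd : ∀ n i, f n ∘ₗ X.d n i = Y.d n i ∘ₗ f (n + 1))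
    (hs : ∀ n i, f (n + 1) ∘ₗ X.s n i = Y.s n i ∘ₗ f n)
    (ht : ∀ n, f n ∘ₗ X.t n = τ n ∘ₗ f n) : IsCyclicOperator Y τ := by
  have hd' := fun n i x => (LinearMap.congr_fun (hd n i) x).symm
  have hs' := fun n i x => (LinearMap.congr_fun (hs n i) x).symm
  have ht' := fun n x => (LinearMap.congr_fun (ht n) x).symm
  simp only [LinearMap.comp_apply] at hd' hs' ht'
  have hX := X.isCyclicOperator
  -- As `f` is surjective, each identity on `Y` may be tested on an element `f n x`; the
  -- intertwining relations then pull it back to the same identity on `X`.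
  refine ⟨fun n => ?_, fun n i => ?_, fun n => ?_, fun n i => ?_, fun n => ?_⟩ <;>
    refine LinearMap.ext ((hf _).forall.2 fun x => ?_)
  · have h : ∀ m : ℕ, ((τ n : Module.End k (Y.obj n)) ^ m) (f n x) =
        f n (((X.t n : Module.End k (X.obj n)) ^ m) x) := by
      intro m
      induction m with
      | zero => rfl
      | succ m ih =>
        rw [pow_succ', pow_succ', Module.End.mul_apply, Module.End.mul_apply, ih, ht']
    rw [h, hX.pow_eq_id]
    rfl
  · have := LinearMap.congr_fun (hX.d_succ_t n i) x
    simp only [LinearMap.comp_apply] at this ⊢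
    rw [ht', hd', hd', ht', this]
  · have := LinearMap.congr_fun (hX.d_zero_t n) x
    simp only [LinearMap.comp_apply] at this ⊢
    rw [ht', hd', hd', this]
  · have := LinearMap.congr_fun (hX.s_succ_t n i) x
    simp only [LinearMap.comp_apply] at this ⊢
    rw [ht', hs', hs', ht', this]
  · have := LinearMap.congr_fun (hX.s_zero_t n) x
    simp only [LinearMap.comp_apply] at this ⊢
    rw [ht', hs', hs', ht', ht', this]

end Transport

/-! ### Tensor powers of H: first and last factors, rotation, iterated comultiplication. -/

section HeadInclusion

variable {k : Type u} [Field k] {H : Type u} [Ring H] [HopfAlgebra k H]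

theorem one_eq_tcons (n : ℕ) : (1 : ⨂[k]^(n + 1) H) = tcons 1 1 := by
  rw [PiTensorProduct.one_def, PiTensorProduct.one_def, tcons_tprod]
  congr 1
  ext i
  induction i using Fin.cases <;> rfl

variable (k H) in
/-- The inclusion `x ↦ x ⊗ 1 ⊗ ⋯ ⊗ 1` of the first tensor factor. -/
noncomputable def headIncl (n : ℕ) : H →ₐ[k] (⨂[k]^(n + 1) H) :=
  AlgHom.ofLinearMap (tcons.flip 1) (one_eq_tcons n).symm fun x y => by
    simp [tcons_mul_tcons]

theorem headIncl_apply (n : ℕ) (x : H) : headIncl k H n x = tcons x 1 := rfl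

variable (k H) in
/-- The inclusion `v ↦ 1 ⊗ v` of the last `n` tensor factors. -/
noncomputable def tailIncl (n : ℕ) : (⨂[k]^n H) →ₐ[k] (⨂[k]^(n + 1) H) :=
  AlgHom.ofLinearMap (tcons 1) (one_eq_tcons n).symm fun x y => by
    simp [tcons_mul_tcons]

theorem tailIncl_apply (n : ℕ) (v : ⨂[k]^n H) : tailIncl k H n v = tcons 1 v := rfl

theorem headIncl_mul_tcons {n : ℕ} (x y : H) (v : ⨂[k]^n H) :
    headIncl k H n x * tcons y v = tcons (x * y) v := by
  simp [headIncl_apply, tcons_mul_tcons]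

theorem tcons_mul_headIncl {n : ℕ} (x y : H) (v : ⨂[k]^n H) :
    tcons y v * headIncl k H n x = tcons (y * x) v := by
  simp [headIncl_apply, tcons_mul_tcons]

/-- Multiplication in the tensor power is factorwise, so permuting the factors respects it. -/
theorem rotate_mul (n : ℕ) (v w : ⨂[k]^(n + 1) H) :
    rotate k H n (v * w) = rotate k H n v * rotate k H n w := by
  induction v using PiTensorProduct.induction_on with
  | smul_tprod r a =>
    induction w using PiTensorProduct.induction_on with
    | smul_tprod r' b =>
      simp only [map_smul, smul_mul_assoc, mul_smul_comm, PiTensorProduct.tprod_mul_tprod,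
        rotate_tprod]
      rfl
    | add y y' hy hy' => simp only [map_add, mul_add, hy, hy']
  | add y y' hy hy' => simp only [map_add, add_mul, hy, hy']

theorem tsnoc_eq_tcons {A : Type u} [Ring A] [Algebra k A] (x : A) (v : ⨂[k]^0 A) :
    tsnoc x v = tcons (k := k) x v := by
  suffices h : (tsnoc x : (⨂[k]^0 A) →ₗ[k] _) = tcons x from LinearMap.congr_fun h v
  apply PiTensorProduct.ext
  ext a
  simp only [LinearMap.compMultilinearMap_apply]
  rw [tsnoc_tprod, tcons_tprod]
  congr 1
  ext i
  obtain rfl : i = 0 := by omega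
  rfl

theorem iterComul_one (h : H) : iterComul k H 1 h = headIncl k H 0 h := by
  rw [iterComul_succ, headIncl_apply]
  have h1 : ∀ w : H ⊗[k] H, TensorProduct.lift (tcons.compl₂ (iterComul k H 0)) w =
      tcons (TensorProduct.rid k H (Coalgebra.counit.lTensor H w)) 1 := by
    intro w
    induction w using TensorProduct.induction_on with
    | zero => simp
    | tmul x y => simp [iterComul]
    | add a b ha hb => simp only [map_add, ha, hb, LinearMap.add_apply]
  rw [h1, Coalgebra.lTensor_counit_comul]
  simp

/-- The map `tsnoc` as a bilinear map. -/
noncomputable def tsnocL (n : ℕ) : (⨂[k]^n H) →ₗ[k] H →ₗ[k] (⨂[k]^(n + 1) H) :=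
  (tcons.compr₂ (rotate k H n).symm.toLinearMap).flip

@[simp]
theorem tsnocL_apply (n : ℕ) (v : ⨂[k]^n H) (x : H) : tsnocL n v x = tsnoc x v := rfl

/-- The iterated comultiplication, split at the last factor. -/
theorem iterComul_succ_snoc (n : ℕ) (h : H) : iterComul k H (n + 1) h =
    TensorProduct.lift (tsnocL n ∘ₗ iterComul k H n) (Coalgebra.comul h) := by
  induction n generalizing h with
  | zero =>
    rw [iterComul_one, headIncl_apply]
    have h1 : ∀ w : H ⊗[k] H, TensorProduct.lift (tsnocL 0 ∘ₗ iterComul k H 0) w =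
        tcons (TensorProduct.lid k H (Coalgebra.counit.rTensor H w)) 1 := by
      intro w
      induction w using TensorProduct.induction_on with
      | zero => simp
      | tmul x y => simp [iterComul, tsnoc_eq_tcons]
      | add a b ha hb => simp only [map_add, ha, hb, LinearMap.add_apply]
    rw [h1, Coalgebra.rTensor_counit_comul]
    simp
  | succ n ih =>
    -- The definition of `iterComul` splits off the first factor and the induction hypothesis, in
    -- the form of `f`, splits off the last one from the rest; coassociativity exchanges the order
    -- of the two splittings.
    set f := TensorProduct.lift (tsnocL n ∘ₗ iterComul k H n) with hf
    have h1 : ∀ w : H ⊗[k] H, TensorProduct.lift (tcons.compl₂ (iterComul k H (n + 1))) w =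
        TensorProduct.lift tcons (f.lTensor H (Coalgebra.comul.lTensor H w)) := by
      intro w
      induction w using TensorProduct.induction_on with
      | zero => simp
      | tmul x y => simp [ih]
      | add a b ha hb => simp only [map_add, ha, hb]
    have h2 : ∀ (u : H ⊗[k] H) (y : H),
        TensorProduct.lift tcons (f.lTensor H (TensorProduct.assoc k H H H (u ⊗ₜ y))) =
        tsnoc y (TensorProduct.lift (tcons.compl₂ (iterComul k H n)) u) := by
      intro u y
      induction u using TensorProduct.induction_on with
      | zero => simp
      | tmul a b => simp [hf]
      | add a b ha hb => simp only [map_add, TensorProduct.add_tmul, ha, hb]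
    have h3 : ∀ w : H ⊗[k] H, TensorProduct.lift tcons
        (f.lTensor H (TensorProduct.assoc k H H H (Coalgebra.comul.rTensor H w))) =
        TensorProduct.lift (tsnocL (n + 1) ∘ₗ iterComul k H (n + 1)) w := by
      intro w
      induction w using TensorProduct.induction_on with
      | zero => simp
      | tmul x y => simp [h2, iterComul_succ]
      | add a b ha hb => simp only [map_add, ha, hb]
    rw [iterComul_succ, h1, ← Coalgebra.coassoc_apply, h3]

/-- Rotation brings the last factor to the front, so splitting the iterated comultiplication at its
last factor gives ∑ (h₍₂₎, Δ(h₍₁₎)), with Δ the iterated comultiplication into n factors. -/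
theorem rotate_iterComul (n : ℕ) (h : H) : rotate k H n (iterComul k H (n + 1) h) =
    TensorProduct.lift (tcons.flip ∘ₗ iterComul k H n) (Coalgebra.comul h) := by
  rw [iterComul_succ_snoc]
  generalize (Coalgebra.comul h : H ⊗[k] H) = w
  induction w using TensorProduct.induction_on with
  | zero => simp
  | tmul x y => simp
  | add a b ha hb => simp only [map_add, ha, hb]

/-- `∑ rotate(Δⁿ(h₍₂₎)) · (g h₍₁₎ ⊗ 1) = ∑ (h₍₂₎ g ⊗ 1) · Δⁿ(h₍₁₎)`. -/
theorem rotate_iterComul_mul_headIncl (n : ℕ) (g h : H) :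
    TensorProduct.lift ((LinearMap.mul k (⨂[k]^(n + 1) H)).flip.compl₁₂
      ((headIncl k H n).toLinearMap ∘ₗ LinearMap.mulLeft k g)
      ((rotate k H n).toLinearMap ∘ₗ iterComul k H (n + 1))) (Coalgebra.comul h) =
    TensorProduct.lift ((LinearMap.mul k (⨂[k]^(n + 1) H)).flip.compl₁₂
      (iterComul k H (n + 1))
      ((headIncl k H n).toLinearMap ∘ₗ LinearMap.mulRight k g)) (Coalgebra.comul h) := by
  -- `F` maps x ⊗ a ⊗ b to (b g x, Δ(a)), with Δ(a) in the last n factors. Both sides are ∑ (h₍₃₎ g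
  -- h₍₁₎, Δ(h₍₂₎)), reached through the two bracketings of the threefold comultiplication.
  set F : H ⊗[k] (H ⊗[k] H) →ₗ[k] (⨂[k]^(n + 1) H) :=
    TensorProduct.lift (tcons.compl₂ (iterComul k H n)) ∘ₗ
      (TensorProduct.comm k H H).toLinearMap ∘ₗ
      TensorProduct.lift (LinearMap.lTensorHom H ∘ₗ (LinearMap.mul k H).flip ∘ₗ
        LinearMap.mulLeft k g) with hF
  have h1 : ∀ (x : H) (u : H ⊗[k] H),
      TensorProduct.lift (tcons.flip ∘ₗ iterComul k H n) u * headIncl k H n (g * x) =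
        F (x ⊗ₜ u) := by
    intro x u
    induction u using TensorProduct.induction_on with
    | zero => simp
    | tmul a b => simp [hF, tcons_mul_headIncl, -map_mul]
    | add a b ha hb => simp only [map_add, TensorProduct.tmul_add, add_mul, ha, hb]
  have h2 : ∀ (u : H ⊗[k] H) (y : H),
      headIncl k H n (y * g) * TensorProduct.lift (tcons.compl₂ (iterComul k H n)) u =
        F (TensorProduct.assoc k H H H (u ⊗ₜ y)) := by
    intro u y
    induction u using TensorProduct.induction_on with
    | zero => simp
    | tmul a b => simp [hF, headIncl_mul_tcons, mul_assoc]
    | add a b ha hb => simp only [map_add, TensorProduct.add_tmul, mul_add, ha, hb]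
  have h3 : ∀ w : H ⊗[k] H, TensorProduct.lift ((LinearMap.mul k (⨂[k]^(n + 1) H)).flip.compl₁₂
      ((headIncl k H n).toLinearMap ∘ₗ LinearMap.mulLeft k g)
      ((rotate k H n).toLinearMap ∘ₗ iterComul k H (n + 1))) w =
      F (Coalgebra.comul.lTensor H w) := by
    intro w
    induction w using TensorProduct.induction_on with
    | zero => simp
    | tmul x y => simp [← h1, rotate_iterComul]
    | add a b ha hb => simp only [map_add, ha, hb]
  have h4 : ∀ w : H ⊗[k] H, TensorProduct.lift ((LinearMap.mul k (⨂[k]^(n + 1) H)).flip.compl₁₂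
      (iterComul k H (n + 1))
      ((headIncl k H n).toLinearMap ∘ₗ LinearMap.mulRight k g)) w =
      F (TensorProduct.assoc k H H H (Coalgebra.comul.rTensor H w)) := by
    intro w
    induction w using TensorProduct.induction_on with
    | zero => simp
    | tmul x y => simp [← h2, iterComul_succ]
    | add a b ha hb => simp only [map_add, ha, hb]
  rw [h3, h4, Coalgebra.coassoc_apply]

end HeadInclusion
end HopfCyclic

/-! ### The canonical map and the H-module structure of A_B. -/

namespace HopfCyclic

variable {k : Type u} [Field k] {H : Type u} [Ring H] [HopfAlgebra k H] {A : Type u} [Ring A]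
  [Algebra k A]

theorem lTensor_tmul_one_mul {V W : Type u} [Ring V] [Algebra k V] [Ring W] [Algebra k W]
    (f : V →ₗ[k] W) (a : A) (X : A ⊗[k] V) :
    f.lTensor A ((a ⊗ₜ 1) * X) = (a ⊗ₜ 1) * f.lTensor A X := by
  induction X using TensorProduct.induction_on with
  | zero => simp
  | tmul x y => simp
  | add a b ha hb => simp only [map_add, mul_add, ha, hb]

namespace HopfGaloisExtension

variable {B : Subalgebra k A} (E : HopfGaloisExtension H B)

/-- As the canonical map is surjective, `A ⊗ H` is spanned by the elements `x ρ(y)`. -/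
theorem ext_canonical {P : Type u} [AddCommGroup P] [Module k P] {f g : A ⊗[k] H →ₗ[k] P}
    (h : ∀ x y, f ((x ⊗ₜ 1) * E.coact y) = g ((x ⊗ₜ 1) * E.coact y)) : f = g := by
  refine LinearMap.ext (E.canonicalEquiv.surjective.forall.2 fun z => ?_)
  induction z using tensorOver_induction with
  | h0 => simp
  | h1 x y => exact h x y
  | h2 z w hz hw => simp only [map_add, hz, hw]

theorem canonicalEquiv_lmulT (a : A) (z : TensorOver B) :
    E.canonicalEquiv (lmulT B a z) = (a ⊗ₜ 1) * E.canonicalEquiv z := by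
  induction z using tensorOver_induction with
  | h0 => simp
  | h1 x y =>
    change (a * x) ⊗ₜ[k] (1 : H) * E.coact y = (a ⊗ₜ 1) * ((x ⊗ₜ 1) * E.coact y)
    rw [← mul_assoc, Algebra.TensorProduct.tmul_mul_tmul, one_mul]
  | h2 z w hz hw => simp only [map_add, mul_add, hz, hw]

/-- The canonical map is left A-linear, so its inverse is determined by the translation map. -/
theorem canonicalEquiv_symm_tmul (a : A) (h : H) :
    E.canonicalEquiv.symm (a ⊗ₜ h) = lmulT B a (E.translation h) := by
  rw [LinearEquiv.symm_apply_eq, canonicalEquiv_lmulT]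
  simp [translation]

theorem sandwich_lmulT (a m : A) (z : TensorOver B) :
    sandwich B (lmulT B a z) m = sandwich B z (m * a) := by
  induction z using tensorOver_induction with
  | h0 => simp
  | h1 x y =>
    change sandwich B (Submodule.Quotient.mk ((a * x) ⊗ₜ y)) m = _
    simp [mul_assoc]
  | h2 z w hz hw => simp only [map_add, LinearMap.add_apply, hz, hw]

/-- `∑ y₍₁₎ · [m y₍₀₎] = [y m]`. -/
theorem act_coact (m y : A) :
    TensorProduct.lift (E.act.flip ∘ₗ (commutators B).mkQ ∘ₗ LinearMap.mulLeft k m) (E.coact y) =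
      (commutators B).mkQ (y * m) := by
  -- For w = a ⊗ h, the inverse canonical map gives aκ(h), whose sandwich around m is h·[ma].
  -- Applied to w = ρ(y), whose preimage is 1 ⊗_B y, this leaves [y m].
  have h : ∀ w : A ⊗[k] H,
      TensorProduct.lift (E.act.flip ∘ₗ (commutators B).mkQ ∘ₗ LinearMap.mulLeft k m) w =
        sandwich B (E.canonicalEquiv.symm w) m := by
    intro w
    induction w using TensorProduct.induction_on with
    | zero => simp
    | tmul a h =>
      rw [canonicalEquiv_symm_tmul, sandwich_lmulT]
      rfl
    | add a b ha hb => simp only [map_add, ha, hb, LinearMap.add_apply]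
  have h2 : E.canonicalEquiv.symm (E.coact y) = Submodule.Quotient.mk (1 ⊗ₜ y) := by
    rw [LinearEquiv.symm_apply_eq, canonicalEquiv_mk, ← Algebra.TensorProduct.one_def, one_mul]
  rw [h, h2, sandwich_mk, mul_one, Submodule.mkQ_apply]

/-- This is `act_coact` with m absorbed into the tensor, the form met after `ext_canonical`: the
action map a ⊗ h ↦ h·[a] sends mρ(y) to [y m]. -/
theorem act_mul_coact (m y : A) :
    TensorProduct.lift (E.act.flip ∘ₗ (commutators B).mkQ) ((m ⊗ₜ 1) * E.coact y) =
      (commutators B).mkQ (y * m) := by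
  rw [← E.act_coact]
  generalize E.coact y = w
  induction w using TensorProduct.induction_on with
  | zero => simp
  | tmul x h => simp
  | add a b ha hb => simp only [map_add, mul_add, ha, hb]

/-- The case y = 1 of `act_coact`, as ρ(1) = 1 ⊗ 1. -/
theorem act_one (m : CommQuot B) : E.act 1 m = m := by
  obtain ⟨a, rfl⟩ := Submodule.Quotient.mk_surjective _ m
  have h := E.act_coact a 1
  rw [map_one, one_mul, Algebra.TensorProduct.one_def, TensorProduct.lift.tmul] at h
  simpa using h

/-- Multiplicativity of ρ replaces any computation of κ(hc): on spanning elements, ρ(z)ρ(y) = ρ(zy)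
and `act_mul_coact` evaluates both sides. -/
theorem act_mul (h c : H) (m : CommQuot B) : E.act (h * c) m = E.act h (E.act c m) := by
  obtain ⟨a, rfl⟩ := Submodule.Quotient.mk_surjective _ m
  set F := TensorProduct.lift (E.act.flip ∘ₗ (commutators B).mkQ) with hF
  -- Right multiplication by ρ(y) before acting amounts to left multiplication by y inside the
  -- bracket. On pρ(z) both maps give [z y p].
  have h1 : ∀ y : A, F ∘ₗ LinearMap.mulRight k (E.coact y) =
      TensorProduct.lift (E.act.flip ∘ₗ (commutators B).mkQ ∘ₗ LinearMap.mulLeft k y) := by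
    intro y
    refine E.ext_canonical fun p z => ?_
    have h2 : ∀ w : A ⊗[k] H,
        TensorProduct.lift (E.act.flip ∘ₗ (commutators B).mkQ ∘ₗ LinearMap.mulLeft k y)
          ((p ⊗ₜ 1) * w) =
        TensorProduct.lift (E.act.flip ∘ₗ (commutators B).mkQ ∘ₗ LinearMap.mulLeft k (y * p))
          w := by
      intro w
      induction w using TensorProduct.induction_on with
      | zero => simp
      | tmul x h => simp
      | add a b ha hb => simp only [map_add, mul_add, ha, hb]
    rw [h2, act_coact, LinearMap.comp_apply, LinearMap.mulRight_apply, mul_assoc, ← map_mul,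
      hF, act_mul_coact, mul_assoc]
  -- The second use of the spanning elements: a ⊗ c is replaced by mρ(y), on which the left side is
  -- `F` of (m ⊗ h)ρ(y) and the right side is h·[y m]. These agree by `h1` at m ⊗ h.
  suffices h3 : F ∘ₗ (LinearMap.mulLeft k h).lTensor A = E.act h ∘ₗ F from
    LinearMap.congr_fun h3 (a ⊗ₜ c)
  refine E.ext_canonical fun m y => ?_
  have h4 : ∀ w : A ⊗[k] H, (LinearMap.mulLeft k h).lTensor A ((m ⊗ₜ 1) * w) =
      (m ⊗ₜ h) * w := by
    intro w
    induction w using TensorProduct.induction_on with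
    | zero => simp
    | tmul x h => simp
    | add a b ha hb => simp only [map_add, mul_add, ha, hb]
  have h5 := LinearMap.congr_fun (h1 y) (m ⊗ₜ h)
  rw [LinearMap.comp_apply, LinearMap.comp_apply, h4, hF, act_mul_coact]
  exact h5

/-! ### Coactions of A into A ⊗ H^{⊗n}: on a new first factor and on all factors diagonally. -/

/-- `a ↦ ∑ a₍₀₎ ⊗ (a₍₁₎ ⊗ 1 ⊗ ⋯ ⊗ 1)`. -/
noncomputable def coactHead (n : ℕ) : A →ₐ[k] A ⊗[k] (⨂[k]^(n + 1) H) :=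
  (Algebra.TensorProduct.map (AlgHom.id k A) (headIncl k H n)).comp E.coact

theorem coactHead_apply (n : ℕ) (a : A) :
    E.coactHead n a = (headIncl k H n).toLinearMap.lTensor A (E.coact a) := rfl

theorem coactHead_mul_tailIncl (n : ℕ) (a : A) (v : ⨂[k]^n H) :
    E.coactHead n a * (1 ⊗ₜ tailIncl k H n v) = (tcons.flip v).lTensor A (E.coact a) := by
  rw [coactHead_apply]
  generalize E.coact a = w
  induction w using TensorProduct.induction_on with
  | zero => simp
  | tmul x y => simp [tailIncl_apply, headIncl_mul_tcons]
  | add a b ha hb => simp only [map_add, add_mul, ha, hb]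

/-- The first element lives in A and the first factor of H^{⊗(n+1)}, the second in the other
factors. This commutation makes `spread` an algebra map. -/
theorem commute_coactHead (n : ℕ) (a : A) (v : ⨂[k]^n H) :
    Commute (E.coactHead n a)
      ((Algebra.TensorProduct.includeRight.comp (tailIncl k H n) : _ →ₐ[k]
        A ⊗[k] (⨂[k]^(n + 1) H)) v) := by
  rw [coactHead_apply, commute_iff_eq]
  generalize E.coact a = w
  induction w using TensorProduct.induction_on with
  | zero => simp
  | tmul x y => simp [tailIncl_apply, headIncl_apply, tcons_mul_tcons]
  | add a b ha hb => simp only [map_add, add_mul, mul_add, ha, hb]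

/-- `a ⊗ v ↦ ∑ a₍₀₎ ⊗ (a₍₁₎ ⊗ v)`. -/
noncomputable def spread (n : ℕ) : A ⊗[k] (⨂[k]^n H) →ₐ[k] A ⊗[k] (⨂[k]^(n + 1) H) :=
  Algebra.TensorProduct.lift (E.coactHead n)
    (Algebra.TensorProduct.includeRight.comp (tailIncl k H n)) (E.commute_coactHead n)

theorem spread_tmul (n : ℕ) (a : A) (v : ⨂[k]^n H) :
    E.spread n (a ⊗ₜ v) = (tcons.flip v).lTensor A (E.coact a) := by
  rw [← coactHead_mul_tailIncl]
  simp [spread]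

theorem spread_tmul_one_mul (n : ℕ) (a : A) (X : A ⊗[k] (⨂[k]^n H)) :
    E.spread n ((a ⊗ₜ 1) * X) = E.coactHead n a * E.spread n X := by
  rw [map_mul]
  simp [spread, ← Algebra.TensorProduct.one_def]

theorem coactHead_of_mem (n : ℕ) {b : A} (hb : b ∈ B) : E.coactHead n b = b ⊗ₜ 1 := by
  rw [coactHead_apply, (E.mem_iff b).1 hb]
  simp

/-- The counit axiom of the comodule A. -/
theorem counitAt_zero_spread (n : ℕ) (X : A ⊗[k] (⨂[k]^n H)) :
    (counitAt k H n 0).lTensor A (E.spread n X) = X := by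
  induction X using TensorProduct.induction_on with
  | zero => simp
  | tmul a v =>
    rw [spread_tmul]
    have h : ∀ w : A ⊗[k] H, (counitAt k H n 0).lTensor A ((tcons.flip v).lTensor A w) =
        (TensorProduct.rid k A (Coalgebra.counit.lTensor A w)) ⊗ₜ v := by
      intro w
      induction w using TensorProduct.induction_on with
      | zero => simp
      | tmul x y => simp [TensorProduct.smul_tmul]
      | add a b ha hb => simp only [map_add, TensorProduct.add_tmul, ha, hb]
    rw [h]
    exact congrArg (· ⊗ₜ v) (LinearMap.congr_fun E.counit_comp a)
  | add a b ha hb => simp only [map_add, ha, hb]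

/-- Spreading only creates a new first factor, so it does not see what happens on the old ones. -/
theorem lTensor_tlift_spread {m n : ℕ} (f : (⨂[k]^m H) →ₗ[k] (⨂[k]^n H))
    (X : A ⊗[k] (⨂[k]^m H)) :
    (tlift f).lTensor A (E.spread m X) = E.spread n (f.lTensor A X) := by
  induction X using TensorProduct.induction_on with
  | zero => simp
  | tmul a v =>
    rw [spread_tmul, LinearMap.lTensor_tmul, spread_tmul, ← LinearMap.comp_apply,
      ← LinearMap.lTensor_comp]
    congr 2
    ext x
    simp
  | add a b ha hb => simp only [map_add, ha, hb]

theorem counitAt_succ_spread (n : ℕ) (i : Fin (n + 1)) (X : A ⊗[k] (⨂[k]^(n + 1) H)) :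
    (counitAt k H (n + 1) i.succ).lTensor A (E.spread (n + 1) X) =
      E.spread n ((counitAt k H n i).lTensor A X) :=
  E.lTensor_tlift_spread (counitAt k H n i) X

theorem comulAt_succ_spread (n : ℕ) (i : Fin (n + 1)) (X : A ⊗[k] (⨂[k]^(n + 1) H)) :
    (comulAt k H (n + 1) i.succ).lTensor A (E.spread (n + 1) X) =
      E.spread (n + 2) ((comulAt k H n i).lTensor A X) :=
  E.lTensor_tlift_spread (comulAt k H n i) X

theorem tsnoc_spread (n : ℕ) (x : H) (X : A ⊗[k] (⨂[k]^n H)) :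
    (tsnoc x).lTensor A (E.spread n X) = E.spread (n + 1) ((tsnoc x).lTensor A X) := by
  rw [← lTensor_tlift_spread]
  congr 2
  refine tpow_ext fun y z => ?_
  simp

/-- `∑ a₍₀₎ ⊗ f a₍₁₎ g a₍₂₎`, with the coassociativity applied. -/
theorem lift_coassoc {P : Type u} [AddCommGroup P] [Module k P]
    (F : A ⊗[k] (H ⊗[k] H) →ₗ[k] P) (a : A) :
    F (TensorProduct.assoc k A H H (E.coact.toLinearMap.rTensor H (E.coact a))) =
      F (Coalgebra.comul.lTensor A (E.coact a)) :=
  congrArg F (LinearMap.congr_fun E.coassoc a)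

/-- Coassociativity of ρ: comultiplying the newly created factor is the same as coacting a second
time. -/
theorem comulAt_zero_spread (n : ℕ) (X : A ⊗[k] (⨂[k]^n H)) :
    (comulAt k H n 0).lTensor A (E.spread n X) = E.spread (n + 1) (E.spread n X) := by
  induction X using TensorProduct.induction_on with
  | zero => simp
  | tmul a v =>
    have h1 : ∀ w : A ⊗[k] H, (comulAt k H n 0).lTensor A ((tcons.flip v).lTensor A w) =
        (tcons₂.flip v).lTensor A (Coalgebra.comul.lTensor A w) := by
      intro w
      induction w using TensorProduct.induction_on with
      | zero => simp
      | tmul x y => simp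
      | add a b ha hb => simp only [map_add, ha, hb]
    have h2 : ∀ (w : A ⊗[k] H) (y : H), (tcons.flip (tcons y v)).lTensor A w =
        (tcons₂.flip v).lTensor A (TensorProduct.assoc k A H H (w ⊗ₜ y)) := by
      intro w y
      induction w using TensorProduct.induction_on with
      | zero => simp
      | tmul x y => simp
      | add a b ha hb => simp only [map_add, TensorProduct.add_tmul, ha, hb]
    have h3 : ∀ w : A ⊗[k] H, E.spread (n + 1) ((tcons.flip v).lTensor A w) =
        (tcons₂.flip v).lTensor A
          (TensorProduct.assoc k A H H (E.coact.toLinearMap.rTensor H w)) := by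
      intro w
      induction w using TensorProduct.induction_on with
      | zero => simp
      | tmul x y =>
        simp only [LinearMap.lTensor_tmul, LinearMap.rTensor_tmul, LinearMap.flip_apply,
          spread_tmul, h2, AlgHom.toLinearMap_apply]
      | add a b ha hb => simp only [map_add, ha, hb]
    rw [spread_tmul, h1, h3, lift_coassoc]
  | add a b ha hb => simp only [map_add, ha, hb]

/-- The diagonal coaction `a ↦ ∑ a₍₀₎ ⊗ (a₍₁₎ ⊗ ⋯ ⊗ a₍ₙ₎)`. -/
noncomputable def coactDiag (n : ℕ) : A →ₗ[k] A ⊗[k] (⨂[k]^n H) :=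
  (iterComul k H n).lTensor A ∘ₗ E.coact.toLinearMap

theorem coactDiag_apply (n : ℕ) (a : A) :
    E.coactDiag n a = (iterComul k H n).lTensor A (E.coact a) := rfl

theorem coactDiag_zero (a : A) : E.coactDiag 0 a = a ⊗ₜ 1 := by
  have h : ∀ w : A ⊗[k] H, (iterComul k H 0).lTensor A w =
      (TensorProduct.rid k A (Coalgebra.counit.lTensor A w)) ⊗ₜ 1 := by
    intro w
    induction w using TensorProduct.induction_on with
    | zero => simp
    | tmul x y => simp [iterComul, TensorProduct.smul_tmul]
    | add a b ha hb => simp only [map_add, TensorProduct.add_tmul, ha, hb]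
  rw [coactDiag_apply, h]
  exact congrArg (· ⊗ₜ 1) (LinearMap.congr_fun E.counit_comp a)

/-- Coassociativity again: the diagonal coaction arises by repeated spreading. Together with
multiplicativity of `spread`, this lets a diagonal right factor pass through it. -/
theorem spread_coactDiag (n : ℕ) (a : A) :
    E.spread n (E.coactDiag n a) = E.coactDiag (n + 1) a := by
  have h1 : ∀ w : A ⊗[k] H, (iterComul k H (n + 1)).lTensor A w =
      (TensorProduct.lift (tcons.compl₂ (iterComul k H n))).lTensor A
        (Coalgebra.comul.lTensor A w) := by
    intro w
    induction w using TensorProduct.induction_on with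
    | zero => simp
    | tmul x y => simp [iterComul_succ]
    | add a b ha hb => simp only [map_add, ha, hb]
  have h2 : ∀ (w : A ⊗[k] H) (y : H), (tcons.flip (iterComul k H n y)).lTensor A w =
      (TensorProduct.lift (tcons.compl₂ (iterComul k H n))).lTensor A
        (TensorProduct.assoc k A H H (w ⊗ₜ y)) := by
    intro w y
    induction w using TensorProduct.induction_on with
    | zero => simp
    | tmul x y => simp
    | add a b ha hb => simp only [map_add, TensorProduct.add_tmul, ha, hb]
  have h3 : ∀ w : A ⊗[k] H, E.spread n ((iterComul k H n).lTensor A w) =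
      (TensorProduct.lift (tcons.compl₂ (iterComul k H n))).lTensor A
        (TensorProduct.assoc k A H H (E.coact.toLinearMap.rTensor H w)) := by
    intro w
    induction w using TensorProduct.induction_on with
    | zero => simp
    | tmul x y =>
      simp only [LinearMap.lTensor_tmul, LinearMap.rTensor_tmul, spread_tmul, h2,
        AlgHom.toLinearMap_apply]
    | add a b ha hb => simp only [map_add, ha, hb]
  rw [coactDiag_apply, coactDiag_apply, h1, h3, lift_coassoc]

end HopfGaloisExtension
end HopfCyclic

/-! ### The cyclic operator on H^{⊗(n+1)} ⊗_H A_B. -/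

namespace HopfCyclic

variable {k : Type u} [Field k] {H : Type u} [Ring H] [HopfAlgebra k H] {A : Type u} [Ring A]
  [Algebra k A]

namespace HopfGaloisExtension

variable {B : Subalgebra k A} (E : HopfGaloisExtension H B)

/-- The projection `A ⊗ H^{⊗(n+1)} → H^{⊗(n+1)} ⊗_H A_B`, `a ⊗ v ↦ v ⊗ [a]`. -/
noncomputable def toHopf (n : ℕ) : A ⊗[k] (⨂[k]^(n + 1) H) →ₗ[k] HopfTensor E.act n :=
  (balancedRel (diagonalAct k H (n + 1)) E.act).mkQ ∘ₗ
    (commutators B).mkQ.lTensor (⨂[k]^(n + 1) H) ∘ₗ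
    (TensorProduct.comm k A (⨂[k]^(n + 1) H)).toLinearMap

theorem toHopf_tmul (n : ℕ) (a : A) (v : ⨂[k]^(n + 1) H) :
    E.toHopf n (a ⊗ₜ v) = Submodule.Quotient.mk (v ⊗ₜ Submodule.Quotient.mk a) := rfl

theorem toHopf_surjective (n : ℕ) : Function.Surjective (E.toHopf n) :=
  (Submodule.mkQ_surjective _).comp
    ((LinearMap.lTensor_surjective _ (Submodule.mkQ_surjective _)).comp
      (TensorProduct.comm k A (⨂[k]^(n + 1) H)).surjective)

theorem hopfTensor_mk_mul_iterComul (n : ℕ) (v : ⨂[k]^(n + 1) H) (h : H) (m : CommQuot B) :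
    (Submodule.Quotient.mk ((v * iterComul k H (n + 1) h) ⊗ₜ m) : HopfTensor E.act n) =
      Submodule.Quotient.mk (v ⊗ₜ E.act h m) :=
  (Submodule.Quotient.eq _).2 (Submodule.subset_span ⟨h, v, m, rfl⟩)

/-- For X = m ⊗ v, the balanced relation moves c₍₁₎ from v across the tensor sign, leaving v ⊗ ∑
c₍₁₎·[m c₍₀₎], which is v ⊗ [c m] by `act_coact`. This is the mechanism by which a last factor of A
becomes a first one. -/
theorem toHopf_mul_coactDiag (n : ℕ) (X : A ⊗[k] (⨂[k]^(n + 1) H)) (c : A) :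
    E.toHopf n (X * E.coactDiag (n + 1) c) = E.toHopf n ((c ⊗ₜ 1) * X) := by
  induction X using TensorProduct.induction_on with
  | zero => simp
  | tmul m v =>
    have h : ∀ w : A ⊗[k] H,
        E.toHopf n ((m ⊗ₜ v) * (iterComul k H (n + 1)).lTensor A w) =
        (balancedRel (diagonalAct k H (n + 1)) E.act).mkQ (v ⊗ₜ
          TensorProduct.lift (E.act.flip ∘ₗ (commutators B).mkQ ∘ₗ LinearMap.mulLeft k m) w) := by
      intro w
      induction w using TensorProduct.induction_on with
      | zero => simp
      | tmul x y =>
        rw [LinearMap.lTensor_tmul, Algebra.TensorProduct.tmul_mul_tmul]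
        exact hopfTensor_mk_mul_iterComul E n v y (Submodule.Quotient.mk (m * x))
      | add a b ha hb => simp only [map_add, mul_add, TensorProduct.tmul_add, ha, hb]
    rw [coactDiag_apply, h, act_coact, Algebra.TensorProduct.tmul_mul_tmul, one_mul]
    rfl
  | add a b ha hb => simp only [map_add, mul_add, add_mul, ha, hb]

theorem toHopf_mem_mul (n : ℕ) (X : A ⊗[k] (⨂[k]^(n + 1) H)) {b : A} (hb : b ∈ B) :
    E.toHopf n (X * (b ⊗ₜ 1)) = E.toHopf n ((b ⊗ₜ 1) * X) := by
  induction X using TensorProduct.induction_on with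
  | zero => simp
  | tmul m v =>
    have h : (Submodule.Quotient.mk (m * b) : CommQuot B) = Submodule.Quotient.mk (b * m) :=
      (Submodule.Quotient.eq _).2 (Submodule.subset_span ⟨m, b, hb, rfl⟩)
    rw [Algebra.TensorProduct.tmul_mul_tmul, Algebra.TensorProduct.tmul_mul_tmul, toHopf_tmul,
      toHopf_tmul, h, one_mul, mul_one]
  | add x y hx hy => simp only [map_add, mul_add, add_mul, hx, hy]

/-- The map `v ⊗ m ↦ ∑ (rotate(v) · (m₍₁₎ ⊗ 1)) ⊗ m₍₀₎`, before passing to the balanced quotient. -/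
noncomputable def cyclicOpAux (n : ℕ) :
    (⨂[k]^(n + 1) H) ⊗[k] CommQuot B →ₗ[k] HopfTensor E.act n :=
  TensorProduct.lift
    (((LinearMap.lTensorHom (CommQuot B) ∘ₗ (LinearMap.mul k (⨂[k]^(n + 1) H)).compl₁₂
        (rotate k H n).toLinearMap (headIncl k H n).toLinearMap).compr₂
      ((balancedRel (diagonalAct k H (n + 1)) E.act).mkQ ∘ₗ
        (TensorProduct.comm k (CommQuot B) (⨂[k]^(n + 1) H)).toLinearMap)).compl₂ E.coactQuot)

theorem cyclicOpAux_tmul (n : ℕ) (v : ⨂[k]^(n + 1) H) (m : CommQuot B) :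
    E.cyclicOpAux n (v ⊗ₜ m) = (balancedRel (diagonalAct k H (n + 1)) E.act).mkQ
      (TensorProduct.comm k (CommQuot B) (⨂[k]^(n + 1) H)
        (((LinearMap.mulLeft k (rotate k H n v)) ∘ₗ (headIncl k H n).toLinearMap).lTensor
          (CommQuot B) (E.coactQuot m))) := rfl

theorem cyclicOpAux_tmul_mk (n : ℕ) (v : ⨂[k]^(n + 1) H) (a : A) :
    E.cyclicOpAux n (v ⊗ₜ Submodule.Quotient.mk a) =
      E.toHopf n ((1 ⊗ₜ rotate k H n v) * E.coactHead n a) := by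
  have h : E.coactQuot (Submodule.Quotient.mk a) = (commutators B).mkQ.rTensor H (E.coact a) := rfl
  rw [cyclicOpAux_tmul, h, coactHead_apply]
  generalize E.coact a = w
  induction w using TensorProduct.induction_on with
  | zero => simp
  | tmul x y => simp [toHopf_tmul]
  | add a b ha hb => simp only [map_add, mul_add, ha, hb]

/-- For a single term p ⊗ g in place of ρ(m), coassociativity turns the claim into an equality of ∑
p y₍₀₎ ⊗ rotate(Δ(y₍₂₎))(g y₍₁₎ ⊗ 1) and ∑ p y₍₀₎ ⊗ (y₍₂₎ g ⊗ 1)Δ(y₍₁₎), which is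
`rotate_iterComul_mul_headIncl` applied to the H-part. Its use is to trade the rotated diagonal for
an honest diagonal on the right, which `toHopf_mul_coactDiag` can absorb. -/
theorem rotate_coactDiag_mul_coactHead (n : ℕ) (m y : A) :
    TensorProduct.lift ((LinearMap.mul k (A ⊗[k] (⨂[k]^(n + 1) H))).flip.compl₁₂
      (E.coactHead n).toLinearMap
      (LinearMap.mulRight k (E.coactHead n m) ∘ₗ TensorProduct.mk k A (⨂[k]^(n + 1) H) 1 ∘ₗ
        (rotate k H n).toLinearMap ∘ₗ iterComul k H (n + 1))) (E.coact y) =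
    TensorProduct.lift ((LinearMap.mul k (A ⊗[k] (⨂[k]^(n + 1) H))).flip.compl₁₂
      (E.coactDiag (n + 1))
      (LinearMap.mulRight k (E.coactHead n m) ∘ₗ TensorProduct.mk k A (⨂[k]^(n + 1) H) 1 ∘ₗ
        (headIncl k H n).toLinearMap)) (E.coact y) := by
  -- Only linearity in ρ(m) matters, so ρ(m) is replaced by an arbitrary tensor and then by p ⊗ g.
  rw [coactHead_apply E n m]
  generalize E.coact m = w'
  induction w' using TensorProduct.induction_on with
  | zero =>
    generalize E.coact y = w
    induction w using TensorProduct.induction_on with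
    | zero => simp
    | tmul x h => simp
    | add a b ha hb => rw [map_add, map_add, ha, hb]
  | tmul p g =>
    set r₁ := TensorProduct.lift ((LinearMap.mul k (⨂[k]^(n + 1) H)).flip.compl₁₂
      ((headIncl k H n).toLinearMap ∘ₗ LinearMap.mulLeft k g)
      ((rotate k H n).toLinearMap ∘ₗ iterComul k H (n + 1))) with hr₁
    set r₂ := TensorProduct.lift ((LinearMap.mul k (⨂[k]^(n + 1) H)).flip.compl₁₂
      (iterComul k H (n + 1))
      ((headIncl k H n).toLinearMap ∘ₗ LinearMap.mulRight k g)) with hr₂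
    have e1 : ∀ (w : A ⊗[k] H) (h : H),
        ((1 : A) ⊗ₜ[k] rotate k H n (iterComul k H (n + 1) h) * (p ⊗ₜ headIncl k H n g)) *
          (headIncl k H n).toLinearMap.lTensor A w =
        TensorProduct.map (LinearMap.mulLeft k p) r₁ (TensorProduct.assoc k A H H (w ⊗ₜ h)) := by
      intro w h
      induction w using TensorProduct.induction_on with
      | zero => simp
      | tmul x y => simp [hr₁, mul_assoc]
      | add a b ha hb => simp only [map_add, mul_add, TensorProduct.add_tmul, ha, hb]
    have e2 : ∀ (w : A ⊗[k] H) (h : H),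
        ((1 : A) ⊗ₜ[k] headIncl k H n h * (p ⊗ₜ headIncl k H n g)) *
          (iterComul k H (n + 1)).lTensor A w =
        TensorProduct.map (LinearMap.mulLeft k p) r₂ (TensorProduct.assoc k A H H (w ⊗ₜ h)) := by
      intro w h
      induction w using TensorProduct.induction_on with
      | zero => simp
      | tmul x y => simp [hr₂, mul_assoc]
      | add a b ha hb => simp only [map_add, mul_add, TensorProduct.add_tmul, ha, hb]
    have e3 : ∀ w : A ⊗[k] H,
        TensorProduct.map (LinearMap.mulLeft k p) r₁ (Coalgebra.comul.lTensor A w) =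
        TensorProduct.map (LinearMap.mulLeft k p) r₂ (Coalgebra.comul.lTensor A w) := by
      intro w
      induction w using TensorProduct.induction_on with
      | zero => simp
      | tmul x y =>
        simp only [LinearMap.lTensor_tmul, TensorProduct.map_tmul, hr₁, hr₂,
          rotate_iterComul_mul_headIncl]
      | add a b ha hb => simp only [map_add, ha, hb]
    have e4 := E.lift_coassoc (TensorProduct.map (LinearMap.mulLeft k p) r₁) y
    have e5 := E.lift_coassoc (TensorProduct.map (LinearMap.mulLeft k p) r₂) y
    rw [e3, ← e5] at e4
    convert e4 using 1
    · generalize E.coact y = w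
      induction w using TensorProduct.induction_on with
      | zero => simp
      | tmul x h => exact e1 (E.coact x) h
      | add a b ha hb => simp only [map_add, ha, hb]
    · generalize E.coact y = w
      induction w using TensorProduct.induction_on with
      | zero => simp
      | tmul x h => exact e2 (E.coact x) h
      | add a b ha hb => simp only [map_add, ha, hb]
  | add a b ha hb =>
    have h1 : ∀ (f : A →ₗ[k] A ⊗[k] (⨂[k]^(n + 1) H)) (g : H →ₗ[k] A ⊗[k] (⨂[k]^(n + 1) H))
        (s t : A ⊗[k] (⨂[k]^(n + 1) H)) (w : A ⊗[k] H),
        TensorProduct.lift ((LinearMap.mul k (A ⊗[k] (⨂[k]^(n + 1) H))).flip.compl₁₂ f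
          (LinearMap.mulRight k (s + t) ∘ₗ g)) w =
        TensorProduct.lift ((LinearMap.mul k (A ⊗[k] (⨂[k]^(n + 1) H))).flip.compl₁₂ f
          (LinearMap.mulRight k s ∘ₗ g)) w +
        TensorProduct.lift ((LinearMap.mul k (A ⊗[k] (⨂[k]^(n + 1) H))).flip.compl₁₂ f
          (LinearMap.mulRight k t ∘ₗ g)) w := by
      intro f g s t w
      induction w using TensorProduct.induction_on with
      | zero => simp
      | tmul x h => simp [mul_add]
      | add a b ha hb => simp only [map_add, ha, hb]; abel
    rw [map_add, h1, h1, ha, hb]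

/-- Take mρ(y) in place of a ⊗ c. The left side carries rotate(v)·rotate(Δ(y₍₁₎))·ρ(m)ρ(y₍₀₎), with
both coactions in the first factor. The preceding lemma rewrites it as rotate(v)·y₍₁₎·ρ(m) times the
diagonal coaction of y₍₀₎; absorbing the latter brings y₍₀₎ to the front of the A-part and assembles
ρ(y)ρ(m) = ρ(ym). That is the right side, because y₍₁₎·[m y₍₀₎] sums to [y m]. -/
theorem cyclicOpAux_balanced (n : ℕ) (v : ⨂[k]^(n + 1) H) (c : H) (m : CommQuot B) :
    E.cyclicOpAux n ((v * iterComul k H (n + 1) c) ⊗ₜ m) =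
      E.cyclicOpAux n (v ⊗ₜ E.act c m) := by
  obtain ⟨a, rfl⟩ := Submodule.Quotient.mk_surjective _ m
  -- `f` and `g` are the two sides, regarded as linear maps of a ⊗ c.
  set f : A ⊗[k] H →ₗ[k] HopfTensor E.act n := E.cyclicOpAux n ∘ₗ
    TensorProduct.map (LinearMap.mulLeft k v ∘ₗ iterComul k H (n + 1)) (commutators B).mkQ ∘ₗ
    (TensorProduct.comm k A H).toLinearMap with hf
  set g : A ⊗[k] H →ₗ[k] HopfTensor E.act n := E.cyclicOpAux n ∘ₗ
    TensorProduct.mk k _ _ v ∘ₗ TensorProduct.lift (E.act.flip ∘ₗ (commutators B).mkQ) with hg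
  suffices h : f = g from LinearMap.congr_fun h (a ⊗ₜ c)
  refine E.ext_canonical fun m y => ?_
  have h1 : ∀ w : A ⊗[k] H, f ((m ⊗ₜ 1) * w) = E.toHopf n ((1 ⊗ₜ rotate k H n v) *
      TensorProduct.lift ((LinearMap.mul k (A ⊗[k] (⨂[k]^(n + 1) H))).flip.compl₁₂
        (E.coactHead n).toLinearMap
        (LinearMap.mulRight k (E.coactHead n m) ∘ₗ TensorProduct.mk k A (⨂[k]^(n + 1) H) 1 ∘ₗ
          (rotate k H n).toLinearMap ∘ₗ iterComul k H (n + 1))) w) := by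
    intro w
    induction w using TensorProduct.induction_on with
    | zero => simp
    | tmul x h =>
      have : f ((m ⊗ₜ 1) * (x ⊗ₜ h)) = E.cyclicOpAux n ((v * iterComul k H (n + 1) h) ⊗ₜ
          Submodule.Quotient.mk (m * x)) := by
        rw [Algebra.TensorProduct.tmul_mul_tmul, one_mul]; rfl
      rw [this, cyclicOpAux_tmul_mk, rotate_mul, map_mul (E.coactHead n)]
      congr 1
      simp [← mul_assoc]
    | add a b ha hb => simp only [map_add, mul_add, ha, hb]
  -- The diagonal factor on the right is absorbed term by term; the elements of A that it brings to
  -- the left join their companions in the first factor of H^{⊗(n+1)}.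
  have h2 : ∀ w : A ⊗[k] H, E.toHopf n ((1 ⊗ₜ rotate k H n v) *
      TensorProduct.lift ((LinearMap.mul k (A ⊗[k] (⨂[k]^(n + 1) H))).flip.compl₁₂
        (E.coactDiag (n + 1))
        (LinearMap.mulRight k (E.coactHead n m) ∘ₗ TensorProduct.mk k A (⨂[k]^(n + 1) H) 1 ∘ₗ
          (headIncl k H n).toLinearMap)) w) =
      E.toHopf n ((1 ⊗ₜ rotate k H n v) *
        ((headIncl k H n).toLinearMap.lTensor A w * E.coactHead n m)) := by
    intro w
    induction w using TensorProduct.induction_on with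
    | zero => simp
    | tmul x h =>
      rw [TensorProduct.lift.tmul, LinearMap.compl₁₂_apply, LinearMap.flip_apply,
        LinearMap.mul_apply', ← mul_assoc, toHopf_mul_coactDiag]
      congr 1
      simp [← mul_assoc]
    | add a b ha hb => simp only [map_add, mul_add, add_mul, ha, hb]
  have h3 : g ((m ⊗ₜ 1) * E.coact y) =
      E.cyclicOpAux n (v ⊗ₜ Submodule.Quotient.mk (y * m)) := by
    rw [← Submodule.mkQ_apply, ← E.act_mul_coact]
    rfl
  rw [h1, rotate_coactDiag_mul_coactHead, h2, h3, cyclicOpAux_tmul_mk, map_mul (E.coactHead n)]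
  rfl

/-- The cyclic operator `(h₀, …, hₙ) ⊗ m ↦ ∑ (hₙm₍₁₎, h₀, …, hₙ₋₁) ⊗ m₍₀₎` of `Z_*(H, A_B)`. -/
noncomputable def cyclicOp (n : ℕ) : HopfTensor E.act n →ₗ[k] HopfTensor E.act n :=
  (balancedRel (diagonalAct k H (n + 1)) E.act).liftQ (E.cyclicOpAux n)
    (balancedRel_le _ _ ⊥ _ fun c v m => by
      rw [Submodule.mem_bot, sub_eq_zero]
      exact E.cyclicOpAux_balanced n v c m)

theorem cyclicOp_toHopf_tmul (n : ℕ) (v : ⨂[k]^(n + 1) H) (a : A) :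
    E.cyclicOp n (E.toHopf n (a ⊗ₜ v)) =
      E.toHopf n ((1 ⊗ₜ rotate k H n v) * E.coactHead n a) :=
  E.cyclicOpAux_tmul_mk n v a

/-- An arbitrary finite expansion of the coaction of a plays the role of the Sweedler sum. -/
theorem cyclicOp_hopfTensorMk (n : ℕ) (h : Fin (n + 1) → H) (a : CommQuot B) (r : ℕ)
    (a₀ : Fin r → CommQuot B) (a₁ : Fin r → H) (ha : E.coactQuot a = ∑ i, a₀ i ⊗ₜ[k] a₁ i) :
    E.cyclicOp n (hopfTensorMk E.act h a) =
      ∑ i, hopfTensorMk E.act (Fin.cons (h (Fin.last n) * a₁ i) (Fin.init h) : Fin (n + 1) → H)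
        (a₀ i) := by
  refine (cyclicOpAux_tmul E n _ a).trans ?_
  rw [ha, map_sum, map_sum, map_sum]
  refine Finset.sum_congr rfl fun i _ => ?_
  have h1 : rotate k H n (PiTensorProduct.tprod k h) =
      tcons (h (Fin.last n)) (PiTensorProduct.tprod k (Fin.init h)) := by
    rw [← rotate_snoc, Fin.snoc_init_self]
  rw [LinearMap.lTensor_tmul, LinearMap.comp_apply, LinearMap.mulLeft_apply,
    AlgHom.toLinearMap_apply, h1, tcons_mul_headIncl, tcons_tprod]
  rfl

/-- When the last entry is 1, the new first entry is just a₍₁₎, so rotating amounts to spreading.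
The values of the comparison map are represented by tuples ending in 1. -/
theorem cyclicOp_toHopf_tsnoc_one (n : ℕ) (X : A ⊗[k] (⨂[k]^n H)) :
    E.cyclicOp n (E.toHopf n ((tsnoc 1).lTensor A X)) = E.toHopf n (E.spread n X) := by
  induction X using TensorProduct.induction_on with
  | zero => simp
  | tmul a v =>
    rw [LinearMap.lTensor_tmul, cyclicOp_toHopf_tmul, rotate_tsnoc, spread_tmul,
      ← coactHead_mul_tailIncl]
    exact congrArg (E.toHopf n) (E.commute_coactHead n a v).eq.symm
  | add a b ha hb => simp only [map_add, ha, hb]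

end HopfGaloisExtension
end HopfCyclic

/-! ### The comparison map and its compatibility with the cyclic structures. -/

namespace HopfCyclic

variable {k : Type u} [Field k] {H : Type u} [Ring H] [HopfAlgebra k H] {A : Type u} [Ring A]
  [Algebra k A]

theorem counitAt_last_tsnoc (n : ℕ) (x : H) (v : ⨂[k]^n H) :
    counitAt k H n (Fin.last n) (tsnoc x v) = Coalgebra.counit (R := k) x • v := by
  induction n with
  | zero => rw [tsnoc_eq_tcons]; exact counitAt_zero 0 x v
  | succ n ih =>
    induction v using tpow_induction with
    | h1 y v => rw [tsnoc_tcons, ← Fin.succ_last, counitAt_succ, ih, map_smul]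
    | h2 z w hz hw => simp only [map_add, hz, hw, smul_add]

theorem tsnoc_one_one : tsnoc 1 (1 : ⨂[k]^0 H) = 1 := by
  rw [tsnoc_eq_tcons, ← one_eq_tcons]

/-- The defining relations of the cyclic tensor product are the rotations of the first one. -/
theorem cyclicRel_le_of_rotate (B : Subalgebra k A) (n : ℕ) {P : Type u} [AddCommGroup P]
    [Module k P] (f : (⨂[k]^(n + 1) A) →ₗ[k] P) (t : P →ₗ[k] P)
    (ht : ∀ z, f (rotate k A n z) = t (f z))
    (h : ∀ (a : Fin (n + 1) → A), ∀ b ∈ B,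
      f (PiTensorProduct.tprod k (Function.update a 0 (a 0 * b))) =
        f (PiTensorProduct.tprod k (Function.update a 1 (b * a 1)))) :
    cyclicRel B n ≤ LinearMap.ker f := by
  rw [cyclicRel, Submodule.span_le]
  rintro _ ⟨a, i, b, hb, rfl⟩
  rw [SetLike.mem_coe, LinearMap.mem_ker, map_sub, sub_eq_zero]
  induction i using Fin.induction generalizing a with
  | zero => rw [zero_add]; exact h a b hb
  | succ i ih =>
    -- The relation at i + 1 is the rotation of the relation at i for the tuple `a ∘ finRotate (n +
    -- 1)`, and `f` turns the rotation into `t`.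
    have hr : ∀ j x, PiTensorProduct.tprod k (Function.update a (finRotate (n + 1) j) x) =
        rotate k A n (PiTensorProduct.tprod k
          (Function.update (a ∘ finRotate (n + 1)) j x)) := by
      intro j x
      rw [rotate_tprod]
      congr 1
      ext l
      simp only [Function.update_apply, Function.comp_apply, Equiv.apply_symm_apply]
      congr 1
      rw [Equiv.symm_apply_eq]
    have h1 : i.succ = finRotate (n + 1) i.castSucc := by
      rw [finRotate_apply, Fin.coeSucc_eq_succ]
    have h2 : i.succ + 1 = finRotate (n + 1) (i.castSucc + 1) := by
      rw [finRotate_apply, Fin.coeSucc_eq_succ]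
    have := ih (a ∘ finRotate (n + 1))
    simp only [Function.comp_apply] at this
    rw [h2, h1, hr, hr, ht, ht, this]

namespace HopfGaloisExtension

variable {B : Subalgebra k A} (E : HopfGaloisExtension H B)

/-- The map `A^{⊗n} → A ⊗ H^{⊗(n+1)}`,
`a₁ ⊗ ⋯ ⊗ aₙ ↦ ∑ a₁₍₀₎ ⋯ aₙ₍₀₎ ⊗ (a₁₍₁₎ ⋯ aₙ₍₁₎ ⊗ a₂₍₂₎ ⋯ aₙ₍₂₎ ⊗ ⋯ ⊗ aₙ₍ₙ₎ ⊗ 1)`. -/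
noncomputable def coactProd : (n : ℕ) → ((⨂[k]^n A) →ₗ[k] A ⊗[k] (⨂[k]^(n + 1) H))
  | 0 => (PiTensorProduct.isEmptyEquiv (R := k) (s := fun _ : Fin 0 => A)
      (Fin 0)).toLinearMap.smulRight 1
  | n + 1 => tuncons (((LinearMap.mul k (A ⊗[k] (⨂[k]^(n + 1) H))).compl₁₂
      (Algebra.TensorProduct.includeLeft : A →ₐ[k] A ⊗[k] (⨂[k]^(n + 1) H)).toLinearMap
      (coactProd n)).compr₂ (E.spread (n + 1)).toLinearMap)

theorem coactProd_tcons (n : ℕ) (a : A) (z : ⨂[k]^n A) :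
    E.coactProd (n + 1) (tcons a z) = E.spread (n + 1) ((a ⊗ₜ 1) * E.coactProd n z) := by
  simp [coactProd]

theorem coactProd_zero (z : ⨂[k]^0 A) : ∃ c : k, E.coactProd 0 z = c • 1 := ⟨_, rfl⟩

/-- The value on z is itself in the image of `spread`, by construction if z has a factor and because
`spread` is unital if it has none. Spreading it once more is therefore comultiplication of its first
entry. -/
theorem coactProd_tcons_one (n : ℕ) (z : ⨂[k]^n A) :
    E.coactProd (n + 1) (tcons 1 z) = (comulAt k H n 0).lTensor A (E.coactProd n z) := by
  rw [coactProd_tcons, ← Algebra.TensorProduct.one_def, one_mul]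
  cases n with
  | zero =>
    obtain ⟨c, hc⟩ := E.coactProd_zero z
    have := E.comulAt_zero_spread 0 1
    rw [map_one] at this
    rw [hc, map_smul, map_smul, this]
  | succ n =>
    suffices h : (E.spread (n + 2)).toLinearMap ∘ₗ E.coactProd (n + 1) =
      (comulAt k H (n + 1) 0).lTensor A ∘ₗ E.coactProd (n + 1) from LinearMap.congr_fun h z
    refine tpow_ext fun a y => ?_
    simp only [LinearMap.comp_apply, coactProd_tcons, AlgHom.toLinearMap_apply,
      comulAt_zero_spread]

/-- Entry i + 1 was created by spreading at the factor i + 1 of z; the counit undoes this, so that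
this factor and its predecessor are multiplied before the next spreading. Entry 0, which will
interact with a₀, and the last entry, which is the constant 1, are excluded. -/
theorem counitAt_coactProd (n : ℕ) (i : Fin (n + 1)) (z : ⨂[k]^(n + 2) A) :
    (counitAt k H (n + 2) i.succ.castSucc).lTensor A (E.coactProd (n + 2) z) =
      E.coactProd (n + 1) (mulAt k A n i z) := by
  rw [← Fin.succ_castSucc]
  suffices h : (counitAt k H (n + 2) i.castSucc.succ).lTensor A ∘ₗ E.coactProd (n + 2) =
    E.coactProd (n + 1) ∘ₗ mulAt k A n i from LinearMap.congr_fun h z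
  clear z
  have h0 : ∀ n : ℕ, (counitAt k H (n + 2) (Fin.castSucc (0 : Fin (n + 1))).succ).lTensor A ∘ₗ
      E.coactProd (n + 2) = E.coactProd (n + 1) ∘ₗ mulAt k A n 0 := by
    intro n
    refine tpow_ext fun b z => ?_
    suffices h : (counitAt k H (n + 2) (Fin.castSucc (0 : Fin (n + 1))).succ).lTensor A ∘ₗ
        E.coactProd (n + 2) ∘ₗ tcons b = E.coactProd (n + 1) ∘ₗ mulAt k A n 0 ∘ₗ tcons b from
      LinearMap.congr_fun h z
    refine tpow_ext fun c z => ?_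
    simp only [LinearMap.comp_apply, mulAt_zero]
    rw [coactProd_tcons, coactProd_tcons, coactProd_tcons, counitAt_succ_spread,
      lTensor_tmul_one_mul, Fin.castSucc_zero, counitAt_zero_spread, ← mul_assoc,
      Algebra.TensorProduct.tmul_mul_tmul, one_mul]
  induction n with
  | zero =>
    obtain rfl : i = 0 := by omega
    exact h0 0
  | succ n ih =>
    induction i using Fin.cases with
    | zero => exact h0 (n + 1)
    | succ i =>
      refine tpow_ext fun b z => ?_
      have := LinearMap.congr_fun (ih i) z
      simp only [LinearMap.comp_apply] at this ⊢
      rw [coactProd_tcons, counitAt_succ_spread, lTensor_tmul_one_mul, Fin.castSucc_succ, this,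
        mulAt_succ, coactProd_tcons]

/-- An inserted 1 causes one more spreading with no multiplication in between, and that doubles the
entry after position i. -/
theorem comulAt_coactProd (n : ℕ) (i : Fin (n + 1)) (z : ⨂[k]^(n + 1) A) :
    (comulAt k H (n + 1) i.succ).lTensor A (E.coactProd (n + 1) z) =
      E.coactProd (n + 2) (insertOne k A n i z) := by
  suffices h : (comulAt k H (n + 1) i.succ).lTensor A ∘ₗ E.coactProd (n + 1) =
    E.coactProd (n + 2) ∘ₗ insertOne k A n i from LinearMap.congr_fun h z
  clear z
  have h0 : ∀ n : ℕ, (comulAt k H (n + 1) (0 : Fin (n + 1)).succ).lTensor A ∘ₗ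
      E.coactProd (n + 1) = E.coactProd (n + 2) ∘ₗ insertOne k A n 0 := by
    intro n
    refine tpow_ext fun b z => ?_
    simp only [LinearMap.comp_apply, insertOne_zero]
    rw [coactProd_tcons, coactProd_tcons, coactProd_tcons_one, comulAt_succ_spread,
      lTensor_tmul_one_mul]
  induction n with
  | zero =>
    obtain rfl : i = 0 := by omega
    exact h0 0
  | succ n ih =>
    induction i using Fin.cases with
    | zero => exact h0 (n + 1)
    | succ i =>
      refine tpow_ext fun b z => ?_
      have := LinearMap.congr_fun (ih i) z
      simp only [LinearMap.comp_apply] at this ⊢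
      rw [coactProd_tcons, comulAt_succ_spread, lTensor_tmul_one_mul, this,
        insertOne_succ, coactProd_tcons]

/-- The last factor takes part in every spreading. As `spread` is multiplicative and iterates to the
diagonal coaction, c contributes a diagonal factor on the right, while the constant 1 at the end is
untouched. -/
theorem coactProd_tsnoc (n : ℕ) (c : A) (z : ⨂[k]^n A) :
    E.coactProd (n + 1) (tsnoc c z) =
      (tsnoc 1).lTensor A (E.coactProd n z * E.coactDiag (n + 1) c) := by
  induction n with
  | zero =>
    obtain ⟨s, hs⟩ := E.coactProd_zero z
    rw [tsnoc_eq_tcons, coactProd_tcons, hs, mul_smul_comm, mul_one, smul_mul_assoc, one_mul,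
      ← spread_coactDiag, coactDiag_zero, map_smul, map_smul, tsnoc_spread, LinearMap.lTensor_tmul,
      tsnoc_one_one]
  | succ n ih =>
    suffices h : E.coactProd (n + 2) ∘ₗ tsnoc c = (tsnoc 1).lTensor A ∘ₗ
      LinearMap.mulRight k (E.coactDiag (n + 2) c) ∘ₗ E.coactProd (n + 1) from
      LinearMap.congr_fun h z
    refine tpow_ext fun a z => ?_
    simp only [LinearMap.comp_apply, LinearMap.mulRight_apply]
    rw [tsnoc_tcons, coactProd_tcons, coactProd_tcons, ih, ← E.spread_coactDiag (n + 1),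
      ← map_mul, tsnoc_spread, mul_assoc]
    congr 1
    generalize E.coactProd n z * E.coactDiag (n + 1) c = X
    induction X using TensorProduct.induction_on with
    | zero => simp
    | tmul x y => simp
    | add x y hx hy => simp only [map_add, mul_add, hx, hy]

/-- The map `A^{⊗(n+1)} → Z_n(H, A_B)`,
`a₀ ⊗ ⋯ ⊗ aₙ ↦ ∑ (a₁₍₁₎ ⋯ aₙ₍₁₎, …, aₙ₍ₙ₎, 1) ⊗ [a₀a₁₍₀₎ ⋯ aₙ₍₀₎]`. -/
noncomputable def toHopfAux (n : ℕ) : (⨂[k]^(n + 1) A) →ₗ[k] HopfTensor E.act n :=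
  tuncons (((LinearMap.mul k (A ⊗[k] (⨂[k]^(n + 1) H))).compl₁₂
      (Algebra.TensorProduct.includeLeft : A →ₐ[k] A ⊗[k] (⨂[k]^(n + 1) H)).toLinearMap
      (E.coactProd n)).compr₂ (E.toHopf n))

theorem toHopfAux_tcons (n : ℕ) (a : A) (z : ⨂[k]^n A) :
    E.toHopfAux n (tcons a z) = E.toHopf n ((a ⊗ₜ 1) * E.coactProd n z) := by
  simp [toHopfAux]

/-- The face maps of `Z_*(H, A_B)`, as maps between the balanced tensor products. -/
noncomputable def hopfFace (n : ℕ) (i : Fin (n + 2)) :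
    HopfTensor E.act (n + 1) →ₗ[k] HopfTensor E.act n :=
  (hopfSimplicialModule E.act).d n i

/-- The degeneracies of `Z_*(H, A_B)`, as maps between the balanced tensor products. -/
noncomputable def hopfDegeneracy (n : ℕ) (i : Fin (n + 1)) :
    HopfTensor E.act n →ₗ[k] HopfTensor E.act (n + 1) :=
  (hopfSimplicialModule E.act).s n i

theorem hopfFace_toHopf (n : ℕ) (i : Fin (n + 2)) (X : A ⊗[k] (⨂[k]^(n + 2) H)) :
    E.hopfFace n i (E.toHopf (n + 1) X) =
      E.toHopf n ((counitAt k H (n + 1) i).lTensor A X) := by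
  induction X using TensorProduct.induction_on with
  | zero => simp only [map_zero]
  | tmul x y => rfl
  | add x y hx hy =>
    simp only [map_add, hx, hy]

theorem hopfDegeneracy_toHopf (n : ℕ) (i : Fin (n + 1)) (X : A ⊗[k] (⨂[k]^(n + 1) H)) :
    E.hopfDegeneracy n i (E.toHopf n X) =
      E.toHopf (n + 1) ((comulAt k H n i).lTensor A X) := by
  induction X using TensorProduct.induction_on with
  | zero => simp only [map_zero]
  | tmul x y => rfl
  | add x y hx hy =>
    simp only [map_add, hx, hy]

/-- All faces but the last. For i = 0 the counit cancels the spreading at a₁ and leaves a₀a₁; for i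
> 0 the factor a₀ is a spectator and `counitAt_coactProd` applies. -/
theorem toHopfAux_mulAt (n : ℕ) (i : Fin (n + 1)) (z : ⨂[k]^(n + 2) A) :
    E.toHopfAux n (mulAt k A n i z) =
      E.hopfFace n i.castSucc (E.toHopfAux (n + 1) z) := by
  suffices h : E.toHopfAux n ∘ₗ mulAt k A n i =
    E.hopfFace n i.castSucc ∘ₗ E.toHopfAux (n + 1) from LinearMap.congr_fun h z
  refine tpow_ext fun a y => ?_
  simp only [LinearMap.comp_apply]
  rw [toHopfAux_tcons, hopfFace_toHopf, lTensor_tmul_one_mul]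
  induction i using Fin.cases with
  | zero =>
    rw [Fin.castSucc_zero]
    suffices h : E.toHopfAux n ∘ₗ mulAt k A n 0 ∘ₗ tcons a =
      E.toHopf n ∘ₗ LinearMap.mulLeft k (a ⊗ₜ 1) ∘ₗ (counitAt k H (n + 1) 0).lTensor A ∘ₗ
        E.coactProd (n + 1) from LinearMap.congr_fun h y
    refine tpow_ext fun b y => ?_
    simp only [LinearMap.comp_apply, mulAt_zero, LinearMap.mulLeft_apply]
    rw [toHopfAux_tcons, coactProd_tcons, counitAt_zero_spread, ← mul_assoc,
      Algebra.TensorProduct.tmul_mul_tmul, one_mul]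
  | succ i =>
    cases n with
    | zero => exact i.elim0
    | succ n => rw [mulAt_succ, counitAt_coactProd, toHopfAux_tcons]

theorem toHopfAux_insertOne (n : ℕ) (i : Fin (n + 1)) (z : ⨂[k]^(n + 1) A) :
    E.toHopfAux (n + 1) (insertOne k A n i z) =
      E.hopfDegeneracy n i (E.toHopfAux n z) := by
  suffices h : E.toHopfAux (n + 1) ∘ₗ insertOne k A n i =
    E.hopfDegeneracy n i ∘ₗ E.toHopfAux n from LinearMap.congr_fun h z
  refine tpow_ext fun a y => ?_
  simp only [LinearMap.comp_apply]
  rw [toHopfAux_tcons, hopfDegeneracy_toHopf, lTensor_tmul_one_mul]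
  induction i using Fin.cases with
  | zero => rw [insertOne_zero, toHopfAux_tcons, coactProd_tcons_one]
  | succ i =>
    cases n with
    | zero => exact i.elim0
    | succ n => rw [insertOne_succ, comulAt_coactProd, toHopfAux_tcons]

/-- By `coactProd_tsnoc`, a last factor c enters as a diagonal factor on the right, before a final
entry 1. The cyclic operator then acts as `spread`, which keeps c diagonal, and
`toHopf_mul_coactDiag` moves c to the front of the A-part, where the rotated tensor has it. -/
theorem toHopfAux_rotate (n : ℕ) (z : ⨂[k]^(n + 1) A) :
    E.toHopfAux n (rotate k A n z) = E.cyclicOp n (E.toHopfAux n z) := by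
  suffices h : E.toHopfAux n ∘ₗ (rotate k A n).toLinearMap = E.cyclicOp n ∘ₗ E.toHopfAux n from
    LinearMap.congr_fun h z
  refine tpow_ext_snoc fun c y => ?_
  simp only [LinearMap.comp_apply, LinearEquiv.coe_coe, rotate_tsnoc]
  cases n with
  | zero =>
    obtain ⟨s, hs⟩ := E.coactProd_zero y
    -- In degree 0 this is the stability identity ∑ c₍₁₎·[c₍₀₎] = [c].
    have h1 := E.cyclicOp_toHopf_tsnoc_one 0 (c ⊗ₜ 1)
    rw [LinearMap.lTensor_tmul, tsnoc_one_one, ← coactDiag_zero, spread_coactDiag,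
      ← one_mul (E.coactDiag _ c), toHopf_mul_coactDiag, mul_one] at h1
    rw [tsnoc_eq_tcons, toHopfAux_tcons, hs, mul_smul_comm, mul_one, map_smul, map_smul, h1]
  | succ n =>
    suffices h : E.toHopfAux (n + 1) ∘ₗ tcons c =
      E.cyclicOp (n + 1) ∘ₗ E.toHopfAux (n + 1) ∘ₗ tsnoc c from LinearMap.congr_fun h y
    refine tpow_ext fun a w => ?_
    simp only [LinearMap.comp_apply, tsnoc_tcons]
    have h1 : ∀ X : A ⊗[k] (⨂[k]^(n + 1) H), (a ⊗ₜ 1) * (tsnoc 1).lTensor A X =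
        (tsnoc 1).lTensor A ((a ⊗ₜ 1) * X) := by
      intro X
      induction X using TensorProduct.induction_on with
      | zero => simp
      | tmul x y => simp
      | add x y hx hy => simp only [map_add, mul_add, hx, hy]
    rw [toHopfAux_tcons, coactProd_tcons, toHopfAux_tcons, coactProd_tsnoc, h1,
      cyclicOp_toHopf_tsnoc_one, ← mul_assoc,
      map_mul (E.spread (n + 1)) _ (E.coactDiag _ c),
      spread_coactDiag, toHopf_mul_coactDiag]

/-- Since b is coinvariant, it passes through the spreading at the factor 1 unchanged and ends up
next to a₀. -/
theorem toHopfAux_update (n : ℕ) (a : Fin (n + 1) → A) {b : A} (hb : b ∈ B) :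
    E.toHopfAux n (PiTensorProduct.tprod k (Function.update a 0 (a 0 * b))) =
      E.toHopfAux n (PiTensorProduct.tprod k (Function.update a 1 (b * a 1))) := by
  cases n with
  | zero =>
    -- With a single factor, the cyclic successor of 0 is 0 itself, and the relation is the one
    -- between ab and ba in A_B.
    have h0 : (1 : Fin 1) = 0 := rfl
    rw [h0, tprod_eq_tcons, tprod_eq_tcons (Function.update a 0 (b * a 0)), toHopfAux_tcons,
      toHopfAux_tcons, Function.update_self, Function.update_self, Fin.tail_update_zero,
      Fin.tail_update_zero]
    obtain ⟨s, hs⟩ := E.coactProd_zero (PiTensorProduct.tprod k (Fin.tail a))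
    have h1 := E.toHopf_mem_mul 0 (a 0 ⊗ₜ 1) hb
    rw [Algebra.TensorProduct.tmul_mul_tmul, Algebra.TensorProduct.tmul_mul_tmul, one_mul] at h1
    rw [hs, mul_smul_comm, mul_one, mul_smul_comm, mul_one, map_smul, map_smul, h1]
  | succ n =>
    have h1 : ∀ x, Fin.tail (Function.update a 1 x) = Function.update (Fin.tail a) 0 x :=
      fun x => Fin.tail_update_succ a 0 x
    rw [tprod_eq_tcons, tprod_eq_tcons (Function.update a 1 (b * a 1)), Function.update_self,
      Function.update_of_ne (by simp), Fin.tail_update_zero, h1, tprod_eq_tcons (Fin.tail a),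
      tprod_eq_tcons (Function.update (Fin.tail a) 0 _), Function.update_self,
      Fin.tail_update_zero, toHopfAux_tcons, toHopfAux_tcons, coactProd_tcons, coactProd_tcons]
    have h2 : ((b * a 1) ⊗ₜ[k] (1 : ⨂[k]^(n + 1) H)) = (b ⊗ₜ 1) * (a 1 ⊗ₜ 1) := by simp
    have h3 : ((a 0 * b) ⊗ₜ[k] (1 : ⨂[k]^(n + 2) H)) = (a 0 ⊗ₜ 1) * (b ⊗ₜ 1) := by simp
    rw [h2, h3, mul_assoc, mul_assoc, E.spread_tmul_one_mul _ b, E.coactHead_of_mem _ hb]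
    rfl

/-- The isomorphism `Z_n(A/B) → Z_n(H, A_B)`. -/
noncomputable def relToHopf (n : ℕ) : CyclicTensor B n →ₗ[k] HopfTensor E.act n :=
  (cyclicRel B n).liftQ (E.toHopfAux n)
    (cyclicRel_le_of_rotate B n _ (E.cyclicOp n) (E.toHopfAux_rotate n)
      fun a _ hb => E.toHopfAux_update n a hb)

theorem relToHopf_mk (n : ℕ) (z : ⨂[k]^(n + 1) A) :
    E.relToHopf n (Submodule.Quotient.mk z) = E.toHopfAux n z := rfl

/-- The counit is multiplicative, so ∑ ε(hₙ₊₁a₍₁₎)a₍₀₎ = ε(hₙ₊₁)a. This one cyclic axiom is checked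
by hand because the compatibility with the last face depends on it. -/
theorem d_zero_cyclicOp (n : ℕ) (x : HopfTensor E.act (n + 1)) :
    E.hopfFace n 0 (E.cyclicOp (n + 1) x) =
      E.hopfFace n (Fin.last (n + 1)) x := by
  obtain ⟨X, rfl⟩ := E.toHopf_surjective (n + 1) x
  rw [hopfFace_toHopf]
  suffices h : E.hopfFace n 0 ∘ₗ E.cyclicOp (n + 1) ∘ₗ E.toHopf (n + 1) =
    E.toHopf n ∘ₗ (counitAt k H (n + 1) (Fin.last (n + 1))).lTensor A from LinearMap.congr_fun h X
  refine TensorProduct.ext (LinearMap.ext fun a => tpow_ext_snoc fun x v => ?_)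
  have h1 : ∀ w : A ⊗[k] H, (counitAt k H (n + 1) 0).lTensor A
      ((1 ⊗ₜ tcons x v) * (headIncl k H (n + 1)).toLinearMap.lTensor A w) =
      (TensorProduct.rid k A (Coalgebra.counit.lTensor A w)) ⊗ₜ
        (Coalgebra.counit (R := k) x • v) := by
    intro w
    induction w using TensorProduct.induction_on with
    | zero => simp
    | tmul p q =>
      simp only [LinearMap.lTensor_tmul, Algebra.TensorProduct.tmul_mul_tmul, one_mul,
        AlgHom.toLinearMap_apply, tcons_mul_headIncl, counitAt_zero, Bialgebra.counit_mul,
        TensorProduct.rid_tmul, TensorProduct.smul_tmul, smul_smul, mul_comm]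
    | add a b ha hb => simp only [map_add, mul_add, TensorProduct.add_tmul, ha, hb]
  have h2 : TensorProduct.rid k A (Coalgebra.counit.lTensor A (E.coact a)) = a :=
    LinearMap.congr_fun E.counit_comp a
  change E.hopfFace n 0 (E.cyclicOp (n + 1) (E.toHopf (n + 1) (a ⊗ₜ tsnoc x v))) =
    E.toHopf n ((counitAt k H (n + 1) (Fin.last (n + 1))).lTensor A (a ⊗ₜ tsnoc x v))
  rw [cyclicOp_toHopf_tmul, hopfFace_toHopf, rotate_tsnoc, coactHead_apply, h1, h2,
    LinearMap.lTensor_tmul, counitAt_last_tsnoc]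

theorem relToHopf_d (n : ℕ) (i : Fin (n + 2)) :
    E.relToHopf n ∘ₗ (relCyclicModule B).d n i =
      (hopfSimplicialModule E.act).d n i ∘ₗ E.relToHopf (n + 1) := by
  apply Submodule.linearMap_qext
  refine LinearMap.ext fun z => ?_
  change E.toHopfAux n (faceT n i z) =
    E.hopfFace n i (E.toHopfAux (n + 1) z)
  induction i using Fin.lastCases with
  | last =>
    -- On both sides the last face is the face 0 after the cyclic operator.
    rw [← d_zero_cyclicOp, ← toHopfAux_rotate, faceT_last]
    exact E.toHopfAux_mulAt n 0 _
  | cast i => rw [faceT_castSucc]; exact E.toHopfAux_mulAt n i z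

theorem relToHopf_s (n : ℕ) (i : Fin (n + 1)) :
    E.relToHopf (n + 1) ∘ₗ (relCyclicModule B).s n i =
      (hopfSimplicialModule E.act).s n i ∘ₗ E.relToHopf n := by
  apply Submodule.linearMap_qext
  exact LinearMap.ext fun z => E.toHopfAux_insertOne n i z

theorem relToHopf_t (n : ℕ) :
    E.relToHopf n ∘ₗ (relCyclicModule B).t n = E.cyclicOp n ∘ₗ E.relToHopf n := by
  apply Submodule.linearMap_qext
  exact LinearMap.ext fun z => E.toHopfAux_rotate n z

end HopfGaloisExtension
end HopfCyclic

/-! ### The isomorphism Z_n(H, M) ⊗ H ≅ Z_{n+1}(H, M), by means of the antipode. -/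

namespace HopfCyclic

section HopfStep

variable {k : Type u} [Field k] {H : Type u} [Ring H] [HopfAlgebra k H]

variable (k H) in
/-- `v ⊗ h ↦ ∑ (h v₀₍₁₎, v₀₍₂₎, v₁, …, vₙ)`. -/
noncomputable def headStep (n : ℕ) : (⨂[k]^(n + 1) H) ⊗[k] H →ₗ[k] (⨂[k]^(n + 2) H) :=
  TensorProduct.lift ((LinearMap.mul k (⨂[k]^(n + 2) H)).flip.compl₁₂ (comulAt k H n 0)
    (headIncl k H (n + 1)).toLinearMap)

theorem headStep_tmul (n : ℕ) (v : ⨂[k]^(n + 1) H) (h : H) :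
    headStep k H n (v ⊗ₜ h) = headIncl k H (n + 1) h * comulAt k H n 0 v := rfl

variable (k H) in
/-- `(s, v) ↦ v ⊗ S(s)`. -/
noncomputable def antipodeHead (n : ℕ) : (⨂[k]^(n + 1) H) →ₗ[k] (⨂[k]^n H) ⊗[k] H :=
  tuncons ((TensorProduct.mk k (⨂[k]^n H) H).flip ∘ₗ HopfAlgebra.antipode k)

@[simp]
theorem antipodeHead_tcons (n : ℕ) (s : H) (v : ⨂[k]^n H) :
    antipodeHead k H n (tcons s v) = v ⊗ₜ HopfAlgebra.antipode k s := by
  simp [antipodeHead]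

variable (k H) in
/-- `(x, y, v) ↦ ∑ (y₍₂₎, v) ⊗ x S(y₍₁₎)`, the inverse of `headStep`. -/
noncomputable def headStepInv (n : ℕ) : (⨂[k]^(n + 2) H) →ₗ[k] (⨂[k]^(n + 1) H) ⊗[k] H :=
  tuncons ((LinearMap.lTensorHom (⨂[k]^(n + 1) H) ∘ₗ LinearMap.mul k H).compl₂
    (antipodeHead k H (n + 1) ∘ₗ comulAt k H n 0))

@[simp]
theorem headStepInv_tcons (n : ℕ) (x : H) (u : ⨂[k]^(n + 1) H) :
    headStepInv k H n (tcons x u) = (LinearMap.mulLeft k x).lTensor (⨂[k]^(n + 1) H)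
      (antipodeHead k H (n + 1) (comulAt k H n 0 u)) := by
  simp [headStepInv]
  rfl

/-- On (y, v) ⊗ h the composite is ∑ (y₍₃₎, v) ⊗ h y₍₁₎S(y₍₂₎), which collapses by the antipode and
counit axioms. -/
theorem headStepInv_headStep (n : ℕ) (z : (⨂[k]^(n + 1) H) ⊗[k] H) :
    headStepInv k H n (headStep k H n z) = z := by
  suffices h : ∀ (y : H) (v : ⨂[k]^n H) (h : H),
      headStepInv k H n (headStep k H n (tcons y v ⊗ₜ h)) = tcons y v ⊗ₜ h by
    induction z using TensorProduct.induction_on with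
    | zero => simp
    | tmul u x =>
      induction u using tpow_induction with
      | h1 y v => exact h y v x
      | h2 a b ha hb => simp only [TensorProduct.add_tmul, map_add, ha, hb]
    | add a b ha hb => simp only [map_add, ha, hb]
  intro y v h
  set F : (H ⊗[k] H) ⊗[k] H →ₗ[k] (⨂[k]^(n + 1) H) ⊗[k] H :=
    (TensorProduct.comm k H (⨂[k]^(n + 1) H)).toLinearMap ∘ₗ
      TensorProduct.map (LinearMap.mulLeft k h ∘ₗ LinearMap.mul' k H ∘ₗ
        (HopfAlgebra.antipode k).lTensor H) (tcons.flip v) with hF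
  have h1 : ∀ (a : H) (w : H ⊗[k] H),
      (LinearMap.mulLeft k (h * a)).lTensor (⨂[k]^(n + 1) H)
        (antipodeHead k H (n + 1) (tcons₂ w v)) =
      F ((TensorProduct.assoc k H H H).symm (a ⊗ₜ w)) := by
    intro a w
    induction w using TensorProduct.induction_on with
    | zero => simp
    | tmul c d => simp [hF]
    | add a b ha hb =>
      simp only [map_add, LinearMap.add_apply, TensorProduct.tmul_add, ha, hb]
  have h2 : ∀ w : H ⊗[k] H, headStepInv k H n (headIncl k H (n + 1) h * tcons₂ w v) =
      F ((TensorProduct.assoc k H H H).symm (Coalgebra.comul.lTensor H w)) := by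
    intro w
    induction w using TensorProduct.induction_on with
    | zero => simp
    | tmul a b => simp [headIncl_mul_tcons, h1, -LinearMap.mulLeft_mul]
    | add a b ha hb => simp only [map_add, LinearMap.add_apply, mul_add, ha, hb]
  have h3 : ∀ w : H ⊗[k] H, F (Coalgebra.comul.rTensor H w) =
      tcons (TensorProduct.lid k H (Coalgebra.counit.rTensor H w)) v ⊗ₜ h := by
    intro w
    induction w using TensorProduct.induction_on with
    | zero => simp
    | tmul a b =>
      simp [hF, HopfAlgebra.mul_antipode_lTensor_comul_apply, Algebra.algebraMap_eq_smul_one,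
        TensorProduct.smul_tmul]
    | add a b ha hb =>
      simp only [map_add, LinearMap.add_apply, TensorProduct.add_tmul, ha, hb]
  rw [headStep_tmul, comulAt_zero, h2, Coalgebra.coassoc_symm_apply, h3,
    Coalgebra.rTensor_counit_comul]
  simp

/-- On (x, y, v) the composite is ∑ (x S(y₍₁₎)y₍₂₎, y₍₃₎, v), which collapses by the other antipode
axiom. The inverse of S never enters. -/
theorem headStep_headStepInv (n : ℕ) (z : ⨂[k]^(n + 2) H) :
    headStep k H n (headStepInv k H n z) = z := by
  suffices h : headStep k H n ∘ₗ headStepInv k H n = LinearMap.id from LinearMap.congr_fun h z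
  refine tpow_ext fun x u => ?_
  suffices h : headStep k H n ∘ₗ headStepInv k H n ∘ₗ tcons x = tcons x from
    LinearMap.congr_fun h u
  refine tpow_ext fun y v => ?_
  set F : (H ⊗[k] H) ⊗[k] H →ₗ[k] (⨂[k]^(n + 2) H) :=
    TensorProduct.lift ((tcons ∘ₗ LinearMap.mulLeft k x ∘ₗ LinearMap.mul' k H ∘ₗ
        (HopfAlgebra.antipode k).rTensor H).compl₂ (tcons.flip v)) with hF
  have h1 : ∀ (c : H) (w : H ⊗[k] H),
      headIncl k H (n + 1) (x * HopfAlgebra.antipode k c) * tcons₂ w v =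
      F ((TensorProduct.assoc k H H H).symm (c ⊗ₜ w)) := by
    intro a w
    induction w using TensorProduct.induction_on with
    | zero => simp
    | tmul c d => simp [hF, mul_assoc, headIncl_mul_tcons, -map_mul]
    | add a b ha hb =>
      simp only [map_add, LinearMap.add_apply, TensorProduct.tmul_add, mul_add, ha, hb]
  have h2 : ∀ w : H ⊗[k] H, headStep k H n ((LinearMap.mulLeft k x).lTensor (⨂[k]^(n + 1) H)
      (antipodeHead k H (n + 1) (tcons₂ w v))) =
      F ((TensorProduct.assoc k H H H).symm (Coalgebra.comul.lTensor H w)) := by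
    intro w
    induction w using TensorProduct.induction_on with
    | zero => simp
    | tmul a b => simp [headStep_tmul, h1, -map_mul]
    | add a b ha hb => simp only [map_add, LinearMap.add_apply, ha, hb]
  have h3 : ∀ w : H ⊗[k] H, F (Coalgebra.comul.rTensor H w) =
      tcons x (tcons (TensorProduct.lid k H (Coalgebra.counit.rTensor H w)) v) := by
    intro w
    induction w using TensorProduct.induction_on with
    | zero => simp
    | tmul a b =>
      simp [hF, HopfAlgebra.mul_antipode_rTensor_comul_apply, Algebra.algebraMap_eq_smul_one]
    | add a b ha hb => simp only [map_add, LinearMap.add_apply, ha, hb]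
  simp only [LinearMap.comp_apply]
  rw [headStepInv_tcons, comulAt_zero, h2, Coalgebra.coassoc_symm_apply, h3,
    Coalgebra.rTensor_counit_comul]
  simp

/-- In the extra factor, x S(s) is replaced by x c₍₁₎S(s c₍₂₎) = x c₍₁₎S(c₍₂₎)S(s), and the c-terms
cancel after summation. Thus H acts diagonally on the remaining factors and trivially on the extra
one, which is what makes the inverse pass to the tensor product over H. -/
theorem headStepInv_mul_iterComul (n : ℕ) (z : ⨂[k]^(n + 2) H) (c : H) :
    headStepInv k H n (z * iterComul k H (n + 2) c) =
      headStepInv k H n z * (iterComul k H (n + 1) c ⊗ₜ 1) := by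
  induction z using tpow_induction with
  | h2 a b ha hb => simp only [map_add, add_mul, ha, hb]
  | h1 x u =>
    have h1 : ∀ w : H ⊗[k] H, headStepInv k H n (tcons x u *
        TensorProduct.lift (tcons.compl₂ (iterComul k H (n + 1))) w) =
        TensorProduct.lift ((LinearMap.lTensorHom (⨂[k]^(n + 1) H) ∘ₗ LinearMap.mul k H ∘ₗ
          LinearMap.mulLeft k x).compl₂ (antipodeHead k H (n + 1) ∘ₗ
            LinearMap.mulLeft k (comulAt k H n 0 u) ∘ₗ iterComul k H (n + 2))) w := by
      intro w
      induction w using TensorProduct.induction_on with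
      | zero => simp
      | tmul a b =>
        simp only [TensorProduct.lift.tmul, LinearMap.compl₂_apply, tcons_mul_tcons,
          headStepInv_tcons, comulAt_mul, comulAt_iterComul]
        rfl
      | add a b ha hb => simp only [map_add, mul_add, ha, hb]
    rw [iterComul_succ, h1, headStepInv_tcons]
    -- The cancellation does not need the first two entries to come from a comultiplication, so an
    -- arbitrary tensor (s, t) is treated.
    generalize comulAt k H n 0 u = p
    induction p using tpow_induction with
    | h2 a b ha hb =>
      have h2 : ∀ w : H ⊗[k] H, TensorProduct.lift ((LinearMap.lTensorHom (⨂[k]^(n + 1) H) ∘ₗ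
          LinearMap.mul k H ∘ₗ LinearMap.mulLeft k x).compl₂ (antipodeHead k H (n + 1) ∘ₗ
            LinearMap.mulLeft k (a + b) ∘ₗ iterComul k H (n + 2))) w =
          TensorProduct.lift ((LinearMap.lTensorHom (⨂[k]^(n + 1) H) ∘ₗ
          LinearMap.mul k H ∘ₗ LinearMap.mulLeft k x).compl₂ (antipodeHead k H (n + 1) ∘ₗ
            LinearMap.mulLeft k a ∘ₗ iterComul k H (n + 2))) w +
          TensorProduct.lift ((LinearMap.lTensorHom (⨂[k]^(n + 1) H) ∘ₗ
          LinearMap.mul k H ∘ₗ LinearMap.mulLeft k x).compl₂ (antipodeHead k H (n + 1) ∘ₗ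
            LinearMap.mulLeft k b ∘ₗ iterComul k H (n + 2))) w := by
        intro w
        induction w using TensorProduct.induction_on with
        | zero => simp
        | tmul y z => simp [add_mul]
        | add y z hy hz => simp only [map_add, hy, hz]; abel
      rw [h2, ha, hb, map_add, map_add, add_mul]
    | h1 s t =>
      set F : (H ⊗[k] H) ⊗[k] H →ₗ[k] (⨂[k]^(n + 1) H) ⊗[k] H :=
        (TensorProduct.comm k H (⨂[k]^(n + 1) H)).toLinearMap ∘ₗ
          TensorProduct.map (LinearMap.mulRight k (HopfAlgebra.antipode k s) ∘ₗ
            LinearMap.mulLeft k x ∘ₗ LinearMap.mul' k H ∘ₗ (HopfAlgebra.antipode k).lTensor H)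
          (LinearMap.mulLeft k t ∘ₗ iterComul k H (n + 1)) with hF
      have h3 : ∀ (a : H) (w : H ⊗[k] H),
          (LinearMap.mulLeft k (x * a)).lTensor (⨂[k]^(n + 1) H) (antipodeHead k H (n + 1)
            (tcons s t * TensorProduct.lift (tcons.compl₂ (iterComul k H (n + 1))) w)) =
          F ((TensorProduct.assoc k H H H).symm (a ⊗ₜ w)) := by
        intro a w
        induction w using TensorProduct.induction_on with
        | zero => simp
        | tmul b b' =>
          simp [hF, tcons_mul_tcons, HopfAlgebra.antipode_mul_antidistrib, mul_assoc]
        | add a b ha hb => simp only [map_add, TensorProduct.tmul_add, mul_add, ha, hb]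
      have h4 : ∀ w : H ⊗[k] H, TensorProduct.lift ((LinearMap.lTensorHom (⨂[k]^(n + 1) H) ∘ₗ
          LinearMap.mul k H ∘ₗ LinearMap.mulLeft k x).compl₂ (antipodeHead k H (n + 1) ∘ₗ
            LinearMap.mulLeft k (tcons s t) ∘ₗ iterComul k H (n + 2))) w =
          F ((TensorProduct.assoc k H H H).symm (Coalgebra.comul.lTensor H w)) := by
        intro w
        induction w using TensorProduct.induction_on with
        | zero => simp
        | tmul a b =>
          rw [LinearMap.lTensor_tmul, ← h3, ← iterComul_succ]
          rfl
        | add a b ha hb => simp only [map_add, ha, hb]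
      have h5 : ∀ w : H ⊗[k] H, F (Coalgebra.comul.rTensor H w) =
          (t * iterComul k H (n + 1) (TensorProduct.lid k H (Coalgebra.counit.rTensor H w))) ⊗ₜ
            (x * HopfAlgebra.antipode k s) := by
        intro w
        induction w using TensorProduct.induction_on with
        | zero => simp
        | tmul a b =>
          simp [hF, HopfAlgebra.mul_antipode_lTensor_comul_apply, Algebra.algebraMap_eq_smul_one,
            TensorProduct.smul_tmul]
        | add a b ha hb => simp only [map_add, TensorProduct.add_tmul, mul_add, ha, hb]
      rw [h4, Coalgebra.coassoc_symm_apply, h5, Coalgebra.rTensor_counit_comul]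
      simp

variable {M : Type u} [AddCommGroup M] [Module k M] (l : H →ₗ[k] Module.End k M)

/-- The isomorphism `Z_n(H, M) ⊗ H ≃ Z_{n+1}(H, M)`,
`((v₀, …, vₙ) ⊗ m) ⊗ h ↦ ∑ (h v₀₍₁₎, v₀₍₂₎, v₁, …, vₙ) ⊗ m`. -/
noncomputable def hopfStep (n : ℕ) : HopfTensor l n ⊗[k] H →ₗ[k] HopfTensor l (n + 1) :=
  TensorProduct.lift ((balancedRel (diagonalAct k H (n + 1)) l).liftQ
    (TensorProduct.curry ((balancedRel (diagonalAct k H (n + 2)) l).mkQ ∘ₗ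
      (headStep k H n).rTensor M ∘ₗ
      (TensorProduct.rightComm k (⨂[k]^(n + 1) H) M H).toLinearMap))
    (balancedRel_le _ _ ⊥ _ fun c v m => by
      rw [Submodule.mem_bot, sub_eq_zero]
      ext h
      refine (Submodule.Quotient.eq _).2 (Submodule.subset_span
        ⟨c, headStep k H n (v ⊗ₜ h), m, ?_⟩)
      simp [diagonalAct_apply, headStep_tmul, comulAt_mul, comulAt_iterComul, mul_assoc]))

theorem hopfStep_mk_tmul (n : ℕ) (v : ⨂[k]^(n + 1) H) (m : M) (h : H) :
    hopfStep l n ((Submodule.Quotient.mk (v ⊗ₜ m) : HopfTensor l n) ⊗ₜ h) =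
      Submodule.Quotient.mk (headStep k H n (v ⊗ₜ h) ⊗ₜ m) := rfl

/-- The inverse of `hopfStep`. -/
noncomputable def hopfStepInv (n : ℕ) : HopfTensor l (n + 1) →ₗ[k] HopfTensor l n ⊗[k] H :=
  (balancedRel (diagonalAct k H (n + 2)) l).liftQ
    ((balancedRel (diagonalAct k H (n + 1)) l).mkQ.rTensor H ∘ₗ
      (TensorProduct.rightComm k (⨂[k]^(n + 1) H) H M).toLinearMap ∘ₗ
      (headStepInv k H n).rTensor M)
    (balancedRel_le _ _ ⊥ _ fun c v m => by
      rw [Submodule.mem_bot, sub_eq_zero]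
      simp only [LinearMap.comp_apply, LinearMap.rTensor_tmul, diagonalAct_apply,
        headStepInv_mul_iterComul]
      generalize headStepInv k H n v = z
      induction z using TensorProduct.induction_on with
      | zero => simp
      | tmul v h =>
        have : (Submodule.Quotient.mk ((v * iterComul k H (n + 1) c) ⊗ₜ m) : HopfTensor l n) =
            Submodule.Quotient.mk (v ⊗ₜ l c m) :=
          (Submodule.Quotient.eq _).2 (Submodule.subset_span ⟨c, v, m, rfl⟩)
        simp [this]
      | add a b ha hb => simp only [add_mul, TensorProduct.add_tmul, map_add, ha, hb])

theorem hopfStep_bijective (n : ℕ) : Function.Bijective (hopfStep l n) := by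
  have h0 : ∀ z m, hopfStepInv l n ((balancedRel (diagonalAct k H (n + 2)) l).mkQ (z ⊗ₜ m)) =
      (balancedRel (diagonalAct k H (n + 1)) l).mkQ.rTensor H
        (TensorProduct.rightComm k (⨂[k]^(n + 1) H) H M (headStepInv k H n z ⊗ₜ m)) :=
    fun z m => rfl
  refine Function.bijective_iff_has_inverse.2 ⟨hopfStepInv l n, fun z => ?_, fun z => ?_⟩
  · induction z using TensorProduct.induction_on with
    | zero => simp
    | add a b ha hb => simp only [map_add, ha, hb]
    | tmul x h =>
      obtain ⟨w, rfl⟩ := Submodule.mkQ_surjective _ x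
      induction w using TensorProduct.induction_on with
      | zero => simp
      | add a b ha hb => simp only [map_add, TensorProduct.add_tmul, ha, hb]
      | tmul v m =>
        rw [Submodule.mkQ_apply, hopfStep_mk_tmul, ← Submodule.mkQ_apply, h0,
          headStepInv_headStep]
        rfl
  · obtain ⟨w, rfl⟩ := Submodule.mkQ_surjective _ z
    induction w using TensorProduct.induction_on with
    | zero => simp
    | add a b ha hb => simp only [map_add, ha, hb]
    | tmul v m =>
      have h1 : ∀ u : (⨂[k]^(n + 1) H) ⊗[k] H,
          hopfStep l n ((balancedRel (diagonalAct k H (n + 1)) l).mkQ.rTensor H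
            (TensorProduct.rightComm k (⨂[k]^(n + 1) H) H M (u ⊗ₜ m))) =
          (balancedRel (diagonalAct k H (n + 2)) l).mkQ (headStep k H n u ⊗ₜ m) := by
        intro u
        induction u using TensorProduct.induction_on with
        | zero => simp
        | add a b ha hb => simp only [map_add, TensorProduct.add_tmul, ha, hb]
        | tmul v h => rfl
      rw [h0, h1, headStep_headStepInv]

end HopfStep

end HopfCyclic

/-! ### The map Z_n(A/B) ⊗ H → Z_{n+1}(A/B), by insertion of the translation map. -/

namespace HopfCyclic

variable {k : Type u} [Field k] {H : Type u} [Ring H] [HopfAlgebra k H] {A : Type u} [Ring A]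
  [Algebra k A] {B : Subalgebra k A}

theorem cyclicTensor_mk_tcons {n : ℕ} (x y : A) {b : A} (hb : b ∈ B) (z : ⨂[k]^n A) :
    (Submodule.Quotient.mk (tcons (x * b) (tcons y z)) : CyclicTensor B (n + 1)) =
      Submodule.Quotient.mk (tcons x (tcons (b * y) z)) := by
  suffices h : (cyclicRel B (n + 1)).mkQ ∘ₗ tcons (x * b) ∘ₗ tcons y =
    (cyclicRel B (n + 1)).mkQ ∘ₗ tcons x ∘ₗ tcons (b * y) from LinearMap.congr_fun h z
  apply PiTensorProduct.ext
  ext a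
  refine (Submodule.Quotient.eq _).2 ?_
  have := mem_cyclicRel (Fin.cons x (Fin.cons y a) : Fin (n + 2) → A) 0 hb
  convert this using 3
  · simp [tcons_tprod]
  · rw [zero_add, ← Fin.succ_zero_eq_one, ← Fin.cons_update]
    simp [tcons_tprod]

/-- The map `x₀ ⊗ x₁ ⊗ ⋯ ⊗ xₙ ↦ x₀u ⊗ y ⊗ x₁ ⊗ ⋯ ⊗ xₙ`, for `u ⊗ y` in `A ⊗_B A`. -/
noncomputable def insertPair (B : Subalgebra k A) (n : ℕ) :
    TensorOver B →ₗ[k] (⨂[k]^(n + 1) A) →ₗ[k] CyclicTensor B (n + 1) :=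
  (balancedRel (rightMul B) (leftMul B)).liftQ
    (TensorProduct.lift (LinearMap.mk₂ k
      (fun u y => (cyclicRel B (n + 1)).mkQ ∘ₗ
        tuncons (tcons.compl₂ (tcons y) ∘ₗ LinearMap.mulRight k u))
      (fun u u' y => tpow_ext fun x z => by simp [mul_add])
      (fun c u y => tpow_ext fun x z => by simp)
      (fun u y y' => tpow_ext fun x z => by simp)
      (fun c u y => tpow_ext fun x z => by simp)))
    (balancedRel_le _ _ ⊥ _ fun c u y => by
      rw [Submodule.mem_bot, sub_eq_zero]
      refine tpow_ext fun x z => ?_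
      have := cyclicTensor_mk_tcons (k := k) (x * u) y c.2 z
      simpa [rightMul, leftMul, mul_assoc] using this)

theorem insertPair_mk_tcons (n : ℕ) (u y x : A) (z : ⨂[k]^n A) :
    insertPair B n (Submodule.Quotient.mk (u ⊗ₜ y)) (tcons x z) =
      Submodule.Quotient.mk (tcons (x * u) (tcons y z)) := by
  change (cyclicRel B (n + 1)).mkQ (tuncons (tcons.compl₂ (tcons y) ∘ₗ LinearMap.mulRight k u)
    (tcons x z)) = _
  simp

theorem insertPair_lmulT (n : ℕ) (x y : A) (w : TensorOver B) (z : ⨂[k]^n A) :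
    insertPair B n (HopfGaloisExtension.lmulT B x w) (tcons y z) =
      insertPair B n w (tcons (y * x) z) := by
  induction w using HopfGaloisExtension.tensorOver_induction with
  | h0 => simp
  | h1 u v =>
    change insertPair B n (Submodule.Quotient.mk ((x * u) ⊗ₜ v)) (tcons y z) = _
    rw [insertPair_mk_tcons, insertPair_mk_tcons, mul_assoc]
  | h2 z w hz hw => simp only [map_add, LinearMap.add_apply, hz, hw]

/-- The tuple `(a₀u, y, a₁, …, aₙ)`. -/
def pairCons {n : ℕ} (u y : A) (a : Fin (n + 1) → A) : Fin (n + 2) → A :=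
  Fin.cons (a 0 * u) (Fin.cons y (Fin.tail a))

theorem pairCons_update_zero {n : ℕ} (u y v : A) (a : Fin (n + 1) → A) :
    pairCons u y (Function.update a 0 v) = Function.update (pairCons u y a) 0 (v * u) := by
  simp [pairCons]

theorem pairCons_update_succ {n : ℕ} (u y v : A) (a : Fin (n + 1) → A) (i : Fin n) :
    pairCons u y (Function.update a i.succ v) =
      Function.update (pairCons u y a) i.succ.succ v := by
  rw [pairCons, pairCons, Fin.tail_update_succ, Fin.cons_update, Fin.cons_update,
    Function.update_of_ne (Fin.succ_ne_zero i).symm]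

theorem pairCons_update_one {n : ℕ} (u y v : A) (a : Fin (n + 1) → A) :
    Function.update (pairCons u y a) 1 v = pairCons u v a := by
  rw [pairCons, pairCons, ← Fin.succ_zero_eq_one, ← Fin.cons_update, Fin.update_cons_zero]

theorem insertPair_mk_tprod (n : ℕ) (u y : A) (a : Fin (n + 1) → A) :
    insertPair B n (Submodule.Quotient.mk (u ⊗ₜ y)) (PiTensorProduct.tprod k a) =
      Submodule.Quotient.mk (PiTensorProduct.tprod k (pairCons u y a)) := by
  rw [tprod_eq_tcons, insertPair_mk_tcons, tcons_tprod, tcons_tprod]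
  rfl

/-- After the insertion, the factor that cyclically follows i in a directly follows position i + 1
of the longer tuple, so b can be passed to the left there. For i = 0 the neighbour on the left is
the inserted y; for the last i the relation wraps around. -/
theorem insertPair_mk_update_add_one (n : ℕ) (u y : A) (a : Fin (n + 1) → A) (i : Fin (n + 1))
    {b : A} (hb : b ∈ B) :
    insertPair B n (Submodule.Quotient.mk (u ⊗ₜ y))
        (PiTensorProduct.tprod k (Function.update a (i + 1) (b * a (i + 1)))) =
      Submodule.Quotient.mk (PiTensorProduct.tprod k
        (Function.update (pairCons u y a) i.succ (pairCons u y a i.succ * b))) := by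
  have h := (Submodule.Quotient.eq _).2 (mem_cyclicRel (pairCons u y a) i.succ hb)
  rw [h, insertPair_mk_tprod]
  congr 2
  induction i using Fin.lastCases with
  | last =>
    rw [Fin.succ_last, Fin.last_add_one, Fin.last_add_one, pairCons_update_zero, mul_assoc]
    rfl
  | cast i =>
    rw [Fin.coeSucc_eq_succ, Fin.succ_castSucc, Fin.coeSucc_eq_succ, pairCons_update_succ]
    rfl

theorem insertPair_update_zero (n : ℕ) (w : TensorOver B) (a : Fin (n + 1) → A) (b : A) :
    insertPair B n w (PiTensorProduct.tprod k (Function.update a 0 (a 0 * b))) =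
      insertPair B n (HopfGaloisExtension.lmulT B b w) (PiTensorProduct.tprod k a) := by
  rw [tprod_eq_tcons, tprod_eq_tcons a, insertPair_lmulT, Function.update_self,
    Fin.tail_update_zero]

theorem insertPair_update_one (n : ℕ) (w : TensorOver B) (a : Fin (n + 1) → A) {b : A}
    (hb : b ∈ B) :
    insertPair B n w (PiTensorProduct.tprod k (Function.update a (0 + 1) (b * a (0 + 1)))) =
      insertPair B n (HopfGaloisExtension.rmulT B b w) (PiTensorProduct.tprod k a) := by
  induction w using HopfGaloisExtension.tensorOver_induction with
  | h0 => simp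
  | h1 u y =>
    change _ = insertPair B n (Submodule.Quotient.mk (u ⊗ₜ (y * b))) _
    rw [insertPair_mk_update_add_one _ _ _ _ _ hb, insertPair_mk_tprod, Fin.succ_zero_eq_one,
      pairCons_update_one]
    rfl
  | h2 z w hz hw => simp only [map_add, LinearMap.add_apply, hz, hw]

theorem insertPair_update_succ (n : ℕ) (w : TensorOver B) (a : Fin (n + 1) → A) (i : Fin n)
    {b : A} (hb : b ∈ B) :
    insertPair B n w (PiTensorProduct.tprod k (Function.update a i.succ (a i.succ * b))) =
      insertPair B n w
        (PiTensorProduct.tprod k (Function.update a (i.succ + 1) (b * a (i.succ + 1)))) := by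
  induction w using HopfGaloisExtension.tensorOver_induction with
  | h0 => simp
  | h1 u y =>
    rw [insertPair_mk_update_add_one _ _ _ _ _ hb, insertPair_mk_tprod, pairCons_update_succ]
    rfl
  | h2 z w hz hw => simp only [map_add, LinearMap.add_apply, hz, hw]

namespace HopfGaloisExtension

variable (E : HopfGaloisExtension H B)

/-- Only the relation between the factors 0 and 1 is affected by the insertion: it becomes bκ(h) =
κ(h)b, which holds by `lmulT_translation`. The others persist as relations in the longer tensor. -/
theorem cyclicRel_le_ker_insertPair (n : ℕ) (h : H) :
    cyclicRel B n ≤ LinearMap.ker (insertPair B n (E.translation h)) := by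
  rw [cyclicRel, Submodule.span_le]
  rintro _ ⟨a, i, b, hb, rfl⟩
  rw [SetLike.mem_coe, LinearMap.mem_ker, map_sub, sub_eq_zero]
  induction i using Fin.cases with
  | zero =>
    rw [insertPair_update_zero, insertPair_update_one _ _ _ hb, E.lmulT_translation b hb]
  | succ i => exact insertPair_update_succ n _ a i hb

/-- The map `Z_n(A/B) ⊗ H → Z_{n+1}(A/B)`,
`(x₀ ⊗ x₁ ⊗ ⋯ ⊗ xₙ) ⊗ h ↦ ∑ x₀κ¹(h) ⊗ κ²(h) ⊗ x₁ ⊗ ⋯ ⊗ xₙ`. -/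
noncomputable def relStep (n : ℕ) : CyclicTensor B n ⊗[k] H →ₗ[k] CyclicTensor B (n + 1) :=
  TensorProduct.lift ((cyclicRel B n).liftQ (insertPair B n ∘ₗ E.translation).flip
    fun _ hz => LinearMap.ext fun h => E.cyclicRel_le_ker_insertPair n h hz)

/-- `a ↦ [xa ⊗ z]`. -/
noncomputable def headMap (B : Subalgebra k A) (n : ℕ) (x : A) (z : ⨂[k]^n A) :
    A →ₗ[k] CyclicTensor B n :=
  (cyclicRel B n).mkQ ∘ₗ tcons.flip z ∘ₗ LinearMap.mulLeft k x

/-- The canonical map sends a ⊗_B b to aρ(b), so that ∑ ab₍₀₎κ(b₍₁₎) = a ⊗_B b. -/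
theorem relStep_headMap_coact (n : ℕ) (a b : A) (z : ⨂[k]^n A) :
    E.relStep n ((headMap B n a z).rTensor H (E.coact b)) =
      Submodule.Quotient.mk (tcons a (tcons b z)) := by
  have h : ∀ w : A ⊗[k] H, E.relStep n ((headMap B n a z).rTensor H w) =
      insertPair B n (E.canonicalEquiv.symm ((a ⊗ₜ 1) * w)) (tcons 1 z) := by
    intro w
    induction w using TensorProduct.induction_on with
    | zero => simp
    | tmul x h =>
      rw [Algebra.TensorProduct.tmul_mul_tmul, one_mul, canonicalEquiv_symm_tmul,
        insertPair_lmulT, one_mul]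
      rfl
    | add a b ha hb => simp only [map_add, mul_add, LinearMap.add_apply, ha, hb]
  rw [h, ← canonicalEquiv_mk, LinearEquiv.symm_apply_apply, insertPair_mk_tcons, one_mul]

/-- Every generator is hit explicitly by `relStep_headMap_coact`. Injectivity will come from the
comparison with `hopfStep`. -/
theorem relStep_surjective (n : ℕ) : Function.Surjective (E.relStep n) := by
  rw [← LinearMap.range_eq_top, ← top_le_iff]
  suffices h : (LinearMap.range (E.relStep n)).mkQ ∘ₗ (cyclicRel B (n + 1)).mkQ = 0 by
    rintro x -
    obtain ⟨z, rfl⟩ := Submodule.mkQ_surjective _ x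
    exact (Submodule.Quotient.mk_eq_zero _).1 (LinearMap.congr_fun h z)
  refine tpow_ext fun a y => ?_
  suffices h : ((LinearMap.range (E.relStep n)).mkQ ∘ₗ (cyclicRel B (n + 1)).mkQ) ∘ₗ tcons a =
    0 from LinearMap.congr_fun h y
  refine tpow_ext fun b z => ?_
  exact (Submodule.Quotient.mk_eq_zero _).2 ⟨_, E.relStep_headMap_coact n a b z⟩

/-- `hopfStep` comultiplies the first entry and multiplies it on the left by b₍₁₎. By
`coactProd_tcons_one` the comultiplied value is a spread one, and ρ(b) times it is the spreading
that occurs at the factor b. -/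
theorem relToHopf_headMap_coact (n : ℕ) (a b : A) (z : ⨂[k]^n A) :
    hopfStep E.act n ((E.relToHopf n).rTensor H ((headMap B n a z).rTensor H (E.coact b))) =
      E.relToHopf (n + 1) (Submodule.Quotient.mk (tcons a (tcons b z))) := by
  have h1 : ∀ (x : A) (h : H) (X : A ⊗[k] (⨂[k]^(n + 1) H)),
      hopfStep E.act n (E.toHopf n ((x ⊗ₜ 1) * X) ⊗ₜ h) =
        E.toHopf (n + 1) ((x ⊗ₜ headIncl k H (n + 1) h) * (comulAt k H n 0).lTensor A X) := by
    intro x h X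
    induction X using TensorProduct.induction_on with
    | zero => simp
    | tmul c v =>
      rw [Algebra.TensorProduct.tmul_mul_tmul, one_mul, toHopf_tmul, hopfStep_mk_tmul,
        headStep_tmul, LinearMap.lTensor_tmul, Algebra.TensorProduct.tmul_mul_tmul]
      rfl
    | add a b ha hb => simp only [map_add, mul_add, TensorProduct.add_tmul, ha, hb]
  have h2 : ∀ w : A ⊗[k] H,
      hopfStep E.act n ((E.relToHopf n).rTensor H ((headMap B n a z).rTensor H w)) =
      E.toHopf (n + 1) ((a ⊗ₜ 1) * ((headIncl k H (n + 1)).toLinearMap.lTensor A w *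
        (comulAt k H n 0).lTensor A (E.coactProd n z))) := by
    intro w
    induction w using TensorProduct.induction_on with
    | zero => simp
    | tmul x h =>
      have : E.relToHopf n (headMap B n a z x) =
          E.toHopf n (((a * x) ⊗ₜ 1) * E.coactProd n z) := E.toHopfAux_tcons n (a * x) z
      rw [LinearMap.rTensor_tmul, LinearMap.rTensor_tmul, this, h1, LinearMap.lTensor_tmul,
        ← mul_assoc, Algebra.TensorProduct.tmul_mul_tmul, one_mul]
      rfl
    | add a b ha hb => simp only [map_add, mul_add, add_mul, ha, hb]
  rw [h2, relToHopf_mk, toHopfAux_tcons, coactProd_tcons, spread_tmul_one_mul,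
    ← coactProd_tcons_one, coactProd_tcons, ← Algebra.TensorProduct.one_def, one_mul]
  rfl

/-- By surjectivity of the canonical map it is enough to compare on ∑ [ab₍₀₎ ⊗ z] ⊗ b₍₁₎, where both
composites give the image of a ⊗ b ⊗ z. -/
theorem relToHopf_comp_relStep (n : ℕ) :
    E.relToHopf (n + 1) ∘ₗ E.relStep n = hopfStep E.act n ∘ₗ (E.relToHopf n).rTensor H := by
  have h1 : ∀ z : ⨂[k]^n A,
      (E.relToHopf (n + 1) ∘ₗ E.relStep n) ∘ₗ (headMap B n 1 z).rTensor H =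
        (hopfStep E.act n ∘ₗ (E.relToHopf n).rTensor H) ∘ₗ (headMap B n 1 z).rTensor H := by
    intro z
    refine E.ext_canonical fun x y => ?_
    have h2 : ∀ w : A ⊗[k] H, (headMap B n 1 z).rTensor H ((x ⊗ₜ 1) * w) =
        (headMap B n x z).rTensor H w := by
      intro w
      induction w using TensorProduct.induction_on with
      | zero => simp
      | tmul x h => simp [headMap]
      | add a b ha hb => simp only [map_add, mul_add, ha, hb]
    simp only [LinearMap.comp_apply]
    rw [h2, relStep_headMap_coact, relToHopf_headMap_coact]
  refine TensorProduct.ext ?_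
  refine Submodule.linearMap_qext _ (tpow_ext fun a z => ?_)
  apply LinearMap.ext
  intro h
  have h2 := LinearMap.congr_fun (h1 z) (a ⊗ₜ h)
  simpa [headMap] using h2

/-! ### Degree 0, the induction, and the conclusion. -/

theorem tpow_zero_eq_smul (z : ⨂[k]^0 A) : ∃ c : k, z = c • 1 := by
  induction z using PiTensorProduct.induction_on with
  | smul_tprod r a =>
    refine ⟨r, ?_⟩
    rw [PiTensorProduct.one_def]
    congr 2
    exact Subsingleton.elim _ _
  | add x y hx hy =>
    obtain ⟨c, rfl⟩ := hx
    obtain ⟨d, rfl⟩ := hy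
    exact ⟨c + d, (add_smul c d _).symm⟩

theorem coactProd_zero_one : E.coactProd 0 1 = 1 := by
  simp [coactProd, PiTensorProduct.one_def]

theorem toHopfAux_zero (a : A) : E.toHopfAux 0 (tcons a 1) = E.toHopf 0 (a ⊗ₜ 1) := by
  rw [toHopfAux_tcons, coactProd_zero_one, mul_one]

theorem tprod_fin_one (a : Fin 1 → A) : PiTensorProduct.tprod k a = tcons (a 0) 1 := by
  rw [tprod_eq_tcons, PiTensorProduct.one_def]
  congr 2
  exact Subsingleton.elim _ _

theorem subsingletonEquiv_headIncl (x : H) :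
    PiTensorProduct.subsingletonEquiv (0 : Fin 1) (headIncl k H 0 x) = x := by
  have h := tprod_fin_one (k := k) (fun _ : Fin 1 => x)
  rw [headIncl_apply, ← h, PiTensorProduct.subsingletonEquiv_apply_tprod]

theorem eq_headIncl (v : ⨂[k]^1 H) :
    v = headIncl k H 0 (PiTensorProduct.subsingletonEquiv (0 : Fin 1) v) := by
  induction v using tpow_induction with
  | h1 x y =>
    obtain ⟨c, rfl⟩ := tpow_zero_eq_smul y
    rw [map_smul, map_smul, map_smul, ← headIncl_apply, subsingletonEquiv_headIncl]
  | h2 z w hz hw => rw [map_add, map_add, ← hz, ← hw]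

/-- The map `Z_0(H, A_B) → A_B`, `h ⊗ m ↦ h m`. -/
noncomputable def hopfZero : HopfTensor E.act 0 →ₗ[k] CommQuot B :=
  (balancedRel (diagonalAct k H 1) E.act).liftQ
    (TensorProduct.lift (E.act ∘ₗ
      (PiTensorProduct.subsingletonEquiv (R := k) (s := fun _ : Fin 1 => H) 0).toLinearMap))
    (balancedRel_le _ _ ⊥ _ fun c v m => by
      rw [Submodule.mem_bot, sub_eq_zero]
      have h : PiTensorProduct.subsingletonEquiv (R := k) (s := fun _ : Fin 1 => H) 0
          (diagonalAct k H 1 c v) = PiTensorProduct.subsingletonEquiv 0 v * c := by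
        rw [diagonalAct_apply, iterComul_one]
        conv_lhs => rw [eq_headIncl v]
        rw [← map_mul, subsingletonEquiv_headIncl]
      simp only [TensorProduct.lift.tmul, LinearMap.comp_apply, LinearEquiv.coe_coe, h, act_mul])

theorem hopfZero_mk (v : ⨂[k]^1 H) (m : CommQuot B) :
    E.hopfZero (Submodule.Quotient.mk (v ⊗ₜ m)) =
      E.act (PiTensorProduct.subsingletonEquiv (0 : Fin 1) v) m := rfl

/-- In degree 0 the map is [a] ↦ 1 ⊗_H [a] from A_B to H ⊗_H A_B, with inverse h ⊗ m ↦ h·m. -/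
theorem relToHopf_zero_bijective : Function.Bijective (E.relToHopf 0) := by
  have h0 : ∀ a : A, E.relToHopf 0 (Submodule.Quotient.mk (tcons a 1)) =
      Submodule.Quotient.mk (1 ⊗ₜ Submodule.Quotient.mk a) := E.toHopfAux_zero
  constructor
  -- `f` identifies A_B with Z_0(A/B), so that `f ∘ₗ E.hopfZero` is the left inverse.
  · set f : CommQuot B →ₗ[k] CyclicTensor B 0 := (commutators B).liftQ
      ((cyclicRel B 0).mkQ ∘ₗ tcons.flip 1) (by
        refine Submodule.span_le.2 ?_
        rintro _ ⟨a, b, hb, rfl⟩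
        rw [SetLike.mem_coe, LinearMap.mem_ker, map_sub, sub_eq_zero]
        have := mem_cyclicRel (k := k) (fun _ : Fin 1 => a) 0 hb
        refine (Submodule.Quotient.eq _).2 ?_
        rw [tprod_fin_one, tprod_fin_one] at this
        exact this) with hf
    suffices h : (f ∘ₗ E.hopfZero) ∘ₗ E.relToHopf 0 = LinearMap.id from
      Function.LeftInverse.injective (g := f ∘ₗ E.hopfZero) (LinearMap.congr_fun h)
    refine Submodule.linearMap_qext _ (tpow_ext fun a y => ?_)
    obtain ⟨c, rfl⟩ := tpow_zero_eq_smul y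
    rw [map_smul, map_smul, map_smul]
    congr 1
    have h1 := subsingletonEquiv_headIncl (k := k) (1 : H)
    rw [map_one] at h1
    change f (E.hopfZero (E.relToHopf 0 (Submodule.Quotient.mk (tcons a 1)))) = _
    rw [h0, hopfZero_mk, h1, act_one]
    rfl
  · rw [← LinearMap.range_eq_top, ← top_le_iff]
    rintro x -
    obtain ⟨X, rfl⟩ := E.toHopf_surjective 0 x
    induction X using TensorProduct.induction_on with
    | zero => simp
    | tmul a v =>
      -- b represents v·[a]; the balanced relation gives v ⊗ [a] = 1 ⊗ v·[a].
      obtain ⟨b, hb⟩ := Submodule.Quotient.mk_surjective _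
        (E.act (PiTensorProduct.subsingletonEquiv (0 : Fin 1) v) (Submodule.Quotient.mk a))
      refine ⟨Submodule.Quotient.mk (tcons b 1), ?_⟩
      rw [h0, hb, ← hopfTensor_mk_mul_iterComul, iterComul_one, one_mul, ← eq_headIncl]
      rfl
    | add a b ha hb => rw [map_add]; exact Submodule.add_mem _ ha hb

/-- In the square of `relToHopf_comp_relStep` the path through `hopfStep` is bijective by induction.
So `relStep` is injective, hence bijective, and it can be cancelled. -/
theorem relToHopf_bijective (n : ℕ) : Function.Bijective (E.relToHopf n) := by
  induction n with
  | zero => exact E.relToHopf_zero_bijective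
  | succ n ih =>
    have h1 : Function.Bijective ((E.relToHopf n).rTensor H) :=
      ((LinearEquiv.ofBijective _ ih).rTensor H).bijective
    have h2 : Function.Bijective (E.relToHopf (n + 1) ∘ E.relStep n) := by
      rw [← LinearMap.coe_comp, relToHopf_comp_relStep, LinearMap.coe_comp]
      exact (hopfStep_bijective E.act n).comp h1
    have h3 : Function.Bijective (E.relStep n) := ⟨h2.injective.of_comp, E.relStep_surjective n⟩
    exact (Function.Bijective.of_comp_iff _ h3).1 h2

/-- The cyclic axioms, including the order n + 1 of the operator, are inherited from the rotation on
Z_*(A/B) through surjectivity of the comparison map. -/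
theorem isCyclicOperator_cyclicOp :
    IsCyclicOperator (hopfSimplicialModule E.act) E.cyclicOp :=
  IsCyclicOperator.of_surjective (relCyclicModule B) _ _ E.relToHopf
    (fun n => (E.relToHopf_bijective n).surjective) E.relToHopf_d E.relToHopf_s E.relToHopf_t

end HopfGaloisExtension

end HopfCyclic

theorem mainTheorem1 {k H A : Type u} [Field k] [Ring H] [HopfAlgebra k H] [Ring A] [Algebra k A]
    (B : Subalgebra k A) (E : HopfCyclic.HopfGaloisExtension H B) :
    ∃ τ : ∀ n : ℕ, (HopfCyclic.hopfSimplicialModule E.act).obj n →ₗ[k]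
        (HopfCyclic.hopfSimplicialModule E.act).obj n,
      (∀ (n : ℕ) (h : Fin (n + 1) → H) (a : HopfCyclic.CommQuot B) (r : ℕ)
        (a₀ : Fin r → HopfCyclic.CommQuot B) (a₁ : Fin r → H),
        E.coactQuot a = ∑ i, a₀ i ⊗ₜ[k] a₁ i →
          τ n (HopfCyclic.hopfTensorMk E.act h a) =
            ∑ i, HopfCyclic.hopfTensorMk E.act
              (Fin.cons (h (Fin.last n) * a₁ i) (Fin.init h)) (a₀ i)) ∧
      ∃ hτ : HopfCyclic.IsCyclicOperator (HopfCyclic.hopfSimplicialModule E.act) τ,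
        ∃ φ : (HopfCyclic.relCyclicModule B).Hom
            ⟨HopfCyclic.hopfSimplicialModule E.act, τ, hτ⟩,
          φ.IsIso ∧ ∀ n : ℕ, CategoryTheory.IsIso (φ.HCMap n) := by
  let φ : (HopfCyclic.relCyclicModule B).Hom
      ⟨HopfCyclic.hopfSimplicialModule E.act, E.cyclicOp, E.isCyclicOperator_cyclicOp⟩ :=
    ⟨E.relToHopf, E.relToHopf_d, E.relToHopf_s, E.relToHopf_t⟩
  have hφ : φ.IsIso := E.relToHopf_bijective
  exact ⟨E.cyclicOp, E.cyclicOp_hopfTensorMk, E.isCyclicOperator_cyclicOp, φ, hφ, hφ.isIso_HCMap⟩
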